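/- Let $d\ge 1$ be an integer and let $$D_d=\{z\in\mathbb{C}^d : z_i z_{i+1}\cdots z_j\notin[0,\infty)\ \text{for all } 1\le i\le j\le d\}.$$ For $n=(n_1,\dots,n_d)\in\mathbb{N}^d$ (all $n_i\ge 1$) write $|n|=n_1+\cdots+n_d$ and $|n|_0=|n|-d$. Then the multiple polylogarithm given near $z=0$ by $$\mathrm{Li}_n(z)=\sum_{0<k_1<\cdots<k_d}\frac{z_1^{k_1}\cdots z_d^{k_d}}{k_1^{n_1}\cdots k_d^{n_d}}$$ has an analytic continuation along the straight path from $0$ to any $z\in D_d$, and $\mathrm{Li}_n(z)$ denotes the value of this continuation at $z$. Put $1/z=(1/z_1,\dots,1/z_d)$. The function $$\mathrm{PLi}_n(z)=\mathrm{Li}_n(z)-(-1)^{|n|_0}\,\mathrm{Li}_n(1/z),\qquad z\in D_d,$$ is of depth at most $d-1$: on $D_d$ it is a finite $\mathbb{Q}$-linear combination (with coefficients independent of $z$) of functions of the form $$(2\pi i)^{k_0}\ \prod_{i=1}^{d}\log^{k_i}(-z_i z_{i+1}\cdots z_d)\ \prod_{i=1}^{s}\mathrm{Li}_{n^{(i)}}\bigl(z^{(i)}\bigr),$$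 where $\log$ is the principal branch, $s,k_0,\dots,k_d\ge 0$ are integers, and * the indices $n^{(i)}\in\mathbb{N}^{d_i}$ ($d_i\ge 1$) have total depth $d_1+\cdots+d_s<d$; * the weight is preserved: $k_0+k_1+\cdots+k_d+\sum_{i=1}^{s}|n^{(i)}|=|n|$; * every entry $z^{(i)}_j$ of the argument vectors is a consecutive product $z_\mu z_{\mu+1}\cdots z_\nu$ with $\mu\le\nu$ (depending on $i,j$), and $z^{(i)}\in D_{d_i}$ for all $z\in D_d$, so that all factors are well defined on $D_d$. -/

import Mathlib

open scoped Topology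

noncomputable section

/-- The consecutive product `z_i z_{i+1} ⋯ z_j`. -/
def consecProd {d : ℕ} (z : Fin d → ℂ) (i j : Fin d) : ℂ :=
  ∏ l ∈ Finset.Icc i j, z l

/-- The product `z_i z_{i+1} ⋯ z_d` up to the last variable. -/
def tailProd {d : ℕ} (z : Fin d → ℂ) (i : Fin d) : ℂ :=
  ∏ l ∈ Finset.Ici i, z l

/-- The set of all `z ∈ ℂ^d` such that no consecutive product `z_i ⋯ z_j` (`i ≤ j`) lies in
`[0, ∞)`. -/
def mplDomain (d : ℕ) : Set (Fin d → ℂ) :=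
  {z | ∀ i j : Fin d, i ≤ j → ∀ r : ℝ, 0 ≤ r → consecProd z i j ≠ (r : ℂ)}

/-- The series `∑_{0 < k_1 < ⋯ < k_d} z_1^{k_1} ⋯ z_d^{k_d} / (k_1^{n_1} ⋯ k_d^{n_d})`, which
converges absolutely when all `|z_i| < 1`. -/
def mplSeries {d : ℕ} (n : Fin d → ℕ) (z : Fin d → ℂ) : ℂ :=
  ∑' k : {k : Fin d → ℕ // StrictMono k ∧ ∀ i, 0 < k i},
    ∏ i, z i ^ k.1 i / (k.1 i : ℂ) ^ n i

/-- `F` is an analytic continuation, along the straight path from `0` to `z`, of the germ at `0` of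
the series `mplSeries n`: it is holomorphic on an open set containing the closed segment from `0`
to `z`, and it agrees with the series near `0`. -/
def IsMPLContinuation {d : ℕ} (n : Fin d → ℕ) (z : Fin d → ℂ) (F : (Fin d → ℂ) → ℂ) : Prop :=
  ∃ U : Set (Fin d → ℂ), IsOpen U ∧ segment ℝ 0 z ⊆ U ∧ DifferentiableOn ℂ F U ∧
    F =ᶠ[𝓝 0] mplSeries n

/-- The value at the end point of the straight path does not depend on the continuation. -/
theorem IsMPLContinuation.value_unique {d : ℕ} {n : Fin d → ℕ} {z : Fin d → ℂ}
    {F G : (Fin d → ℂ) → ℂ} (hF : IsMPLContinuation n z F) (hG : IsMPLContinuation n z G) :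
    F z = G z := by
  have key : ∀ {H : (Fin d → ℂ) → ℂ}, IsMPLContinuation n z H →
      AnalyticOnNhd ℂ (fun t : ℂ => H (t • z)) (segment ℝ (0 : ℂ) 1) := by
    rintro H ⟨U, hU, hs, hd, -⟩ t ht
    have hc : Continuous fun t : ℂ => t • z := by fun_prop
    have hV : IsOpen ((fun t : ℂ => t • z) ⁻¹' U) := hU.preimage hc
    have hdV : DifferentiableOn ℂ (fun t : ℂ => H (t • z)) ((fun t : ℂ => t • z) ⁻¹' U) :=
      hd.comp (by fun_prop) (Set.mapsTo_preimage _ _)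
    refine hdV.analyticAt (hV.mem_nhds (hs ?_))
    obtain ⟨a, b, ha, hb, hab, rfl⟩ := ht
    refine ⟨a, b, ha, hb, hab, ?_⟩
    ext i
    simp
  have hev : (fun t : ℂ => F (t • z)) =ᶠ[𝓝 0] fun t : ℂ => G (t • z) := by
    obtain ⟨_, _, _, _, h1⟩ := hF
    obtain ⟨_, _, _, _, h2⟩ := hG
    have hc : Filter.Tendsto (fun t : ℂ => t • z) (𝓝 0) (𝓝 0) := by
      have h : Continuous fun t : ℂ => t • z := by fun_prop
      simpa using h.tendsto 0
    exact hc.eventually (h1.trans h2.symm)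
  have h := (key hF).eqOn_of_preconnected_of_eventuallyEq (key hG)
    (convex_segment (𝕜 := ℝ) (0 : ℂ) 1).isPreconnected (left_mem_segment ℝ 0 1) hev
    (right_mem_segment ℝ (0 : ℂ) 1)
  simpa using h

open Classical in
/-- The multiple polylogarithm `Li_n(z)`: the value at `z` of the analytic continuation of the
series along the straight path from `0` to `z` (and `0` when there is no such continuation). -/
def mpl {d : ℕ} (n : Fin d → ℕ) (z : Fin d → ℂ) : ℂ :=
  if h : ∃ F, IsMPLContinuation n z F then h.choose z else 0

theorem IsMPLContinuation.mpl_eq {d : ℕ} {n : Fin d → ℕ} {z : Fin d → ℂ}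
    {F : (Fin d → ℂ) → ℂ} (hF : IsMPLContinuation n z F) : mpl n z = F z := by
  have h : ∃ F, IsMPLContinuation n z F := ⟨F, hF⟩
  rw [mpl, dif_pos h]
  exact h.choose_spec.value_unique hF

/-- `PLi_n(z) = Li_n(z) - (-1)^{|n| - d} Li_n(1/z)`. -/
def pli {d : ℕ} (n : Fin d → ℕ) (z : Fin d → ℂ) : ℂ :=
  mpl n z - (-1) ^ ((∑ i, n i) - d) * mpl n (fun i => (z i)⁻¹)

/-- The data of a product
`(2πi)^{k₀} ∏_i log^{k_i}(-z_i ⋯ z_d) ∏_{i=1}^s Li_{n^{(i)}}(z^{(i)})`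
in which `n^{(i)}` is an index of depth `d_i = dep i` with positive entries and every argument
`z^{(i)}_j` is a consecutive product `z_μ ⋯ z_ν`, with `μ = lo i j ≤ ν = hi i j`. -/
structure MPLProduct (d : ℕ) where
  k₀ : ℕ
  k : Fin d → ℕ
  s : ℕ
  dep : Fin s → ℕ
  dep_pos : ∀ i, 0 < dep i
  idx : ∀ i : Fin s, Fin (dep i) → ℕ
  idx_pos : ∀ i j, 0 < idx i j
  lo : ∀ i : Fin s, Fin (dep i) → Fin d
  hi : ∀ i : Fin s, Fin (dep i) → Fin d
  lo_le_hi : ∀ i j, lo i j ≤ hi i j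

namespace MPLProduct

variable {d : ℕ}

/-- The total depth `d_1 + ⋯ + d_s`. -/
def depth (T : MPLProduct d) : ℕ := ∑ i, T.dep i

/-- The total weight `k_0 + k_1 + ⋯ + k_d + ∑_i |n^{(i)}|`. -/
def weight (T : MPLProduct d) : ℕ := T.k₀ + ∑ i, T.k i + ∑ i, ∑ j, T.idx i j

/-- The vector of arguments `z^{(i)}`. -/
def args (T : MPLProduct d) (z : Fin d → ℂ) (i : Fin T.s) : Fin (T.dep i) → ℂ :=
  fun j => consecProd z (T.lo i j) (T.hi i j)

/-- All factors `Li_{n^{(i)}}(z^{(i)})` are unambiguously defined for `z` in the domain: the argument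
vectors `z^{(i)}` lie in the corresponding domain in `d_i` variables. -/
def WellDefined (T : MPLProduct d) : Prop :=
  ∀ z ∈ mplDomain d, ∀ i, T.args z i ∈ mplDomain (T.dep i)

/-- The value of the product at `z`. -/
def eval (T : MPLProduct d) (z : Fin d → ℂ) : ℂ :=
  (2 * Real.pi * Complex.I) ^ T.k₀ * (∏ i, Complex.log (-tailProd z i) ^ T.k i) *
    ∏ i, mpl (T.idx i) (T.args z i)

end MPLProduct

end

/-! Put `t_i = z_i ⋯ z_d`. In the variable `x = e^s`, `Li_n(z)` is an iterated integral over chains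
`s_1 < ⋯ < s_d < 0` built from the kernels `ker t_i` and from extra integrations `ds`. The latter
are absorbed into a generating function: giving the `i`-th kernel the factor `e^{-y_i ε s}` produces
a function of `ε` whose expansion at `0` collects all `Li_{m+1}(z)`, `m` a vector of exponents, with
coefficients the monomials of exponent `m` in the partial sums `y_1 + ⋯ + y_i` (`genInt_hasAsymp`,
`coef_eq`). The power of `ε` records the weight, and as the `y_i` are arbitrary positive rationals,
the single indices can be recovered at the end (`mem_of_forall_ratWt`).

Reversing the chain at `0` (`low_antipode`) writes this integral over `s < 0` as `(-1)^d` times the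
one over `s > 0`, plus signed products of an integral of `i` kernels over `s > 0` and an integral of
`d - i` kernels over the whole line. Two facts then give the theorem.

Reflection: `ker t (-s) = -(1 + ker t⁻¹ s)` (`wker_neg`), so `s ↦ -s` turns the integral over `s >
0` into one for `1/z` with `y` replaced by `-y`; this sign change is the source of `(-1)^{|n|_0}`.
Each constant `1` can be integrated out at the cost of a factor `1/ε` and with a loss of depth
(`low_mker_expansion`).

Partial fractions: `∏_j ker t_j s_j = ∑_v ker t_v s_v ∏_{j≠v} ker (t_j/t_v) (s_j - s_v)`. Over the
whole line the variable `s_v` separates (`full_wker_eq_splits`), and its integral is elementary, `-π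
/ sin(πY) · e^{Y log(-t_v)}` with `Y` the total weight (`kerInt_eq_mul`, `kerInt_neg_one`), so it
contributes only `2πi` and `log(-t_v)`. Hence an integral of `d - i` kernels over the line has depth
at most `d - i - 1`, and every product above has depth at most `d - 1`.

The arguments that occur are quotients `t_a/t_b` with `a < b`, which are consecutive products, and
inverses `1/t_c`. The latter occur in smaller depth only, where `Li(1/z) = ±(Li(z) - PLi(z))` and
induction on the depth remove them (`representable_inv_tl`). Depth and weight are tracked by
`PolyAsymp`: Laurent expansions in `ε` whose coefficients lie in prescribed rational spans.

The continuation itself is given by the same iterated integral, which is holomorphic as long as no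
`t_i` lies in `[1, ∞)` and agrees with the series near `0` (`isMPLContinuation_Lw`). -/

open MeasureTheory Set Filter Asymptotics

namespace MPLParity

/-! ### Iterated integrals over chains -/

/-- The iterated integral of `f_d(s_d) ⋯ f_1(s_1)` over `s_1 < ⋯ < s_d < b`, for the list
`[f_d, …, f_1]`. -/
noncomputable def low : List (ℝ → ℂ) → ℝ → ℂ
  | [], _ => 1
  | f :: l, b => ∫ s in Iic b, f s * low l s

/-- The iterated integral of `f_d(s_d) ⋯ f_1(s_1)` over `b < s_d < ⋯ < s_1`, for the list
`[f_d, …, f_1]`. -/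
noncomputable def upp : List (ℝ → ℂ) → ℝ → ℂ
  | [], _ => 1
  | f :: l, b => ∫ s in Ioi b, f s * upp l s

/-- The iterated integral of `f_d(s_d) ⋯ f_1(s_1)` over `s_1 < ⋯ < s_d`. -/
noncomputable def full : List (ℝ → ℂ) → ℂ
  | [] => 0
  | f :: l => ∫ s, f s * low l s

theorem upp_eq_low (l : List (ℝ → ℂ)) (b : ℝ) :
    upp l b = low (l.map fun f s => f (-s)) (-b) := by
  induction l generalizing b with
  | nil => rfl
  | cons f l ih =>
    simp only [upp, List.map_cons, low]
    rw [← integral_comp_neg_Ioi]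
    refine integral_congr_ae (.of_forall fun s => ?_)
    simp [ih]

theorem low_map_congr {α : Type*} {L : List α} {φ ψ : α → ℝ → ℂ} {b : ℝ}
    (h : ∀ x ∈ L, ∀ s ≤ b, φ x s = ψ x s) : low (L.map φ) b = low (L.map ψ) b := by
  induction L generalizing b with
  | nil => rfl
  | cons x L ih =>
    simp only [List.map_cons, low]
    refine setIntegral_congr_fun measurableSet_Iic fun s hs => ?_
    rw [h x List.mem_cons_self s hs,
      ih fun y hy r hr => h y (List.mem_cons_of_mem _ hy) r (hr.trans hs)]

theorem continuous_integral_Iic {E : Type*} [NormedAddCommGroup E] [NormedSpace ℝ E] {g : ℝ → E}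
    (hg : ∀ b, IntegrableOn g (Iic b)) :
    Continuous fun b => ∫ s in Iic b, g s := by
  have h : (fun b => ∫ s in Iic b, g s) = fun b => (∫ s in Iic 0, g s) + ∫ s in (0 : ℝ)..b, g s := by
    ext b
    rw [← intervalIntegral.integral_Iic_sub_Iic (hg 0) (hg b), add_sub_cancel]
  rw [h]
  refine continuous_const.add (intervalIntegral.continuous_primitive (fun a b => ?_) 0)
  rw [intervalIntegrable_iff]
  exact (hg (max a b)).mono_set fun x hx => hx.2

/-- Both properties are proved together, since bounding and integrating the outer factor needs both
for the inner integral. A general lower set `S` covers the half-lines `Iic b`, needed for kernels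
integrable only at `-∞`, as well as the whole line. -/
theorem low_continuous_bdd {l : List (ℝ → ℂ)} (hl : ∀ f ∈ l, ∀ b, IntegrableOn f (Iic b)) :
    Continuous (low l) ∧ ∀ S : Set ℝ, IsLowerSet S → MeasurableSet S →
      (∀ f ∈ l, IntegrableOn f S) → ∃ C, ∀ s ∈ S, ‖low l s‖ ≤ C := by
  induction l with
  | nil => exact ⟨continuous_const, fun _ _ _ _ => ⟨1, by simp [low]⟩⟩
  | cons f l ih =>
    obtain ⟨hc, hb⟩ := ih fun g hg => hl g (List.mem_cons_of_mem _ hg)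
    constructor
    · refine continuous_integral_Iic fun b => ?_
      obtain ⟨C, hC⟩ := hb (Iic b) (isLowerSet_Iic b) measurableSet_Iic
        fun g hg => hl g (List.mem_cons_of_mem _ hg) b
      exact (hl f List.mem_cons_self b).mul_bdd (c := C) hc.aestronglyMeasurable
        (ae_restrict_of_forall_mem measurableSet_Iic hC)
    · intro S hS hSm hfS
      obtain ⟨C, hC⟩ := hb S hS hSm fun g hg => hfS g (List.mem_cons_of_mem _ hg)
      refine ⟨∫ s in S, ‖f s‖ * C, fun b hbS => ?_⟩
      have hsub : Iic b ⊆ S := fun x hx => hS hx hbS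
      have hint : IntegrableOn (fun s => ‖f s‖ * C) S :=
        (hfS f List.mem_cons_self).norm.mul_const C
      have hC0 : 0 ≤ C := (norm_nonneg _).trans (hC b hbS)
      simp only [low]
      refine (norm_integral_le_of_norm_le (hint.mono_set hsub)
        (ae_restrict_of_forall_mem measurableSet_Iic fun s hs => ?_)).trans
        (setIntegral_mono_set hint (.of_forall fun s => by positivity) hsub.eventuallyLE)
      rw [norm_mul]
      exact mul_le_mul_of_nonneg_left (hC s (hsub hs)) (norm_nonneg _)

theorem low_continuous {l : List (ℝ → ℂ)} (hl : ∀ f ∈ l, ∀ b, IntegrableOn f (Iic b)) :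
    Continuous (low l) := (low_continuous_bdd hl).1

theorem low_integrableOn {f : ℝ → ℂ} {l : List (ℝ → ℂ)}
    (hl : ∀ g ∈ f :: l, ∀ b, IntegrableOn g (Iic b)) (b : ℝ) :
    IntegrableOn (fun s => f s * low l s) (Iic b) := by
  obtain ⟨hc, hb⟩ := low_continuous_bdd fun g hg => hl g (List.mem_cons_of_mem _ hg)
  obtain ⟨C, hC⟩ := hb (Iic b) (isLowerSet_Iic b) measurableSet_Iic
    fun g hg => hl g (List.mem_cons_of_mem _ hg) b
  exact (hl f List.mem_cons_self b).mul_bdd (c := C) hc.aestronglyMeasurable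
    (ae_restrict_of_forall_mem measurableSet_Iic hC)

theorem low_continuous_of_integrable {l : List (ℝ → ℂ)} (hl : ∀ f ∈ l, Integrable f) :
    Continuous (low l) := low_continuous fun f hf _ => (hl f hf).integrableOn

theorem low_bdd_of_integrable {l : List (ℝ → ℂ)} (hl : ∀ f ∈ l, Integrable f) :
    ∃ C, ∀ s, ‖low l s‖ ≤ C := by
  obtain ⟨C, hC⟩ := (low_continuous_bdd fun f hf _ => (hl f hf).integrableOn).2 univ
    isLowerSet_univ .univ fun f hf => (hl f hf).integrableOn
  exact ⟨C, fun s => hC s (mem_univ s)⟩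

theorem integrable_mul_low {f : ℝ → ℂ} {l : List (ℝ → ℂ)} (hf : Integrable f)
    (hl : ∀ f ∈ l, Integrable f) : Integrable fun s => f s * low l s := by
  obtain ⟨C, hC⟩ := low_bdd_of_integrable hl
  exact hf.mul_bdd (c := C) (low_continuous_of_integrable hl).aestronglyMeasurable
    (.of_forall hC)

theorem forall_integrable_neg {l : List (ℝ → ℂ)} (hl : ∀ f ∈ l, Integrable f) :
    ∀ f ∈ l.map (fun (f : ℝ → ℂ) s => f (-s)), Integrable f := by
  intro f hf
  obtain ⟨g, hg, rfl⟩ := List.mem_map.1 hf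
  exact (hl g hg).comp_neg

theorem upp_continuous {l : List (ℝ → ℂ)} (hl : ∀ f ∈ l, Integrable f) : Continuous (upp l) := by
  have h : upp l = fun b => low (l.map fun f s => f (-s)) (-b) := funext (upp_eq_low l)
  rw [h]
  exact (low_continuous_of_integrable (forall_integrable_neg hl)).comp continuous_neg

theorem integrable_mul_upp {f : ℝ → ℂ} {l : List (ℝ → ℂ)} (hf : Integrable f)
    (hl : ∀ f ∈ l, Integrable f) : Integrable fun s => f s * upp l s := by
  obtain ⟨C, hC⟩ := low_bdd_of_integrable (forall_integrable_neg hl)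
  exact hf.mul_bdd (c := C) (upp_continuous hl).aestronglyMeasurable
    (.of_forall fun s => by rw [upp_eq_low]; exact hC _)

/-- Reversal of a chain with respect to the base point `b`. -/
theorem low_antipode {l : List (ℝ → ℂ)} (hl : ∀ f ∈ l, Integrable f) (b : ℝ) :
    low l b = (-1) ^ l.length * upp l b +
      ∑ i ∈ Finset.range l.length, (-1) ^ i * (upp (l.take i) b * full (l.drop i)) := by
  induction l generalizing b with
  | nil => simp [low, upp]
  | cons f l ih =>
    have hl' : ∀ g ∈ l, Integrable g := fun g hg => hl g (List.mem_cons_of_mem _ hg)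
    have hf : Integrable f := hl f List.mem_cons_self
    -- The constraint `s < b` on the outermost variable is traded for the whole line minus `s > b`.
    -- The first part is the term `i = 0` of the sum; in the second, the induction hypothesis at
    -- base point `s` lets every `upp` absorb the factor `f`.
    have h1 : low (f :: l) b = full (f :: l) - ∫ s in Ioi b, f s * low l s := by
      have := integral_add_compl (measurableSet_Iic (a := b)) (integrable_mul_low hf hl')
      rw [compl_Iic] at this
      simp only [low, full]
      rw [← this]
      ring
    have h2 : ∫ s in Ioi b, f s * low l s = (-1) ^ l.length * upp (f :: l) b +
        ∑ i ∈ Finset.range l.length,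
          (-1) ^ i * (upp (f :: l.take i) b * full (l.drop i)) := by
      have hi : ∀ i, Integrable fun s => f s * upp (l.take i) s := fun i =>
        integrable_mul_upp hf fun g hg => hl' g (List.mem_of_mem_take hg)
      have : ∀ s, f s * low l s = (-1) ^ l.length * (f s * upp l s) +
          ∑ i ∈ Finset.range l.length,
            (-1) ^ i * full (l.drop i) * (f s * upp (l.take i) s) := by
        intro s
        rw [ih hl' s, mul_add, Finset.mul_sum]
        congr 1
        · ring
        · exact Finset.sum_congr rfl fun i _ => by ring
      simp only [this]
      rw [integral_add, integral_const_mul, integral_finsetSum]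
      · congr 1
        refine Finset.sum_congr rfl fun i _ => ?_
        rw [integral_const_mul]
        simp only [upp]
        ring
      · exact fun i _ => ((hi i).integrableOn).const_mul _
      · exact ((integrable_mul_upp hf hl').integrableOn).const_mul _
      · exact integrable_finsetSum _ fun i _ => ((hi i).integrableOn).const_mul _
    rw [h1, h2, List.length_cons, Finset.sum_range_succ']
    simp only [List.take_succ_cons, List.drop_succ_cons, List.take_zero, List.drop_zero, upp,
      pow_zero, one_mul]
    rw [sub_eq_add_neg, neg_add, ← Finset.sum_neg_distrib]
    simp only [pow_succ]
    rw [add_comm, add_assoc]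
    congr 1
    · ring
    · congr 1
      exact Finset.sum_congr rfl fun i _ => by ring

/-! ### Reading a chain from its other end -/

theorem integral_mul_integral_swap {F G : ℝ → ℂ} (hF : Integrable F) (hG : Integrable G) :
    ∫ s, F s * ∫ u in Iic s, G u = ∫ u, G u * ∫ s in Ioi u, F s := by
  have hS : MeasurableSet {p : ℝ × ℝ | p.2 ≤ p.1} := measurableSet_le measurable_snd measurable_fst
  have hint : Integrable (Function.uncurry fun s u : ℝ =>
      {p : ℝ × ℝ | p.2 ≤ p.1}.indicator (fun p => F p.1 * G p.2) (s, u)) (volume.prod volume) :=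
    (hF.mul_prod hG).indicator hS
  have h := integral_integral_swap hint
  refine Eq.trans (integral_congr_ae (.of_forall fun s => ?_))
    (h.trans (integral_congr_ae (.of_forall fun u => ?_)))
  · simp only
    rw [← integral_const_mul, ← integral_indicator measurableSet_Iic]
    rfl
  · simp only
    rw [← integral_Ici_eq_integral_Ioi, ← integral_const_mul, ← integral_indicator measurableSet_Ici]
    refine integral_congr_ae (.of_forall fun s => ?_)
    simp only [indicator, mem_ofPred_eq, mem_Ici]
    split_ifs <;> ring

/-- The iterated integral of `f_1(s_1) ⋯ f_d(s_d)` over `s_1 < ⋯ < s_d`, for the list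
`[f_1, …, f_d]`. -/
noncomputable def fullUpp : List (ℝ → ℂ) → ℂ
  | [] => 0
  | f :: l => ∫ s, f s * upp l s

/-- Fubini moves one factor at a time from the part below the marked variable `s` to the part above
it. Keeping both parts arbitrary is what makes the induction run; `q = []` is the case of interest.
-/
theorem integral_mul_low_mul_upp (p : List (ℝ → ℂ)) (f : ℝ → ℂ) (q : List (ℝ → ℂ))
    (hp : ∀ g ∈ p, Integrable g) (hf : Integrable f) (hq : ∀ g ∈ q, Integrable g) :
    ∫ s, f s * upp q s * low p s = fullUpp (p.reverse ++ f :: q) := by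
  induction p generalizing f q with
  | nil => simp [low, fullUpp]
  | cons g p ih =>
    have hp' : ∀ h ∈ p, Integrable h := fun h hh => hp h (List.mem_cons_of_mem _ hh)
    have hg : Integrable g := hp g List.mem_cons_self
    simp only [low]
    rw [integral_mul_integral_swap (integrable_mul_upp hf hq) (integrable_mul_low hg hp')]
    have := ih g (f :: q) hp' hg (by
      intro h hh
      rcases List.mem_cons.1 hh with rfl | hh
      exacts [hf, hq h hh])
    simp only [List.reverse_cons, List.append_assoc, List.singleton_append]
    rw [← this]
    refine integral_congr_ae (.of_forall fun s => ?_)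
    simp only [upp]
    ring

theorem full_eq_fullUpp_reverse (l : List (ℝ → ℂ)) (hl : ∀ g ∈ l, Integrable g) :
    full l = fullUpp l.reverse := by
  cases l with
  | nil => rfl
  | cons f l =>
    have := integral_mul_low_mul_upp l f [] (fun g hg => hl g (List.mem_cons_of_mem _ hg))
      (hl f List.mem_cons_self) (by simp)
    simpa [upp, full] using this

/-- Truncation of a function to the positive axis. -/
noncomputable def pos (f : ℝ → ℂ) : ℝ → ℂ := (Ioi 0).indicator f

theorem Integrable.pos {f : ℝ → ℂ} (hf : Integrable f) : Integrable (pos f) :=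
  hf.indicator measurableSet_Ioi

theorem upp_map_pos (l : List (ℝ → ℂ)) {b : ℝ} (hb : 0 ≤ b) : upp (l.map pos) b = upp l b := by
  induction l generalizing b with
  | nil => rfl
  | cons f l ih =>
    simp only [List.map_cons, upp]
    refine setIntegral_congr_fun measurableSet_Ioi fun s hs => ?_
    have hs' : 0 < s := hb.trans_lt hs
    simp [ih hs'.le, pos, hs']

/-- The truncation confines the chain to the positive axis; reading it from its smallest variable
gives an integral based at `0`. -/
theorem full_map_pos (f : ℝ → ℂ) (l : List (ℝ → ℂ)) (hl : ∀ g ∈ f :: l, Integrable g) :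
    full ((f :: l).map pos) = upp (f :: l).reverse 0 := by
  rw [full_eq_fullUpp_reverse, ← List.map_reverse]
  · obtain ⟨g, r, hr⟩ : ∃ g r, (f :: l).reverse = g :: r :=
      List.exists_cons_of_ne_nil (by simp)
    rw [hr]
    simp only [List.map_cons, fullUpp, upp]
    rw [← integral_indicator measurableSet_Ioi]
    refine integral_congr_ae (.of_forall fun s => ?_)
    by_cases hs : 0 < s
    · simp [pos, hs, upp_map_pos r hs.le]
    · simp [pos, hs]
  · intro g hg
    obtain ⟨h, hh, rfl⟩ := List.mem_map.1 hg
    exact Integrable.pos (hl h hh)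

theorem tendsto_low_atTop (f : ℝ → ℂ) (l : List (ℝ → ℂ)) (hl : ∀ g ∈ f :: l, Integrable g) :
    Tendsto (low (f :: l)) atTop (𝓝 (full (f :: l))) := by
  have hint := integrable_mul_low (hl f List.mem_cons_self)
    fun g hg => hl g (List.mem_cons_of_mem _ hg)
  exact (aecover_Iic tendsto_id).integral_tendsto_of_countably_generated hint

theorem low_map_pos_of_nonpos (f : ℝ → ℂ) (l : List (ℝ → ℂ)) {b : ℝ} (hb : b ≤ 0) :
    low ((f :: l).map pos) b = 0 := by
  simp only [List.map_cons, low]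
  refine setIntegral_eq_zero_of_forall_eq_zero fun s hs => ?_
  have : ¬ 0 < s := not_lt.2 (le_trans hs hb)
  simp [pos, this]

end MPLParity

namespace MPLParity

/-! ### The kernel -/

/-- The kernel `t e^s / (1 - t e^s)`. -/
noncomputable def ker (t : ℂ) (s : ℝ) : ℂ := t * Complex.exp s / (1 - t * Complex.exp s)

theorem one_sub_mul_ne_zero {t : ℂ} (ht : -t ∈ Complex.slitPlane) (s : ℝ) :
    1 - t * Complex.exp s ≠ 0 := by
  intro h
  have h1 : -t = ((-Real.exp (-s) : ℝ) : ℂ) := by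
    have : t * Complex.exp s = 1 := (sub_eq_zero.1 h).symm
    push_cast
    rw [Complex.exp_neg, eq_inv_of_mul_eq_one_left this]
  rw [h1, Complex.ofReal_mem_slitPlane] at ht
  linarith [Real.exp_pos (-s)]

theorem ker_continuous {t : ℂ} (ht : -t ∈ Complex.slitPlane) : Continuous (ker t) := by
  unfold ker
  exact Continuous.div (by fun_prop) (by fun_prop) (one_sub_mul_ne_zero ht)

theorem exists_le_norm_one_sub {t : ℂ} (ht : -t ∈ Complex.slitPlane) :
    ∃ δ > 0, ∀ s : ℝ, δ ≤ ‖1 - t * Complex.exp s‖ := by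
  have ht0 : t ≠ 0 := fun h => by simp [h] at ht
  have hcl : IsClosed (Complex.ofReal '' Ici 0) :=
    Complex.isometry_ofReal.isClosedEmbedding.isClosedMap _ isClosed_Ici
  have hne : (Complex.ofReal '' Ici 0).Nonempty := ⟨0, 0, by simp, by simp⟩
  have hnot : t⁻¹ ∉ Complex.ofReal '' Ici 0 := by
    rintro ⟨r, hr, h⟩
    have hr' : (0 : ℝ) ≤ r := hr
    have h1 : -t = ((-r⁻¹ : ℝ) : ℂ) := by
      push_cast
      rw [h, inv_inv]
    rw [h1, Complex.ofReal_mem_slitPlane] at ht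
    have : 0 ≤ r⁻¹ := inv_nonneg.2 hr'
    linarith
  have hd := (hcl.notMem_iff_infDist_pos hne).1 hnot
  refine ⟨‖t‖ * Metric.infDist t⁻¹ (Complex.ofReal '' Ici 0),
    mul_pos (norm_pos_iff.2 ht0) hd, fun s => ?_⟩
  have h1 : 1 - t * Complex.exp s = t * (t⁻¹ - Complex.exp s) := by
    field_simp
  rw [h1, norm_mul]
  refine mul_le_mul_of_nonneg_left ?_ (norm_nonneg _)
  rw [← dist_eq_norm]
  exact Metric.infDist_le_dist_of_mem ⟨Real.exp s, (Real.exp_pos s).le, by simp⟩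

/-- The denominator stays away from `0`. The form `1 / (1 - t e^s) - 1` then gives the uniform
bound, and the numerator `t e^s` gives the decay at `-∞`. -/
theorem exists_norm_ker_le {t : ℂ} (ht : -t ∈ Complex.slitPlane) :
    ∃ C, 0 ≤ C ∧ ∀ s : ℝ, ‖ker t s‖ ≤ C ∧ ‖ker t s‖ ≤ C * Real.exp s := by
  obtain ⟨δ, hδ, h⟩ := exists_le_norm_one_sub ht
  refine ⟨1 + 1 / δ + ‖t‖ / δ, by positivity, fun s => ⟨?_, ?_⟩⟩
  · have h1 : ker t s = 1 / (1 - t * Complex.exp s) - 1 := by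
      rw [ker]
      field_simp [one_sub_mul_ne_zero ht s]
      ring
    rw [h1]
    calc ‖1 / (1 - t * Complex.exp s) - 1‖ ≤ ‖1 / (1 - t * Complex.exp s)‖ + ‖(1 : ℂ)‖ :=
          norm_sub_le _ _
      _ ≤ 1 / δ + 1 := by
          rw [norm_div, norm_one]
          gcongr
          exact h s
      _ ≤ _ := by
          have : 0 ≤ ‖t‖ / δ := by positivity
          linarith
  · have h2 : ‖ker t s‖ ≤ ‖t‖ / δ * Real.exp s := by
      rw [ker, norm_div, norm_mul, Complex.norm_exp_ofReal, div_mul_eq_mul_div]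
      gcongr
      exact h s
    refine h2.trans ?_
    gcongr
    have : 0 ≤ 1 / δ := by positivity
    linarith

/-- The kernel with an exponential weight, attached to the pair `(t, y)`. -/
noncomputable def wker (x : ℂ × ℝ) (s : ℝ) : ℂ := ker x.1 s * Complex.exp ((-(x.2 * s) : ℝ) : ℂ)

theorem wker_continuous {x : ℂ × ℝ} (hx : -x.1 ∈ Complex.slitPlane) : Continuous (wker x) :=
  (ker_continuous hx).mul (by fun_prop)

theorem wker_integrableOn_Iic {x : ℂ × ℝ} (hx : -x.1 ∈ Complex.slitPlane) (hy : x.2 < 1) (b : ℝ) :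
    IntegrableOn (wker x) (Iic b) := by
  obtain ⟨C, hC, h⟩ := exists_norm_ker_le hx
  have hint := (integrableOn_exp_mul_Iic (a := 1 - x.2) (by linarith) b).const_mul C
  refine hint.mono' (wker_continuous hx).aestronglyMeasurable (.of_forall fun s => ?_)
  rw [wker, norm_mul, Complex.norm_exp_ofReal]
  calc _ ≤ C * Real.exp s * Real.exp (-(x.2 * s)) := by gcongr; exact (h s).2
    _ = _ := by rw [mul_assoc, ← Real.exp_add]; ring_nf

/-- The kernel is `O(e^s)` at `-∞` and only bounded at `+∞`, so the exponent must lie strictly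
between `0` and `1`. Since partial fractions add up exponents, `Good` asks for this bound on the
total. -/
theorem wker_integrable {x : ℂ × ℝ} (hx : -x.1 ∈ Complex.slitPlane) (hy0 : 0 < x.2)
    (hy : x.2 < 1) : Integrable (wker x) := by
  rw [← integrableOn_univ, ← Iic_union_Ioi (a := 0)]
  refine (wker_integrableOn_Iic hx hy 0).union ?_
  obtain ⟨C, hC, h⟩ := exists_norm_ker_le hx
  have hint := (integrableOn_exp_mul_Ioi (a := -x.2) (by linarith) 0).const_mul C
  refine hint.mono' (wker_continuous hx).aestronglyMeasurable (.of_forall fun s => ?_)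
  rw [wker, norm_mul, Complex.norm_exp_ofReal]
  calc _ ≤ C * Real.exp (-(x.2 * s)) := by gcongr; exact (h s).1
    _ = _ := by ring_nf

/-- The partial fraction decomposition of a product of two kernels. -/
theorem ker_mul_ker {t u : ℂ} (ht : -t ∈ Complex.slitPlane) (hu : -u ∈ Complex.slitPlane)
    (htu : -(u / t) ∈ Complex.slitPlane) (hut : -(t / u) ∈ Complex.slitPlane) (r s : ℝ) :
    ker u s * ker t r = ker t r * ker (u / t) (s - r) + ker u s * ker (t / u) (r - s) := by
  have ht0 : t ≠ 0 := fun h => by simp [h] at ht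
  have hu0 : u ≠ 0 := fun h => by simp [h] at hu
  have h1 := one_sub_mul_ne_zero ht r
  have h2 := one_sub_mul_ne_zero hu s
  have h3 := one_sub_mul_ne_zero htu (s - r)
  have h4 := one_sub_mul_ne_zero hut (r - s)
  have er := Complex.exp_ne_zero (r : ℂ)
  have es := Complex.exp_ne_zero (s : ℂ)
  simp only [ker, Complex.ofReal_sub, Complex.exp_sub] at *
  generalize Complex.exp (r : ℂ) = x at *
  generalize Complex.exp (s : ℂ) = y at *
  have e3 : 1 - u / t * (y / x) = (t * x - u * y) / (t * x) := by field_simp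
  have e4 : 1 - t / u * (x / y) = -(t * x - u * y) / (u * y) := by field_simp; ring
  have h5 : t * x - u * y ≠ 0 := fun h => h3 (by rw [e3, h, zero_div])
  rw [e3, e4]
  field_simp
  ring

end MPLParity

namespace MPLParity

/-! ### Decomposition of an iterated integral over a chain -/

/-- All ways to write a list as `p ++ x :: q`. -/
def splits {α : Type*} : List α → List (List α × α × List α)
  | [] => []
  | x :: L => ([], x, L) :: (splits L).map fun σ => (x :: σ.1, σ.2.1, σ.2.2)

theorem eq_of_mem_splits {α : Type*} {L : List α} {σ : List α × α × List α} (h : σ ∈ splits L) :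
    L = σ.1 ++ σ.2.1 :: σ.2.2 := by
  induction L generalizing σ with
  | nil => simp [splits] at h
  | cons x L ih =>
    simp only [splits, List.mem_cons, List.mem_map] at h
    rcases h with rfl | ⟨τ, hτ, rfl⟩
    · rfl
    · simp [← ih hτ]

theorem splits_map {α β : Type*} (f : α → β) (L : List α) :
    splits (L.map f) = (splits L).map fun σ => (σ.1.map f, f σ.2.1, σ.2.2.map f) := by
  induction L with
  | nil => rfl
  | cons x L ih => simp [splits, ih, Function.comp_def]

theorem integrable_list_sum {α : Type*} {μ : Measure ℝ} (l : List α) (f : α → ℝ → ℂ)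
    (h : ∀ x ∈ l, Integrable (f x) μ) : Integrable (fun s => (l.map fun x => f x s).sum) μ := by
  induction l with
  | nil => simp
  | cons x l ih =>
    simp only [List.map_cons, List.sum_cons]
    exact (h x List.mem_cons_self).add (ih fun y hy => h y (List.mem_cons_of_mem _ hy))

theorem integral_list_sum {α : Type*} {μ : Measure ℝ} (l : List α) (f : α → ℝ → ℂ)
    (h : ∀ x ∈ l, Integrable (f x) μ) :
    ∫ s, (l.map fun x => f x s).sum ∂μ = (l.map fun x => ∫ s, f x s ∂μ).sum := by
  induction l with
  | nil => simp
  | cons x l ih =>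
    simp only [List.map_cons, List.sum_cons]
    have h' : ∀ y ∈ l, Integrable (f y) μ := fun y hy => h y (List.mem_cons_of_mem _ hy)
    rw [integral_add (h x List.mem_cons_self) (integrable_list_sum l f h'), ih h']

theorem list_sum_map_congr {α M : Type*} [AddMonoid M] {l : List α} {f g : α → M}
    (h : ∀ x ∈ l, f x = g x) : (l.map f).sum = (l.map g).sum := by
  rw [List.map_congr_left h]

/-- The total weight of a list of pairs. -/
def total (L : List (ℂ × ℝ)) : ℝ := (L.map Prod.snd).sum

/-- Division of the first component by `t`. -/
noncomputable def scale (t : ℂ) (x : ℂ × ℝ) : ℂ × ℝ := (x.1 / t, x.2)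

theorem total_map_scale (t : ℂ) (L : List (ℂ × ℝ)) : total (L.map (scale t)) = total L := by
  simp [total, scale, Function.comp_def]

theorem scale_scale {t u : ℂ} (ht : t ≠ 0) (x : ℂ × ℝ) :
    scale (u / t) (scale t x) = scale u x := by
  simp only [scale]
  congr 1
  by_cases hu : u = 0
  · simp [hu]
  · field_simp

/-- The lists for which all integrals below converge. -/
structure Good (L : List (ℂ × ℝ)) : Prop where
  slit : ∀ x ∈ L, -x.1 ∈ Complex.slitPlane
  pos : ∀ x ∈ L, 0 < x.2
  lt_one : total L < 1
  ratio : L.Pairwise fun x x' => -(x.1 / x'.1) ∈ Complex.slitPlane ∧ -(x'.1 / x.1) ∈ Complex.slitPlane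

theorem total_nonneg {L : List (ℂ × ℝ)} (h : ∀ x ∈ L, 0 < x.2) : 0 ≤ total L := by
  refine List.sum_nonneg fun y hy => ?_
  obtain ⟨x, hx, rfl⟩ := List.mem_map.1 hy
  exact (h x hx).le

theorem le_total_of_mem {L : List (ℂ × ℝ)} (h : ∀ x ∈ L, 0 < x.2) {x : ℂ × ℝ} (hx : x ∈ L) :
    x.2 ≤ total L := by
  induction L with
  | nil => simp at hx
  | cons x' L ih =>
    have h' : ∀ x ∈ L, 0 < x.2 := fun x hx => h x (List.mem_cons_of_mem _ hx)
    simp only [total, List.map_cons, List.sum_cons]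
    rcases List.mem_cons.1 hx with rfl | hx
    · have := total_nonneg h'
      simp only [total] at this
      linarith
    · have := ih h' hx
      have h0 := h x' List.mem_cons_self
      simp only [total] at this
      linarith

theorem Good.integrable {L : List (ℂ × ℝ)} (h : Good L) :
    ∀ f ∈ L.map wker, Integrable f := by
  intro f hf
  obtain ⟨x, hx, rfl⟩ := List.mem_map.1 hf
  exact wker_integrable (h.slit x hx) (h.pos x hx) ((le_total_of_mem h.pos hx).trans_lt h.lt_one)

theorem Good.of_cons {x : ℂ × ℝ} {L : List (ℂ × ℝ)} (h : Good (x :: L)) : Good L where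
  slit y hy := h.slit y (List.mem_cons_of_mem _ hy)
  pos y hy := h.pos y (List.mem_cons_of_mem _ hy)
  lt_one := by
    have h1 := h.lt_one
    have h2 := h.pos x List.mem_cons_self
    simp only [total, List.map_cons, List.sum_cons] at h1 ⊢
    linarith
  ratio := (List.pairwise_cons.1 h.ratio).2

theorem Good.of_append {p q : List (ℂ × ℝ)} (h : Good (p ++ q)) : Good p ∧ Good q := by
  have ht : total (p ++ q) = total p + total q := by simp [total]
  have hp : ∀ y ∈ p, 0 < y.2 := fun y hy => h.pos y (List.mem_append_left _ hy)
  have hq : ∀ y ∈ q, 0 < y.2 := fun y hy => h.pos y (List.mem_append_right _ hy)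
  have h1 := h.lt_one
  rw [ht] at h1
  have := total_nonneg hp
  have := total_nonneg hq
  exact ⟨⟨fun y hy => h.slit y (List.mem_append_left _ hy), hp, by linarith,
      (List.pairwise_append.1 h.ratio).1⟩,
    ⟨fun y hy => h.slit y (List.mem_append_right _ hy), hq, by linarith,
      (List.pairwise_append.1 h.ratio).2.1⟩⟩

theorem Good.scale {t : ℂ} {L : List (ℂ × ℝ)} (h : Good L) (ht : t ≠ 0)
    (h' : ∀ x ∈ L, -(x.1 / t) ∈ Complex.slitPlane) : Good (L.map (scale t)) where
  slit y hy := by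
    obtain ⟨x, hx, rfl⟩ := List.mem_map.1 hy
    exact h' x hx
  pos y hy := by
    obtain ⟨x, hx, rfl⟩ := List.mem_map.1 hy
    exact h.pos x hx
  lt_one := by rw [total_map_scale]; exact h.lt_one
  ratio := by
    refine List.pairwise_map.2 (h.ratio.imp ?_)
    intro a b hab
    simpa only [MPLParity.scale, div_div_div_cancel_right₀ ht] using hab

theorem wker_bdd {x : ℂ × ℝ} (hx : -x.1 ∈ Complex.slitPlane) (h0 : 0 ≤ x.2) (h1 : x.2 ≤ 1) :
    ∃ C, ∀ s, ‖wker x s‖ ≤ C := by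
  obtain ⟨C, hC, h⟩ := exists_norm_ker_le hx
  refine ⟨C, fun s => ?_⟩
  rw [wker, norm_mul, Complex.norm_exp_ofReal]
  rcases le_total 0 s with hs | hs
  · calc _ ≤ C * 1 := by
          gcongr
          · exact (h s).1
          · exact Real.exp_le_one_iff.2 (by nlinarith)
      _ = C := mul_one C
  · calc _ ≤ (C * Real.exp s) * Real.exp (-(x.2 * s)) := by gcongr; exact (h s).2
      _ = C * Real.exp ((1 - x.2) * s) := by rw [mul_assoc, ← Real.exp_add]; ring_nf
      _ ≤ C * 1 := by
          gcongr
          exact Real.exp_le_one_iff.2 (by nlinarith)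
      _ = C := mul_one C

theorem integrable_conv {k H : ℝ → ℂ} (hk : Integrable k) (hH : Integrable H) :
    Integrable fun s => ∫ r, k r * H (s - r) :=
  (Integrable.convolution_integrand (μ := volume) (ν := volume) (ContinuousLinearMap.mul ℂ ℂ)
    hk hH).integral_prod_left

theorem integral_Iic_conv {k H : ℝ → ℂ} (hk : Integrable k) (hH : Integrable H) (b : ℝ) :
    ∫ s in Iic b, ∫ r, k r * H (s - r) = ∫ r, k r * ∫ u in Iic (b - r), H u := by
  have hint := Integrable.convolution_integrand (μ := volume) (ν := volume)
    (ContinuousLinearMap.mul ℂ ℂ) hk hH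
  have h2 : Integrable (Function.uncurry fun s r : ℝ => k r * H (s - r))
      ((volume.restrict (Iic b)).prod volume) := by
    refine hint.mono_measure ?_
    exact Measure.prod_mono Measure.restrict_le_self le_rfl
  rw [integral_integral_swap h2]
  refine integral_congr_ae (.of_forall fun r => ?_)
  simp only
  rw [integral_const_mul]
  congr 1
  rw [← integral_indicator measurableSet_Iic, ← integral_indicator measurableSet_Iic,
    ← integral_sub_right_eq_self ((Iic (b - r)).indicator H) r]
  refine integral_congr_ae (.of_forall fun s => ?_)
  simp [indicator]

/-- In each summand of the partial fraction identity the variable kept as pivot receives the sum of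
both weights, and the other variable keeps its own weight relative to the pivot. -/
theorem wker_mul_wker {x x' : ℂ × ℝ} (hx : -x.1 ∈ Complex.slitPlane)
    (hx' : -x'.1 ∈ Complex.slitPlane) (h : -(x'.1 / x.1) ∈ Complex.slitPlane)
    (h' : -(x.1 / x'.1) ∈ Complex.slitPlane) (r s : ℝ) :
    wker x' s * wker x r = wker (x.1, x.2 + x'.2) r * wker (scale x.1 x') (s - r) +
      wker (x'.1, x.2 + x'.2) s * wker (scale x'.1 x) (r - s) := by
  have := ker_mul_ker hx hx' h h' r s
  simp only [wker, scale]
  have e1 : Complex.exp ((-(x'.2 * s) : ℝ) : ℂ) * Complex.exp ((-(x.2 * r) : ℝ) : ℂ) =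
      Complex.exp ((-((x.2 + x'.2) * r) : ℝ) : ℂ) * Complex.exp ((-(x'.2 * (s - r)) : ℝ) : ℂ) := by
    rw [← Complex.exp_add, ← Complex.exp_add]
    push_cast
    ring_nf
  have e2 : Complex.exp ((-(x'.2 * s) : ℝ) : ℂ) * Complex.exp ((-(x.2 * r) : ℝ) : ℂ) =
      Complex.exp ((-((x.2 + x'.2) * s) : ℝ) : ℂ) * Complex.exp ((-(x.2 * (r - s)) : ℝ) : ℂ) := by
    rw [← Complex.exp_add, ← Complex.exp_add]
    push_cast
    ring_nf
  rw [mul_mul_mul_comm, this, add_mul]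
  congr 1
  · rw [e1]; ring
  · rw [e2]; ring

theorem integral_Iic_sub_right (g : ℝ → ℂ) (s : ℝ) :
    ∫ r in Iic s, g (r - s) = ∫ r in Iic 0, g r := by
  rw [← integral_indicator measurableSet_Iic, ← integral_indicator measurableSet_Iic,
    ← integral_sub_right_eq_self ((Iic 0).indicator g) s]
  refine integral_congr_ae (.of_forall fun r => ?_)
  simp [indicator]

/-- The contribution of one split to an iterated integral. -/
noncomputable def splitTerm (Y b : ℝ) (σ : List (ℂ × ℝ) × (ℂ × ℝ) × List (ℂ × ℝ)) : ℂ :=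
  low ((σ.2.2.map (scale σ.2.1.1)).map wker) 0 *
    ∫ r in Iic b, wker (σ.2.1.1, Y) r *
      low (((σ.1.map (scale σ.2.1.1)).map wker).map pos) (b - r)

theorem Good.of_mem_splits {L : List (ℂ × ℝ)} (h : Good L)
    {σ : List (ℂ × ℝ) × (ℂ × ℝ) × List (ℂ × ℝ)} (hσ : σ ∈ splits L) :
    Good (σ.1.map (MPLParity.scale σ.2.1.1)) ∧ Good (σ.2.2.map (MPLParity.scale σ.2.1.1)) ∧
      -σ.2.1.1 ∈ Complex.slitPlane := by
  have e := eq_of_mem_splits hσ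
  rw [e] at h
  have hs : -σ.2.1.1 ∈ Complex.slitPlane := h.slit _ (by simp)
  have h0 : σ.2.1.1 ≠ 0 := fun h => by simp [h] at hs
  have hr := List.pairwise_append.1 h.ratio
  refine ⟨h.of_append.1.scale h0 fun x hx => (hr.2.2 x hx _ List.mem_cons_self).1,
    h.of_append.2.of_cons.scale h0 fun x hx => ((List.pairwise_cons.1 hr.2.1).1 x hx).2, hs⟩

theorem integrable_map_pos {l : List (ℝ → ℂ)} (hl : ∀ f ∈ l, Integrable f) :
    ∀ f ∈ l.map pos, Integrable f := by
  intro f hf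
  obtain ⟨g, hg, rfl⟩ := List.mem_map.1 hf
  exact Integrable.pos (hl g hg)

/-- Partial fractions are applied to the new outer variable `s` and the pivot `r`. The first summand
keeps the pivot and places `x` among the variables above it, as a convolution. In the second `x`
becomes the pivot, and the shift `r ↦ r - s` frees the remaining integral from `s`. -/
theorem wker_mul_splitTerm {x : ℂ × ℝ} {L : List (ℂ × ℝ)} (h : Good (x :: L)) (s : ℝ)
    {σ : List (ℂ × ℝ) × (ℂ × ℝ) × List (ℂ × ℝ)} (hσ : σ ∈ splits L) :
    wker x s * splitTerm (total L) s σ =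
      low ((σ.2.2.map (scale σ.2.1.1)).map wker) 0 *
        (∫ r, wker (σ.2.1.1, total (x :: L)) r *
          (fun u => pos (wker (scale σ.2.1.1 x)) u *
            low (((σ.1.map (scale σ.2.1.1)).map wker).map pos) u) (s - r)) +
      wker (x.1, total (x :: L)) s *
        splitTerm (total L) 0 (σ.1.map (scale x.1), scale x.1 σ.2.1, σ.2.2.map (scale x.1)) := by
  obtain ⟨p, v, q⟩ := σ
  obtain ⟨hp, hq, hv⟩ := h.of_cons.of_mem_splits hσ
  have hx := h.slit x List.mem_cons_self
  have hx0 : x.1 ≠ 0 := fun h => by simp [h] at hx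
  have hvL : v ∈ L := by rw [eq_of_mem_splits hσ]; simp
  obtain ⟨hr1, hr2⟩ := (List.pairwise_cons.1 h.ratio).1 v hvL
  have htot : total (x :: L) = total L + x.2 := by simp [total, add_comm]
  have hL0 : 0 < total L := lt_of_lt_of_le (h.of_cons.pos v hvL) (le_total_of_mem h.of_cons.pos hvL)
  have hx2 := h.pos x List.mem_cons_self
  have h1 := h.lt_one
  rw [htot] at h1
  simp only at hp hq hv
  have hint := integrable_map_pos hp.integrable
  obtain ⟨C, hC⟩ := low_bdd_of_integrable hint
  have hcont := low_continuous_of_integrable hint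
  simp only [splitTerm, List.map_map]
  have hcomp : (scale (scale x.1 v).1 ∘ scale x.1) = scale v.1 := by
    ext1 w
    simp only [Function.comp]
    exact scale_scale hx0 w
  simp only [← List.map_map] at *
  set M := low (((p.map (scale v.1)).map wker).map pos) with hM
  set A := low ((q.map (scale v.1)).map wker) 0 with hA
  have e1 : ((q.map (scale x.1)).map (scale (scale x.1 v).1)) = q.map (scale v.1) := by
    rw [List.map_map, hcomp]
  have e2 : ((p.map (scale x.1)).map (scale (scale x.1 v).1)) = p.map (scale v.1) := by
    rw [List.map_map, hcomp]
  rw [e1, e2, ← hA, ← hM, mul_left_comm, mul_left_comm _ A, ← mul_add, ← integral_const_mul]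
  congr 1
  have key : ∀ r, wker x s * (wker (v.1, total L) r * M (s - r)) =
      wker (v.1, total (x :: L)) r * wker (scale v.1 x) (s - r) * M (s - r) +
      wker (x.1, total (x :: L)) s * (wker (scale x.1 (v.1, total L)) (r - s) * M (0 - (r - s))) := by
    intro r
    rw [← mul_assoc, wker_mul_wker (x := (v.1, total L)) hv hx hr1 hr2 r s, htot, zero_sub, neg_sub]
    ring
  simp only [key]
  have hk : Integrable (wker (v.1, total (x :: L))) :=
    wker_integrable hv (by simp only [htot]; linarith) (by simp only [htot]; linarith)
  have hMm : AEStronglyMeasurable (fun r => M (s - r)) :=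
    (hcont.comp (continuous_const.sub continuous_id)).aestronglyMeasurable
  obtain ⟨C', hC'⟩ := wker_bdd (x := scale v.1 x) hr1 hx2.le (by simp only [scale]; linarith)
  have i1 : Integrable fun r => wker (v.1, total (x :: L)) r * wker (scale v.1 x) (s - r) *
      M (s - r) := by
    refine Integrable.mul_bdd (c := C) (Integrable.mul_bdd (c := C') hk ?_ (.of_forall fun r => hC' _))
      hMm (.of_forall fun r => hC _)
    exact ((wker_continuous (x := scale v.1 x) hr1).comp
      (continuous_const.sub continuous_id)).aestronglyMeasurable
  have i2 : Integrable fun r => wker (scale x.1 (v.1, total L)) (r - s) * M (0 - (r - s)) := by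
    refine Integrable.comp_sub_right (f := fun r => wker (scale x.1 (v.1, total L)) r * M (0 - r)) ?_ s
    refine (wker_integrable (x := scale x.1 (v.1, total L)) hr2 hL0
      (by simp only [scale]; linarith)).mul_bdd (c := C) ?_ (.of_forall fun r => hC _)
    exact (hcont.comp (continuous_const.sub continuous_id)).aestronglyMeasurable
  rw [integral_add i1.integrableOn (i2.integrableOn.const_mul _), integral_const_mul,
    integral_Iic_sub_right (fun r => wker (scale x.1 (v.1, total L)) r * M (0 - r)) s]
  congr 1
  rw [integral_Iic_eq_integral_Iio, ← integral_indicator measurableSet_Iio]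
  refine integral_congr_ae (.of_forall fun r => ?_)
  by_cases hrs : r < s
  · simp [pos, hrs, mul_assoc]
  · simp [pos, hrs]

/-- This is the integrated partial fraction identity: in a split `p ++ x :: q` the pivot is the
variable of `x`, and `q` and `p` carry the differences to it, negative and positive respectively.
The proof adds one outer variable at a time. -/
theorem low_wker_eq_splits {L : List (ℂ × ℝ)} (h : Good L) (hL : L ≠ []) (b : ℝ) :
    low (L.map wker) b = ((splits L).map (splitTerm (total L) b)).sum := by
  induction hn : L.length generalizing L b with
  | zero => exact absurd (List.length_eq_zero_iff.1 hn) hL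
  | succ n ih =>
    obtain ⟨x, L, rfl⟩ := List.exists_cons_of_ne_nil hL
    have hx := h.slit x List.mem_cons_self
    have hx0 : x.1 ≠ 0 := fun h => by simp [h] at hx
    have hn' : L.length = n := by simpa using hn
    rcases eq_or_ne L [] with rfl | hne
    · simp [splits, splitTerm, low, total]
    have hscale : Good (L.map (scale x.1)) :=
      h.of_cons.scale hx0 fun v hv => ((List.pairwise_cons.1 h.ratio).1 v hv).2
    -- The summands in which `x` is the new pivot reassemble, by the induction hypothesis for the
    -- list divided by `x.1`, into the single term of the split `([], x, L)`.
    have hB : ((splits L).map fun σ => splitTerm (total L) 0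
        (σ.1.map (scale x.1), scale x.1 σ.2.1, σ.2.2.map (scale x.1))).sum =
        low ((L.map (scale x.1)).map wker) 0 := by
      rw [ih hscale (by simpa using hne) 0 (by simpa using hn'), splits_map, total_map_scale,
        List.map_map]
      rfl
    have hxt : x.2 ≤ total (x :: L) := le_total_of_mem h.pos List.mem_cons_self
    have hx2 := h.pos x List.mem_cons_self
    have hpt : 0 < total (x :: L) := hx2.trans_le hxt
    have hk : ∀ t : ℂ, -t ∈ Complex.slitPlane → Integrable (wker (t, total (x :: L))) :=
      fun t ht => wker_integrable ht hpt h.lt_one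
    have hH : ∀ σ ∈ splits L, Integrable fun u => pos (wker (scale σ.2.1.1 x)) u *
        low (((σ.1.map (scale σ.2.1.1)).map wker).map pos) u := by
      intro σ hσ
      have hmem : σ.2.1 ∈ L := by rw [eq_of_mem_splits hσ]; simp
      refine integrable_mul_low (Integrable.pos (wker_integrable
        ((List.pairwise_cons.1 h.ratio).1 _ hmem).1 hx2 ?_)) ?_
      · exact hxt.trans_lt h.lt_one
      · exact integrable_map_pos (h.of_cons.of_mem_splits hσ).1.integrable
    have hpt : ∀ s, wker x s * low (L.map wker) s =
        ((splits L).map fun σ => low ((σ.2.2.map (scale σ.2.1.1)).map wker) 0 *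
        (∫ r, wker (σ.2.1.1, total (x :: L)) r *
          (fun u => pos (wker (scale σ.2.1.1 x)) u *
            low (((σ.1.map (scale σ.2.1.1)).map wker).map pos) u) (s - r))).sum +
        low ((L.map (scale x.1)).map wker) 0 * wker (x.1, total (x :: L)) s := by
      intro s
      rw [ih h.of_cons hne s hn', ← List.sum_map_mul_left,
        list_sum_map_congr (M := ℂ) fun σ hσ => wker_mul_splitTerm h s hσ, List.sum_map_add,
        List.sum_map_mul_left, hB, mul_comm (wker _ s)]
    have hi : ∀ σ ∈ splits L, IntegrableOn (fun s =>
        low ((σ.2.2.map (scale σ.2.1.1)).map wker) 0 *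
        (∫ r, wker (σ.2.1.1, total (x :: L)) r *
          (fun u => pos (wker (scale σ.2.1.1 x)) u *
            low (((σ.1.map (scale σ.2.1.1)).map wker).map pos) u) (s - r))) (Iic b) := by
      intro σ hσ
      exact ((integrable_conv (hk _ (h.of_cons.of_mem_splits hσ).2.2)
        (hH σ hσ)).integrableOn).const_mul _
    simp only [List.map_cons, low, hpt]
    rw [integral_add (integrable_list_sum _ _ hi) ((hk _ hx).integrableOn.const_mul _),
      integral_list_sum _ _ hi, integral_const_mul, splits, List.map_cons, List.sum_cons, add_comm]
    congr 1
    · simp [splitTerm, low]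
    · rw [List.map_map]
      refine list_sum_map_congr (M := ℂ) fun σ hσ => ?_
      rw [integral_const_mul, integral_Iic_conv (hk _ (h.of_cons.of_mem_splits hσ).2.2) (hH σ hσ)]
      simp only [Function.comp, splitTerm]
      congr 1
      rw [← integral_indicator measurableSet_Iic]
      refine integral_congr_ae (.of_forall fun r => ?_)
      -- For `r > b` the truncated chain below `b - r < 0` is empty, so the integral over all `r` is
      -- one over `r ≤ b`.
      by_cases hr : r ≤ b
      · simp [hr, low]
      · have := low_map_pos_of_nonpos (wker (scale σ.2.1.1 x))
          ((σ.1.map (scale σ.2.1.1)).map wker) (b := b - r) (by linarith)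
        simp only [List.map_cons, low] at this
        rw [indicator_of_notMem (by simpa using hr)]
        exact mul_eq_zero_of_right _ this

/-- The full integral of a kernel. -/
noncomputable def kerInt (t : ℂ) (y : ℝ) : ℂ := ∫ s, wker (t, y) s

/-- Let `b → ∞` in `low_wker_eq_splits`: by dominated convergence the factor for `p` loses its
dependence on the pivot variable `r`, and the integral over `r` becomes `kerInt`. -/
theorem full_wker_eq_splits {L : List (ℂ × ℝ)} (h : Good L) :
    full (L.map wker) = ((splits L).map fun σ =>
      kerInt σ.2.1.1 (total L) * low ((σ.2.2.map (scale σ.2.1.1)).map wker) 0 *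
        upp ((σ.1.map (scale σ.2.1.1)).map wker).reverse 0).sum := by
  rcases L with _ | ⟨x, L⟩
  · simp [full, splits]
  have h1 : Tendsto (low ((x :: L).map wker)) atTop (𝓝 (full ((x :: L).map wker))) := by
    have := h.integrable
    rw [List.map_cons] at this ⊢
    exact tendsto_low_atTop _ _ this
  refine tendsto_nhds_unique h1 ?_
  have h2 : low ((x :: L).map wker) =
      fun b => ((splits (x :: L)).map (splitTerm (total (x :: L)) b)).sum :=
    funext fun b => low_wker_eq_splits h (by simp) b
  rw [h2]
  refine tendsto_list_sum (f := fun σ b => splitTerm (total (x :: L)) b σ) (splits (x :: L))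
    fun σ hσ => ?_
  obtain ⟨hp, hq, hv⟩ := h.of_mem_splits hσ
  rw [mul_comm (kerInt _ _), mul_assoc]
  refine Tendsto.const_mul _ ?_
  have hpt : 0 < total (x :: L) :=
    (h.pos x List.mem_cons_self).trans_le (le_total_of_mem h.pos List.mem_cons_self)
  have hk : Integrable (wker (σ.2.1.1, total (x :: L))) := wker_integrable hv hpt h.lt_one
  have hint := integrable_map_pos hp.integrable
  obtain ⟨C, hC⟩ := low_bdd_of_integrable hint
  have hcont := low_continuous_of_integrable hint
  have hlim : Tendsto (low (((σ.1.map (scale σ.2.1.1)).map wker).map pos)) atTop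
      (𝓝 (upp ((σ.1.map (scale σ.2.1.1)).map wker).reverse 0)) := by
    rcases hl : (σ.1.map (scale σ.2.1.1)).map wker with _ | ⟨f, l⟩
    · simp only [List.map_nil, List.reverse_nil]
      exact tendsto_const_nhds
    · rw [hl] at hint
      rw [← full_map_pos f l (by rw [← hl]; exact hp.integrable)]
      exact tendsto_low_atTop (pos f) (l.map pos) hint
  rw [kerInt, ← integral_mul_const]
  simp only [← integral_indicator measurableSet_Iic]
  refine tendsto_integral_filter_of_dominated_convergence
    (fun r => ‖wker (σ.2.1.1, total (x :: L)) r‖ * C) ?_ ?_ (hk.norm.mul_const C) ?_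
  · refine .of_forall fun b => AEStronglyMeasurable.indicator ?_ measurableSet_Iic
    exact hk.aestronglyMeasurable.mul
      (hcont.comp (continuous_const.sub continuous_id)).aestronglyMeasurable
  · refine .of_forall fun b => .of_forall fun r => ?_
    refine (norm_indicator_le_norm_self _ _).trans ?_
    rw [norm_mul]
    exact mul_le_mul_of_nonneg_left (hC _) (norm_nonneg _)
  · refine .of_forall fun r => ?_
    have hlim' : Tendsto (fun b => wker (σ.2.1.1, total (x :: L)) r *
        low (((σ.1.map (scale σ.2.1.1)).map wker).map pos) (b - r)) atTop
        (𝓝 (wker (σ.2.1.1, total (x :: L)) r *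
          upp ((σ.1.map (scale σ.2.1.1)).map wker).reverse 0)) :=
      (hlim.comp (tendsto_atTop_add_const_right atTop (-r) tendsto_id)).const_mul _
    refine hlim'.congr' ?_
    filter_upwards [eventually_ge_atTop r] with b hb
    simp [hb]

end MPLParity

namespace MPLParity

/-! ### Reflection of the integration variables -/

theorem hasDerivAt_low {f : ℝ → ℂ} {l : List (ℝ → ℂ)} (hfc : Continuous f)
    (hl : ∀ g ∈ f :: l, ∀ b, IntegrableOn g (Iic b)) (b : ℝ) :
    HasDerivAt (low (f :: l)) (f b * low l b) b := by
  have hint := low_integrableOn hl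
  have hc : Continuous fun s => f s * low l s :=
    hfc.mul (low_continuous fun g hg => hl g (List.mem_cons_of_mem _ hg))
  have h : low (f :: l) = fun b => (∫ s in Iic 0, f s * low l s) +
      ∫ s in (0 : ℝ)..b, f s * low l s := by
    ext b
    rw [← intervalIntegral.integral_Iic_sub_Iic (hint 0) (hint b)]
    simp [low]
  rw [h]
  exact (intervalIntegral.integral_hasDerivAt_right (hc.intervalIntegrable _ _)
    (hc.stronglyMeasurableAtFilter _ _) hc.continuousAt).const_add _

theorem integrableOn_cexp_mul {μ : ℝ} (hμ : 0 < μ) (b : ℝ) :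
    IntegrableOn (fun s : ℝ => Complex.exp ((μ * s : ℝ) : ℂ)) (Iic b) := by
  have := integrableOn_exp_mul_complex_Iic (a := (μ : ℂ)) (by simpa using hμ) b
  simpa using this

/-- Integration by parts; the boundary term at `-∞` vanishes because `μ > 0` and the chain integral
is bounded there. -/
theorem integral_cexp_mul_low {μ : ℝ} (hμ : 0 < μ) {f : ℝ → ℂ} {l : List (ℝ → ℂ)}
    (hfc : Continuous f) (hl : ∀ g ∈ f :: l, ∀ b, IntegrableOn g (Iic b))
    (hl' : ∀ b, IntegrableOn (fun s : ℝ => Complex.exp ((μ * s : ℝ) : ℂ) * f s) (Iic b)) (b : ℝ) :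
    ∫ s in Iic b, Complex.exp ((μ * s : ℝ) : ℂ) * low (f :: l) s =
      (Complex.exp ((μ * b : ℝ) : ℂ) * low (f :: l) b -
        low ((fun s : ℝ => Complex.exp ((μ * s : ℝ) : ℂ) * f s) :: l) b) / μ := by
  have hμ' : (μ : ℂ) ≠ 0 := by exact_mod_cast hμ.ne'
  obtain ⟨hc, hb⟩ := low_continuous_bdd hl
  obtain ⟨C, hC⟩ := hb (Iic b) (isLowerSet_Iic b) measurableSet_Iic fun g hg => hl g hg b
  have i1 : IntegrableOn (fun s : ℝ => Complex.exp ((μ * s : ℝ) : ℂ) * low (f :: l) s) (Iic b) :=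
    (integrableOn_cexp_mul hμ b).mul_bdd (c := C) hc.aestronglyMeasurable
      (ae_restrict_of_forall_mem measurableSet_Iic hC)
  have i2 : IntegrableOn (fun s : ℝ => Complex.exp ((μ * s : ℝ) : ℂ) * f s * low l s) (Iic b) := by
    refine low_integrableOn (f := fun s : ℝ => Complex.exp ((μ * s : ℝ) : ℂ) * f s)
      (fun g hg => ?_) b
    rcases List.mem_cons.1 hg with rfl | hg
    · exact hl'
    · exact hl g (List.mem_cons_of_mem _ hg)
  have hexp : ∀ s : ℝ, HasDerivAt (fun s : ℝ => Complex.exp ((μ * s : ℝ) : ℂ))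
      (Complex.exp ((μ * s : ℝ) : ℂ) * μ) s := by
    intro s
    have h1 : HasDerivAt (fun s : ℝ => ((μ * s : ℝ) : ℂ)) (μ : ℂ) s := by
      have := ((hasDerivAt_id s).const_mul μ).ofReal_comp
      simpa using this
    exact h1.cexp
  have hder : ∀ s ∈ Iic b, HasDerivAt (fun s : ℝ => Complex.exp ((μ * s : ℝ) : ℂ) * low (f :: l) s)
      (μ * (Complex.exp ((μ * s : ℝ) : ℂ) * low (f :: l) s) +
        Complex.exp ((μ * s : ℝ) : ℂ) * f s * low l s) s := by
    intro s _
    exact ((hexp s).mul (hasDerivAt_low hfc hl s)).congr_deriv (by ring)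
  have hlim : Tendsto (fun s : ℝ => Complex.exp ((μ * s : ℝ) : ℂ) * low (f :: l) s) atBot (𝓝 0) := by
    have h0 : Tendsto (fun s : ℝ => Complex.exp ((μ * s : ℝ) : ℂ)) atBot (𝓝 0) := by
      rw [tendsto_zero_iff_norm_tendsto_zero]
      simp only [Complex.norm_exp_ofReal]
      exact Real.tendsto_exp_atBot.comp (tendsto_id.const_mul_atBot hμ)
    refine h0.zero_mul_isBoundedUnder_le ⟨C, ?_⟩
    rw [eventually_map]
    filter_upwards [eventually_le_atBot b] with s hs using hC s hs
  have := integral_Iic_of_hasDerivAt_of_tendsto' hder ((i1.const_mul _).add i2) hlim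
  rw [integral_add (i1.const_mul _) i2, integral_const_mul, sub_zero] at this
  rw [eq_div_iff hμ', ← this]
  simp only [low]
  ring

/-- The kernel obtained from `wker` by reflection. -/
noncomputable def mker (x : ℂ × ℝ) (s : ℝ) : ℂ := (1 + ker x.1 s) * Complex.exp ((x.2 * s : ℝ) : ℂ)

theorem inv_neg_mem_slitPlane {t : ℂ} (ht : -t ∈ Complex.slitPlane) :
    -t⁻¹ ∈ Complex.slitPlane := by
  rw [← inv_neg]
  rw [Complex.mem_slitPlane_iff] at *
  have h0 : -t ≠ 0 := by
    intro h
    simp [h] at ht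
  have hn : 0 < Complex.normSq (-t) := Complex.normSq_pos.2 h0
  rw [Complex.inv_re, Complex.inv_im]
  rcases ht with ht | ht
  · exact Or.inl (div_pos ht hn)
  · exact Or.inr (div_ne_zero (neg_ne_zero.2 ht) hn.ne')

/-- This is where `1/z` enters: reflection inverts the argument, up to an additive constant and a
sign. -/
theorem wker_neg {x : ℂ × ℝ} (hx : -x.1 ∈ Complex.slitPlane) (s : ℝ) :
    wker x (-s) = -mker (x.1⁻¹, x.2) s := by
  have h0 : x.1 ≠ 0 := fun h => by simp [h] at hx
  have h1 := one_sub_mul_ne_zero hx (-s)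
  have h2 := one_sub_mul_ne_zero (inv_neg_mem_slitPlane hx) s
  have e := Complex.exp_ne_zero (s : ℂ)
  have key : ker x.1 (-s) = -(1 + ker x.1⁻¹ s) := by
    simp only [ker] at *
    push_cast at *
    rw [Complex.exp_neg] at *
    generalize Complex.exp (s : ℂ) = v at *
    have e1 : 1 - x.1 * v⁻¹ = (v - x.1) / v := by field_simp
    have e2 : 1 - x.1⁻¹ * v = -(v - x.1) / x.1 := by field_simp; ring
    have h3 : v - x.1 ≠ 0 := fun h => h1 (by rw [e1, h, zero_div])
    rw [e1, e2]
    field_simp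
    ring
  rw [wker, mker, key, neg_mul]
  congr 3
  push_cast
  ring

theorem low_map_neg {α : Type*} (L : List α) (φ : α → ℝ → ℂ) (b : ℝ) :
    low (L.map fun x s => -φ x s) b = (-1) ^ L.length * low (L.map φ) b := by
  induction L generalizing b with
  | nil => simp [low]
  | cons x L ih =>
    simp only [List.map_cons, low, List.length_cons, pow_succ]
    rw [← integral_const_mul]
    refine integral_congr_ae (.of_forall fun s => ?_)
    simp only [ih]
    ring

theorem upp_wker (L : List (ℂ × ℝ)) (hL : ∀ x ∈ L, -x.1 ∈ Complex.slitPlane) :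
    upp (L.map wker) 0 =
      (-1) ^ L.length * low ((L.map fun x => (x.1⁻¹, x.2)).map mker) 0 := by
  rw [upp_eq_low, List.map_map, List.map_map, neg_zero, ← low_map_neg]
  refine low_map_congr fun x hx s _ => ?_
  simp only [Function.comp]
  rw [wker_neg (hL x hx)]

/-- The list of pairs `(τ i, -y ε)` attached to a list of pairs `(i, y)`. -/
noncomputable def pairs {ι : Type*} (τ : ι → ℂ) (ε : ℝ) (L : List (ι × ℚ)) : List (ℂ × ℝ) :=
  L.map fun x => (τ x.1, -(x.2 * ε))

/-- The value of one of the terms in the expansion of an iterated integral of the functions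
`mker`. -/
noncomputable def mterm {ι : Type*} (N : ℕ) (τ : ι → ℂ) (ε b : ℝ) (ρ : ℚ × ℚ × List (ι × ℚ)) : ℂ :=
  ρ.1 * ((ε : ℂ) ^ (N - ρ.2.2.length))⁻¹ * Complex.exp ((ρ.2.1 * ε * b : ℝ) : ℂ) *
    low ((pairs τ ε ρ.2.2).map wker) b

variable {ι : Type*}

theorem wker_pair_integrableOn {t : ℂ} (ht : -t ∈ Complex.slitPlane) {y : ℚ} (hy : 0 < y) {ε : ℝ}
    (hε : 0 < ε) (b : ℝ) : IntegrableOn (wker (t, -(y * ε))) (Iic b) := by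
  have : (0 : ℝ) < y * ε := mul_pos (by exact_mod_cast hy) hε
  exact wker_integrableOn_Iic (x := (t, -(y * ε))) ht (by simp only; linarith) b

theorem pairs_integrableOn {τ : ι → ℂ} {ε : ℝ} (hε : 0 < ε) {L : List (ι × ℚ)}
    (hL : ∀ x ∈ L, 0 < x.2) (hτ : ∀ x ∈ L, -τ x.1 ∈ Complex.slitPlane) :
    ∀ f ∈ (pairs τ ε L).map wker, ∀ b, IntegrableOn f (Iic b) := by
  intro f hf b
  simp only [pairs, List.map_map, List.mem_map, Function.comp] at hf
  obtain ⟨x, hx, rfl⟩ := hf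
  exact wker_pair_integrableOn (hτ x hx) (hL x hx) hε b

theorem cexp_mul_wker (t : ℂ) (y μ : ℚ) (ε s : ℝ) :
    Complex.exp ((μ * ε * s : ℝ) : ℂ) * wker (t, -(y * ε)) s =
      wker (t, -(((y + μ : ℚ) : ℝ) * ε)) s := by
  simp only [wker]
  rw [mul_left_comm, ← Complex.exp_add]
  push_cast
  ring_nf

/-- The terms produced by the constant part of the kernel `mker`. -/
def boundary (y : ℚ) (ρ : ℚ × ℚ × List (ι × ℚ)) : List (ℚ × ℚ × List (ι × ℚ)) :=
  (ρ.1 / (y + ρ.2.1), y + ρ.2.1, ρ.2.2) ::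
    match ρ.2.2 with
    | [] => []
    | x :: L => [(-ρ.1 / (y + ρ.2.1), 0, (x.1, x.2 + (y + ρ.2.1)) :: L)]

/-- Integration by parts leaves the boundary value at `b` and a term in which the exponential is
merged into the weight of the next kernel. The division by `(y + l) ε` accounts for the extra power
of `ε⁻¹`. For an empty chain only the first term occurs. -/
theorem integral_mterm {N : ℕ} {τ : ι → ℂ} {ε : ℝ} (hε : 0 < ε) {ρ : ℚ × ℚ × List (ι × ℚ)}
    (hρ : 0 ≤ ρ.2.1) (hL : ∀ x ∈ ρ.2.2, 0 < x.2) (hN : ρ.2.2.length ≤ N)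
    (hτ : ∀ x ∈ ρ.2.2, -τ x.1 ∈ Complex.slitPlane) {y : ℚ} (hy : 0 < y) (b : ℝ) :
    ∫ s in Iic b, Complex.exp ((y * ε * s : ℝ) : ℂ) * mterm N τ ε s ρ =
      ((boundary y ρ).map (mterm (N + 1) τ ε b)).sum := by
  obtain ⟨q, l, L⟩ := ρ
  simp only at hρ hL hN hτ
  have hμ : 0 < y + l := by linarith
  have hμε : (0 : ℝ) < ((y + l : ℚ) : ℝ) * ε := mul_pos (by exact_mod_cast hμ) hε
  have hμ' : ((y + l : ℚ) : ℂ) ≠ 0 := by exact_mod_cast hμ.ne'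
  have hε' : (ε : ℂ) ≠ 0 := by exact_mod_cast hε.ne'
  have h1 : ∀ s : ℝ, Complex.exp ((y * ε * s : ℝ) : ℂ) * mterm N τ ε s (q, l, L) =
      q * ((ε : ℂ) ^ (N - L.length))⁻¹ *
        (Complex.exp ((((y + l : ℚ) : ℝ) * ε * s : ℝ) : ℂ) * low ((pairs τ ε L).map wker) s) := by
    intro s
    simp only [mterm]
    have : Complex.exp ((((y + l : ℚ) : ℝ) * ε * s : ℝ) : ℂ) =
        Complex.exp ((y * ε * s : ℝ) : ℂ) * Complex.exp ((l * ε * s : ℝ) : ℂ) := by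
      rw [← Complex.exp_add]
      push_cast
      ring_nf
    rw [this]
    ring
  simp only [h1]
  rw [integral_const_mul]
  have hpow : ∀ k ≤ N, ((ε : ℂ) ^ (N + 1 - k))⁻¹ = ((ε : ℂ) ^ (N - k))⁻¹ * (ε : ℂ)⁻¹ := by
    intro k hk
    rw [Nat.succ_sub hk, pow_succ, mul_inv]
  cases L with
  | nil =>
    have h2 := integral_exp_mul_complex_Iic (a := ((((y + l : ℚ) : ℝ) * ε : ℝ) : ℂ))
      (by simpa using hμε) b
    have h3 : ∀ s : ℝ, Complex.exp ((((y + l : ℚ) : ℝ) * ε * s : ℝ) : ℂ) *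
        low ((pairs τ ε ([] : List (ι × ℚ))).map wker) s =
        Complex.exp ((((((y + l : ℚ) : ℝ) * ε : ℝ) : ℂ)) * s) := by
      intro s
      simp [pairs, low]
    simp only [h3, h2]
    simp only [boundary, List.map_cons, List.map_nil, List.sum_cons, List.sum_nil, add_zero, mterm,
      List.length_nil, hpow 0 (Nat.zero_le N)]
    push_cast at hμ' ⊢
    simp only [pairs, List.map_nil, low]
    field_simp
  | cons x L =>
    have hx := hL x List.mem_cons_self
    have hτx := hτ x List.mem_cons_self
    have h2 := integral_cexp_mul_low (f := wker (τ x.1, -(x.2 * ε)))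
      (l := (pairs τ ε L).map wker) hμε (wker_continuous (x := (τ x.1, -(x.2 * ε))) hτx)
      (pairs_integrableOn hε hL hτ) (fun b => by
        simp only [cexp_mul_wker]
        exact wker_pair_integrableOn hτx (by linarith) hε b) b
    simp only [cexp_mul_wker] at h2
    have h3 : (pairs τ ε (x :: L)).map wker =
        wker (τ x.1, -(x.2 * ε)) :: (pairs τ ε L).map wker := rfl
    rw [h3, h2]
    simp only [boundary, List.map_cons, List.map_nil, List.sum_cons, List.sum_nil, add_zero, mterm]
    have h4 : ((pairs τ ε ((x.1, x.2 + (y + l)) :: L)).map wker) =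
        wker (τ x.1, -(((x.2 + (y + l) : ℚ) : ℝ) * ε)) :: (pairs τ ε L).map wker := rfl
    simp only [List.length_cons] at hN ⊢
    rw [h3, h4, hpow _ hN]
    push_cast at hμ' ⊢
    simp only [zero_mul, Complex.exp_zero]
    field_simp
    ring

/-- Expand every factor `1 + ker`. Choosing `ker` throughout gives the leading term, with negated
weights; every constant is integrated out and shortens the chain. The coefficients and exponents in
`R` are rational and independent of `τ`, `ε` and `b`, as the weight count requires. -/
theorem low_mker_expansion (L : List (ι × ℚ)) (hL : ∀ x ∈ L, 0 < x.2) :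
    ∃ R : List (ℚ × ℚ × List (ι × ℚ)),
      (∀ ρ ∈ R, 0 ≤ ρ.2.1 ∧ (∀ x ∈ ρ.2.2, 0 < x.2) ∧ ρ.2.2.length < L.length ∧
        (ρ.2.2.map Prod.fst).Sublist (L.map Prod.fst)) ∧
      ∀ τ : ι → ℂ, (∀ x ∈ L, -τ x.1 ∈ Complex.slitPlane) → ∀ ε : ℝ, 0 < ε → ∀ b : ℝ,
        low ((L.map fun x => (τ x.1, (x.2 * ε : ℝ))).map mker) b =
          low ((pairs τ ε L).map wker) b + (R.map (mterm L.length τ ε b)).sum := by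
  induction L with
  | nil => exact ⟨[], by simp, by simp [pairs, low]⟩
  | cons v L ih =>
    obtain ⟨R, hR, h⟩ := ih fun x hx => hL x (List.mem_cons_of_mem _ hx)
    have hv := hL v List.mem_cons_self
    set R' : List (ℚ × ℚ × List (ι × ℚ)) := (1, 0, L) :: R with hR'
    have hRR : ∀ ρ ∈ R', 0 ≤ ρ.2.1 ∧ (∀ x ∈ ρ.2.2, 0 < x.2) ∧ ρ.2.2.length ≤ L.length ∧
        (ρ.2.2.map Prod.fst).Sublist (L.map Prod.fst) := by
      intro ρ hρ
      rcases List.mem_cons.1 hρ with rfl | hρ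
      · exact ⟨le_rfl, fun x hx => hL x (List.mem_cons_of_mem _ hx), le_rfl, List.Sublist.refl _⟩
      · obtain ⟨h1, h2, h3, h4⟩ := hR ρ hρ
        exact ⟨h1, h2, h3.le, h4⟩
    -- The `ker` part of the new factor lengthens each lower term in `R`, and turns the old leading
    -- term into the new one, which is therefore not listed. The constant part acts on all terms
    -- `R'`, including the old leading term.
    refine ⟨R.map (fun ρ => (ρ.1, 0, (v.1, v.2 + ρ.2.1) :: ρ.2.2)) ++ R'.flatMap (boundary v.2),
      ?_, ?_⟩
    · intro ρ hρ
      rcases List.mem_append.1 hρ with hρ | hρ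
      · obtain ⟨σ, hσ, rfl⟩ := List.mem_map.1 hρ
        obtain ⟨h1, h2, h3, h4⟩ := hR σ hσ
        refine ⟨le_rfl, ?_, by simpa using h3, by simpa using h4⟩
        intro x hx
        rcases List.mem_cons.1 hx with rfl | hx
        · exact add_pos_of_pos_of_nonneg hv h1
        · exact h2 x hx
      · obtain ⟨σ, hσ, hρ⟩ := List.mem_flatMap.1 hρ
        obtain ⟨h1, h2, h3, h4⟩ := hRR σ hσ
        obtain ⟨q, l, M⟩ := σ
        simp only at h1 h2 h3 h4
        cases M with
        | nil =>
          simp only [boundary, List.mem_singleton] at hρ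
          subst hρ
          exact ⟨by positivity, by simp, by simp, by simp⟩
        | cons x M =>
          have hsub : ((x :: M).map Prod.fst).Sublist ((v :: L).map Prod.fst) :=
            h4.trans (List.sublist_cons_self _ _)
          simp only [boundary, List.mem_cons, List.not_mem_nil, or_false] at hρ
          simp only [List.length_cons] at h3
          rcases hρ with rfl | rfl
          · exact ⟨by positivity, h2, by simpa using h3, hsub⟩
          · refine ⟨le_rfl, ?_, by simpa using h3, hsub⟩
            intro z hz
            rcases List.mem_cons.1 hz with rfl | hz
            · have := h2 x List.mem_cons_self
              simp only
              positivity
            · exact h2 z (List.mem_cons_of_mem _ hz)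
    · intro τ hτ ε hε b
      have hτv := hτ v List.mem_cons_self
      have hτL : ∀ ρ ∈ R', ∀ x ∈ ρ.2.2, -τ x.1 ∈ Complex.slitPlane := by
        intro ρ hρ x hx
        obtain ⟨z, hz, hzx⟩ := List.mem_map.1
          ((hRR ρ hρ).2.2.2.subset (List.mem_map_of_mem hx))
        rw [← hzx]
        exact hτ z (List.mem_cons_of_mem _ hz)
      have hV : ∀ s, low ((L.map fun x => (τ x.1, (x.2 * ε : ℝ))).map mker) s =
          (R'.map (mterm L.length τ ε s)).sum := by
        intro s
        rw [h τ (fun x hx => hτ x (List.mem_cons_of_mem _ hx)) ε hε s, hR', List.map_cons,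
          List.sum_cons]
        simp [mterm]
      have hpt : ∀ s, mker (τ v.1, (v.2 * ε : ℝ)) s * (R'.map (mterm L.length τ ε s)).sum =
          (R'.map fun ρ => wker (τ v.1, -(v.2 * ε)) s * mterm L.length τ ε s ρ).sum +
          (R'.map fun ρ => Complex.exp ((v.2 * ε * s : ℝ) : ℂ) * mterm L.length τ ε s ρ).sum := by
        intro s
        rw [List.sum_map_mul_left, List.sum_map_mul_left, ← add_mul]
        congr 1
        simp only [mker, wker]
        push_cast
        ring_nf
      have hk : ∀ ρ ∈ R', ∀ s, wker (τ v.1, -(v.2 * ε)) s * mterm L.length τ ε s ρ =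
          ρ.1 * ((ε : ℂ) ^ (L.length - ρ.2.2.length))⁻¹ *
          (wker (τ v.1, -(((v.2 + ρ.2.1 : ℚ) : ℝ) * ε)) s * low ((pairs τ ε ρ.2.2).map wker) s) := by
        intro ρ _ s
        rw [← cexp_mul_wker, mterm]
        ring
      have hLI : ∀ ρ ∈ R', ∀ g ∈ wker (τ v.1, -(((v.2 + ρ.2.1 : ℚ) : ℝ) * ε)) ::
          (pairs τ ε ρ.2.2).map wker, ∀ b, IntegrableOn g (Iic b) := by
        intro ρ hρ g hg
        rcases List.mem_cons.1 hg with rfl | hg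
        · exact wker_pair_integrableOn hτv (add_pos_of_pos_of_nonneg hv (hRR ρ hρ).1) hε
        · exact pairs_integrableOn hε (hRR ρ hρ).2.1 (hτL ρ hρ) g hg
      have i1 : ∀ ρ ∈ R', IntegrableOn
          (fun s => wker (τ v.1, -(v.2 * ε)) s * mterm L.length τ ε s ρ) (Iic b) := by
        intro ρ hρ
        simp only [hk ρ hρ]
        exact (low_integrableOn (hLI ρ hρ) b).const_mul _
      have i2 : ∀ ρ ∈ R', IntegrableOn
          (fun s => Complex.exp ((v.2 * ε * s : ℝ) : ℂ) * mterm L.length τ ε s ρ) (Iic b) := by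
        intro ρ hρ
        have hl := pairs_integrableOn hε (hRR ρ hρ).2.1 (hτL ρ hρ)
        have h0 : (0 : ℝ) < ((v.2 + ρ.2.1 : ℚ) : ℝ) * ε :=
          mul_pos (by exact_mod_cast add_pos_of_pos_of_nonneg hv (hRR ρ hρ).1) hε
        have := low_integrableOn (f := fun s : ℝ =>
          Complex.exp ((((v.2 + ρ.2.1 : ℚ) : ℝ) * ε * s : ℝ) : ℂ)) (fun g hg => by
            rcases List.mem_cons.1 hg with rfl | hg
            · exact fun b => integrableOn_cexp_mul h0 b
            · exact hl g hg) b
        refine (this.const_mul (ρ.1 * ((ε : ℂ) ^ (L.length - ρ.2.2.length))⁻¹)).congr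
          (.of_forall fun s => ?_)
        have e : Complex.exp ((((v.2 + ρ.2.1 : ℚ) : ℝ) * ε * s : ℝ) : ℂ) =
            Complex.exp ((v.2 * ε * s : ℝ) : ℂ) * Complex.exp ((ρ.2.1 * ε * s : ℝ) : ℂ) := by
          rw [← Complex.exp_add]
          push_cast
          ring_nf
        simp only [mterm, e]
        ring
      have h2 : low (((v :: L).map fun x => (τ x.1, (x.2 * ε : ℝ))).map mker) b =
          (R'.map fun ρ => mterm (L.length + 1) τ ε b
            (ρ.1, 0, (v.1, v.2 + ρ.2.1) :: ρ.2.2)).sum +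
          (R'.map fun ρ => ((boundary v.2 ρ).map (mterm (L.length + 1) τ ε b)).sum).sum := by
        have : low (((v :: L).map fun x => (τ x.1, (x.2 * ε : ℝ))).map mker) b =
            ∫ s in Iic b, mker (τ v.1, (v.2 * ε : ℝ)) s *
              low ((L.map fun x => (τ x.1, (x.2 * ε : ℝ))).map mker) s := rfl
        rw [this]
        simp only [hV, hpt]
        rw [integral_add (integrable_list_sum _ _ i1) (integrable_list_sum _ _ i2),
          integral_list_sum _ _ i1, integral_list_sum _ _ i2]
        congr 1
        · refine list_sum_map_congr (M := ℂ) fun ρ hρ => ?_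
          simp only [hk ρ hρ]
          rw [integral_const_mul]
          simp [mterm, pairs, low]
        · exact list_sum_map_congr (M := ℂ) fun ρ hρ => integral_mterm hε (hRR ρ hρ).1
            (hRR ρ hρ).2.1 (hRR ρ hρ).2.2.1 (hτL ρ hρ) hv b
      rw [h2, List.map_append, List.sum_append, hR', List.map_cons, List.sum_cons, ← hR',
        List.map_map, List.map_flatMap, List.flatMap, List.sum_flatten, List.map_map, ← add_assoc]
      congr 2
      simp [mterm]

/-! ### Depth and weight expansions of generating integrals -/

section Decay

variable {E : Type*} [NormedAddCommGroup E]

/-- The primitive vanishing at `-∞`. -/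
noncomputable def prim [NormedSpace ℝ E] (g : ℝ → E) (b : ℝ) : E := ∫ s in Iic b, g s

/-- Continuity on the negative axis, with a bound by `C e^s`. -/
def DecayBy (C : ℝ) (g : ℝ → E) : Prop :=
  ContinuousOn g (Iic 0) ∧ ∀ s ≤ 0, ‖g s‖ ≤ C * Real.exp s

theorem DecayBy.integrableOn {C : ℝ} {g : ℝ → E} (h : DecayBy C g) {b : ℝ} (hb : b ≤ 0) :
    IntegrableOn g (Iic b) := by
  refine ((integrableOn_exp_Iic b).const_mul C).mono'
    ((h.1.mono (Iic_subset_Iic.2 hb)).aestronglyMeasurable measurableSet_Iic)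
    (ae_restrict_of_forall_mem measurableSet_Iic fun s hs => h.2 s (le_trans hs hb))

theorem DecayBy.prim [NormedSpace ℝ E] {C : ℝ} {g : ℝ → E} (h : DecayBy C g) : DecayBy C (prim g) := by
  constructor
  · have hG : Integrable ((Iic 0).indicator g) :=
      (integrable_indicator_iff measurableSet_Iic).2 (h.integrableOn le_rfl)
    refine (continuous_integral_Iic fun b => hG.integrableOn (s := Iic b)).continuousOn.congr ?_
    intro b hb
    refine setIntegral_congr_fun measurableSet_Iic fun s hs => ?_
    have : s ≤ 0 := le_trans hs hb
    simp [this]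
  · intro b hb
    refine (norm_integral_le_of_norm_le ((integrableOn_exp_Iic b).const_mul C)
      (ae_restrict_of_forall_mem measurableSet_Iic fun s hs => h.2 s (le_trans hs hb))).trans ?_
    rw [integral_const_mul, integral_exp_Iic]

theorem DecayBy.iterate_prim [NormedSpace ℝ E] {C : ℝ} {g : ℝ → E} (h : DecayBy C g) (m : ℕ) :
    DecayBy C (MPLParity.prim^[m] g) := by
  induction m with
  | zero => exact h
  | succ m ih => rw [Function.iterate_succ_apply']; exact ih.prim

theorem DecayBy.add {C C' : ℝ} {g g' : ℝ → E} (h : DecayBy C g) (h' : DecayBy C' g') :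
    DecayBy (C + C') fun s => g s + g' s := by
  refine ⟨h.1.add h'.1, fun s hs => (norm_add_le _ _).trans ?_⟩
  rw [add_mul]
  exact add_le_add (h.2 s hs) (h'.2 s hs)

end Decay

theorem DecayBy.const_mul {C : ℝ} {g : ℝ → ℂ} (h : DecayBy C g) (c : ℂ) :
    DecayBy (‖c‖ * C) fun s => c * g s := by
  refine ⟨continuousOn_const.mul h.1, fun s hs => ?_⟩
  rw [norm_mul, mul_assoc]
  exact mul_le_mul_of_nonneg_left (h.2 s hs) (norm_nonneg _)

theorem prim_congr {g g' : ℝ → ℂ} {b : ℝ} (h : ∀ s ≤ b, g s = g' s) : prim g b = prim g' b :=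
  setIntegral_congr_fun measurableSet_Iic fun s hs => h s hs

/-- The iterated integral representing a multiple polylogarithm; the list contains the pairs
`(z_i ⋯ z_d, n_i - 1)`, starting with `i = d`. -/
noncomputable def Lw : List (ℂ × ℕ) → ℝ → ℂ
  | [] => fun _ => 1
  | x :: r => prim^[x.2 + 1] fun s => ker x.1 s * Lw r s

theorem ker_decay {t : ℂ} (ht : -t ∈ Complex.slitPlane) : ∃ C, DecayBy C (ker t) := by
  obtain ⟨C, -, h⟩ := exists_norm_ker_le ht
  exact ⟨C, (ker_continuous ht).continuousOn, fun s _ => (h s).2⟩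

theorem DecayBy.nonneg {E : Type*} [NormedAddCommGroup E] {C : ℝ} {g : ℝ → E}
    (h : DecayBy C g) : 0 ≤ C := by
  have := (norm_nonneg _).trans (h.2 0 le_rfl)
  simpa using this

theorem DecayBy.mul_bdd {C C' : ℝ} {g g' : ℝ → ℂ} (h : DecayBy C g)
    (hc : ContinuousOn g' (Iic 0)) (hb : ∀ s ≤ 0, ‖g' s‖ ≤ C') :
    DecayBy (C * C') fun s => g s * g' s := by
  refine ⟨h.1.mul hc, fun s hs => ?_⟩
  rw [norm_mul, mul_right_comm]
  exact mul_le_mul (h.2 s hs) (hb s hs) (norm_nonneg _)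
    (mul_nonneg h.nonneg (Real.exp_pos _).le)

theorem DecayBy.norm_le {C : ℝ} {g : ℝ → ℂ} (h : DecayBy C g) : ∀ s ≤ 0, ‖g s‖ ≤ C := by
  intro s hs
  refine (h.2 s hs).trans (mul_le_of_le_one_right h.nonneg (Real.exp_le_one_iff.2 hs))

theorem Lw_cons_decay {r : List (ℂ × ℕ)} {C C' : ℝ} {x : ℂ × ℕ} (hx : DecayBy C (ker x.1))
    (hc : ContinuousOn (Lw r) (Iic 0)) (hb : ∀ s ≤ 0, ‖Lw r s‖ ≤ C') :
    DecayBy (C * C') (Lw (x :: r)) := (hx.mul_bdd hc hb).iterate_prim _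

theorem Lw_bdd {L : List (ℂ × ℕ)} (hL : ∀ x ∈ L, -x.1 ∈ Complex.slitPlane) :
    ContinuousOn (Lw L) (Iic 0) ∧ ∃ C, ∀ s ≤ 0, ‖Lw L s‖ ≤ C := by
  induction L with
  | nil => exact ⟨continuousOn_const, 1, by simp [Lw]⟩
  | cons x L ih =>
    obtain ⟨hc, C, hC⟩ := ih fun y hy => hL y (List.mem_cons_of_mem _ hy)
    obtain ⟨C', hC'⟩ := ker_decay (hL x List.mem_cons_self)
    have := Lw_cons_decay hC' hc hC
    exact ⟨this.1, _, this.norm_le⟩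

/-- The generating integral of `L`, with all weights multiplied by `ε`. -/
noncomputable def genInt (L : List (ℂ × ℝ)) (ε b : ℝ) : ℂ :=
  low ((L.map fun x => (x.1, x.2 * ε)).map wker) b

/-- The generating integral, normalized by an exponential. -/
noncomputable def gen (L : List (ℂ × ℝ)) (ε b : ℝ) : ℂ :=
  Complex.exp ((total L * ε * b : ℝ) : ℂ) * genInt L ε b

/-- The coefficients of the generating integral. -/
noncomputable def coef : List (ℂ × ℝ) → ℕ → ℝ → ℂ
  | [], k => fun _ => if k = 0 then 1 else 0
  | x :: L, k => k.rec (prim fun s => ker x.1 s * coef L 0 s) fun k c b =>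
      prim (fun s => ker x.1 s * coef L (k + 1) s) b + total (x :: L) * prim c b

theorem coef_cons_zero (x : ℂ × ℝ) (L : List (ℂ × ℝ)) :
    coef (x :: L) 0 = prim fun s => ker x.1 s * coef L 0 s := rfl

theorem coef_cons_succ (x : ℂ × ℝ) (L : List (ℂ × ℝ)) (k : ℕ) :
    coef (x :: L) (k + 1) = fun b => prim (fun s => ker x.1 s * coef L (k + 1) s) b +
      total (x :: L) * prim (coef (x :: L) k) b := rfl

theorem coef_bdd {L : List (ℂ × ℝ)} (hL : ∀ x ∈ L, -x.1 ∈ Complex.slitPlane) (k : ℕ) :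
    ContinuousOn (coef L k) (Iic 0) ∧ (∃ C, ∀ s ≤ 0, ‖coef L k s‖ ≤ C) ∧
      (L ≠ [] → ∃ C, DecayBy C (coef L k)) := by
  induction L generalizing k with
  | nil =>
    refine ⟨continuousOn_const, ⟨1, fun s _ => ?_⟩, by simp⟩
    simp only [coef]
    split_ifs <;> simp
  | cons x L ih =>
    obtain ⟨C', hC'⟩ := ker_decay (hL x List.mem_cons_self)
    have h1 : ∀ k, ∃ C, DecayBy C (prim fun s => ker x.1 s * coef L k s) := by
      intro k
      obtain ⟨hc, ⟨C, hC⟩, -⟩ := ih (fun y hy => hL y (List.mem_cons_of_mem _ hy)) k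
      exact ⟨_, (hC'.mul_bdd hc hC).prim⟩
    have h2 : ∃ C, DecayBy C (coef (x :: L) k) := by
      induction k with
      | zero => exact h1 0
      | succ k ihk =>
        obtain ⟨C, hC⟩ := ihk
        obtain ⟨D, hD⟩ := h1 (k + 1)
        exact ⟨_, hD.add (hC.prim.const_mul _)⟩
    obtain ⟨C, hC⟩ := h2
    exact ⟨hC.1, ⟨C, hC.norm_le⟩, fun _ => ⟨C, hC⟩⟩

theorem gen_cons (x : ℂ × ℝ) (L : List (ℂ × ℝ)) (ε b : ℝ) :
    gen (x :: L) ε b = ∫ s in Iic b,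
      Complex.exp ((total (x :: L) * ε * (b - s) : ℝ) : ℂ) * (ker x.1 s * gen L ε s) := by
  simp only [gen, genInt, List.map_cons, low]
  rw [← integral_const_mul]
  refine integral_congr_ae (.of_forall fun s => ?_)
  simp only [wker]
  have h1 : total (x :: L) = x.2 + total L := by simp [total]
  have h2 : Complex.exp ((total (x :: L) * ε * b : ℝ) : ℂ) *
      Complex.exp ((-(x.2 * ε * s) : ℝ) : ℂ) =
      Complex.exp ((total (x :: L) * ε * (b - s) : ℝ) : ℂ) *
        Complex.exp ((total L * ε * s : ℝ) : ℂ) := by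
    rw [← Complex.exp_add, ← Complex.exp_add, h1]
    push_cast
    ring_nf
  linear_combination (ker x.1 s * low ((L.map fun x => (x.1, x.2 * ε)).map wker) s) * h2

theorem eventually_mul_lt (y : ℝ) {c : ℝ} (hc : 0 < c) : ∀ᶠ ε in 𝓝[>] (0 : ℝ), y * ε < c := by
  have : Tendsto (fun ε : ℝ => y * ε) (𝓝[>] 0) (𝓝 0) := by
    have h : Continuous fun ε : ℝ => y * ε := by fun_prop
    simpa using (h.tendsto 0).mono_left nhdsWithin_le_nhds
  exact this.eventually_lt_const hc

theorem eventually_forall_mul_lt (L : List (ℂ × ℝ)) :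
    ∀ᶠ ε in 𝓝[>] (0 : ℝ), ∀ y ∈ L, y.2 * ε < 1 := by
  induction L with
  | nil => simp
  | cons y L ih =>
    filter_upwards [ih, eventually_mul_lt y.2 one_pos] with ε h1 h2
    exact List.forall_mem_cons.2 ⟨h2, h1⟩

/-- The bounds must be uniform in small `ε`, because `gen_expansion` starts from them as its case `N
= 0`. -/
theorem gen_bdd {L : List (ℂ × ℝ)} (hL : ∀ x ∈ L, -x.1 ∈ Complex.slitPlane) :
    ∃ C, ∀ᶠ ε in 𝓝[>] (0 : ℝ), ContinuousOn (gen L ε) (Iic 0) ∧ (∀ s ≤ 0, ‖gen L ε s‖ ≤ C) ∧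
      (L ≠ [] → DecayBy C (gen L ε)) := by
  induction L with
  | nil =>
    refine ⟨1, .of_forall fun ε => ?_⟩
    have : gen [] ε = fun _ => 1 := by
      ext b
      simp [gen, genInt, low, total]
    rw [this]
    exact ⟨continuousOn_const, by simp, by simp⟩
  | cons x L ih =>
    obtain ⟨C, hC⟩ := ih fun y hy => hL y (List.mem_cons_of_mem _ hy)
    obtain ⟨D, hD⟩ := ker_decay (hL x List.mem_cons_self)
    have hLI := eventually_forall_mul_lt (x :: L)
    -- The factor `2` bounds `1 / (1 - a)`, where `a = |total (x :: L)| ε` is below `1/2` for small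
    -- `ε`.
    refine ⟨2 * (D * C), ?_⟩
    filter_upwards [hC, hLI, eventually_mul_lt |total (x :: L)| (c := 1 / 2) (by norm_num),
      self_mem_nhdsWithin] with ε hε h1 h2 h0
    have h0' : 0 < ε := h0
    have hcont : Continuous (gen (x :: L) ε) := by
      refine Continuous.mul (by fun_prop) (low_continuous fun f hf b => ?_)
      simp only [List.map_map, List.mem_map, Function.comp] at hf
      obtain ⟨y, hy, rfl⟩ := hf
      exact wker_integrableOn_Iic (x := (y.1, y.2 * ε)) (hL y hy) (h1 y hy) b
    have hd := hD.mul_bdd hε.1 hε.2.1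
    have key : DecayBy (2 * (D * C)) (gen (x :: L) ε) := by
      refine ⟨hcont.continuousOn, fun b hb => ?_⟩
      set a := |total (x :: L)| * ε with ha
      have hi := (integrableOn_exp_mul_Iic (a := 1 - a) (by linarith) b).const_mul
        (Real.exp (a * b) * (D * C))
      rw [gen_cons]
      refine (norm_integral_le_of_norm_le hi
        (ae_restrict_of_forall_mem measurableSet_Iic fun s hs => ?_)).trans ?_
      · rw [norm_mul, Complex.norm_exp_ofReal]
        have hs' : s ≤ b := hs
        have e1 : total (x :: L) * ε * (b - s) ≤ a * (b - s) := by
          have : 0 ≤ b - s := by linarith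
          rw [ha]
          gcongr
          exact le_abs_self _
        calc _ ≤ Real.exp (a * (b - s)) * (D * C * Real.exp s) := by
              gcongr
              exact hd.2 s (hs'.trans hb)
          _ = _ := by
              have : Real.exp (a * (b - s)) * Real.exp s =
                  Real.exp (a * b) * Real.exp ((1 - a) * s) := by
                rw [← Real.exp_add, ← Real.exp_add]
                ring_nf
              linear_combination (D * C) * this
      · rw [integral_const_mul, integral_exp_mul_Iic (by linarith)]
        have hDC : 0 ≤ D * C := hd.nonneg
        have e2 : Real.exp (a * b) * Real.exp ((1 - a) * b) = Real.exp b := by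
          rw [← Real.exp_add]
          ring_nf
        calc Real.exp (a * b) * (D * C) * (Real.exp ((1 - a) * b) / (1 - a))
            = (D * C) * Real.exp b / (1 - a) := by rw [← e2]; ring
          _ ≤ (D * C) * Real.exp b / (1 / 2) := by
              gcongr
              linarith
          _ = _ := by ring
    exact ⟨key.1, key.norm_le, fun _ => key⟩

/-- With `α = total (x :: L)`, the normalized integral satisfies `G' = ker x.1 · gen L ε + α ε G`
and vanishes at `-∞`; integrate. Comparing powers of `ε` yields the recursion that defines `coef`.
-/
theorem gen_eq {x : ℂ × ℝ} {L : List (ℂ × ℝ)} (hL : ∀ y ∈ x :: L, -y.1 ∈ Complex.slitPlane)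
    {C : ℝ} {ε : ℝ} (hε : ∀ y ∈ x :: L, y.2 * ε < 1) (hC : DecayBy C (gen (x :: L) ε))
    (hc : ContinuousOn (gen L ε) (Iic 0)) (hb : ∀ s ≤ 0, ‖gen L ε s‖ ≤ C) {b : ℝ} (hb0 : b ≤ 0) :
    gen (x :: L) ε b = prim (fun s => ker x.1 s * gen L ε s) b +
      (total (x :: L) * ε : ℝ) * prim (gen (x :: L) ε) b := by
  obtain ⟨D, hD⟩ := ker_decay (hL x List.mem_cons_self)
  have hd := hD.mul_bdd hc hb
  have hexp : ∀ s : ℝ, HasDerivAt (fun s : ℝ => Complex.exp ((total (x :: L) * ε * s : ℝ) : ℂ))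
      (Complex.exp ((total (x :: L) * ε * s : ℝ) : ℂ) * (total (x :: L) * ε : ℝ)) s := by
    intro s
    have h1 : HasDerivAt (fun s : ℝ => ((total (x :: L) * ε * s : ℝ) : ℂ))
        ((total (x :: L) * ε : ℝ) : ℂ) s := by
      have := ((hasDerivAt_id s).const_mul (total (x :: L) * ε)).ofReal_comp
      simpa using this
    exact h1.cexp
  have hder : ∀ s ∈ Iic b, HasDerivAt (gen (x :: L) ε) (ker x.1 s * gen L ε s +
      (total (x :: L) * ε : ℝ) * gen (x :: L) ε s) s := by
    intro s _
    have h1 := hasDerivAt_low (f := wker (x.1, x.2 * ε))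
      (l := (L.map fun x => (x.1, x.2 * ε)).map wker)
      (wker_continuous (x := (x.1, x.2 * ε)) (hL x List.mem_cons_self)) (fun f hf b => by
        rw [← List.map_cons, ← List.map_cons (f := fun x : ℂ × ℝ => (x.1, x.2 * ε))] at hf
        simp only [List.map_map, List.mem_map, Function.comp] at hf
        obtain ⟨y, hy, rfl⟩ := hf
        exact wker_integrableOn_Iic (x := (y.1, y.2 * ε)) (hL y hy) (hε y hy) b) s
    refine ((hexp s).mul h1).congr_deriv ?_
    have h2 : Complex.exp ((total (x :: L) * ε * s : ℝ) : ℂ) *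
        Complex.exp ((-(x.2 * ε * s) : ℝ) : ℂ) = Complex.exp ((total L * ε * s : ℝ) : ℂ) := by
      rw [← Complex.exp_add]
      simp only [total, List.map_cons, List.sum_cons]
      push_cast
      ring_nf
    simp only [gen, genInt, wker, List.map_cons]
    rw [← h2]
    ring
  have hlim : Tendsto (gen (x :: L) ε) atBot (𝓝 0) := by
    refine squeeze_zero_norm' (a := fun s => C * Real.exp s) ?_ ?_
    · filter_upwards [eventually_le_atBot 0] with s hs using hC.2 s hs
    · simpa using Real.tendsto_exp_atBot.const_mul C
  have := integral_Iic_of_hasDerivAt_of_tendsto' hder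
    ((hd.integrableOn hb0).add ((hC.integrableOn hb0).const_mul _)) hlim
  rw [integral_add (hd.integrableOn hb0) ((hC.integrableOn hb0).const_mul _), integral_const_mul,
    sub_zero] at this
  exact this.symm

theorem gen_expansion {L : List (ℂ × ℝ)} (hL : ∀ x ∈ L, -x.1 ∈ Complex.slitPlane) (N : ℕ) :
    ∃ C, ∀ᶠ ε in 𝓝[>] (0 : ℝ),
      (∀ s ≤ 0, ‖gen L ε s - ∑ k ∈ Finset.range N, coef L k s * (ε : ℂ) ^ k‖ ≤ C * ε ^ N) ∧
      (L ≠ [] → ∀ s ≤ 0, ‖gen L ε s - ∑ k ∈ Finset.range N, coef L k s * (ε : ℂ) ^ k‖ ≤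
        C * ε ^ N * Real.exp s) := by
  induction L generalizing N with
  | nil =>
    refine ⟨1, ?_⟩
    filter_upwards [self_mem_nhdsWithin] with ε hε
    have h0 : (0 : ℝ) < ε := hε
    have : gen [] ε = fun _ => 1 := by
      ext b
      simp [gen, genInt, low, total]
    refine ⟨fun s _ => ?_, by simp⟩
    rw [this]
    cases N with
    | zero => simp
    | succ N =>
      rw [Finset.sum_range_succ']
      simp only [coef]
      simp
      positivity
  | cons x L ih =>
    have hL' : ∀ y ∈ L, -y.1 ∈ Complex.slitPlane := fun y hy => hL y (List.mem_cons_of_mem _ hy)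
    obtain ⟨D, hD⟩ := ker_decay (hL x List.mem_cons_self)
    have hLI := eventually_forall_mul_lt (x :: L)
    obtain ⟨B, hB⟩ := gen_bdd hL
    obtain ⟨B', hB'⟩ := gen_bdd hL'
    have key : ∃ C, ∀ᶠ ε in 𝓝[>] (0 : ℝ), DecayBy (C * ε ^ N)
        fun s => gen (x :: L) ε s - ∑ k ∈ Finset.range N, coef (x :: L) k s * (ε : ℂ) ^ k := by
      have hcoef : ∀ (n : ℕ) (M : List (ℂ × ℝ)), (∀ y ∈ M, -y.1 ∈ Complex.slitPlane) → ∀ ε : ℝ,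
          ContinuousOn (fun s => ∑ k ∈ Finset.range n, coef M k s * (ε : ℂ) ^ k) (Iic 0) :=
        fun n M hM ε => continuousOn_finsetSum _ fun k _ =>
          (coef_bdd hM k).1.mul continuousOn_const
      -- By `gen_eq`, the remainder of order `N + 1` for `x :: L` is a primitive of the kernel times
      -- the one of order `N + 1` for `L`, plus `ε` times a primitive of the one of order `N` for `x
      -- :: L`. Hence an induction on `N` inside that on the list.
      induction N with
      | zero =>
        refine ⟨B, ?_⟩
        filter_upwards [hB] with ε hε
        simpa using hε.2.2 (by simp)
      | succ N ihN =>
        obtain ⟨C₁, h₁⟩ := ihN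
        obtain ⟨C₂, h₂⟩ := ih hL' (N + 1)
        refine ⟨D * C₂ + |total (x :: L)| * C₁, ?_⟩
        filter_upwards [h₁, h₂, hB, hB', hLI, self_mem_nhdsWithin] with ε e₁ e₂ e₃ e₄ e₅ h0
        have h0' : 0 < ε := h0
        set M := max B B'
        have d₁ : DecayBy (D * (C₂ * ε ^ (N + 1))) fun s => ker x.1 s * (gen L ε s -
            ∑ k ∈ Finset.range (N + 1), coef L k s * (ε : ℂ) ^ k) :=
          hD.mul_bdd (e₄.1.sub (hcoef _ _ hL' _)) e₂.1
        have d₂ := e₁.prim.const_mul ((total (x :: L) * ε : ℝ) : ℂ)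
        have hsum := d₁.prim.add d₂
        have hconst : D * (C₂ * ε ^ (N + 1)) + ‖((total (x :: L) * ε : ℝ) : ℂ)‖ * (C₁ * ε ^ N) =
            (D * C₂ + |total (x :: L)| * C₁) * ε ^ (N + 1) := by
          rw [Complex.norm_real, Real.norm_eq_abs, abs_mul, abs_of_pos h0']
          ring
        rw [hconst] at hsum
        have heq : ∀ s ≤ 0, gen (x :: L) ε s -
            ∑ k ∈ Finset.range (N + 1), coef (x :: L) k s * (ε : ℂ) ^ k =
            prim (fun s => ker x.1 s * (gen L ε s -
              ∑ k ∈ Finset.range (N + 1), coef L k s * (ε : ℂ) ^ k)) s +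
            ((total (x :: L) * ε : ℝ) : ℂ) * prim (fun s => gen (x :: L) ε s -
              ∑ k ∈ Finset.range N, coef (x :: L) k s * (ε : ℂ) ^ k) s := by
          intro s hs
          have hg := e₃.2.2 (by simp)
          have hk : ∀ k, ∃ C, DecayBy C fun s => ker x.1 s * coef L k s := fun k => by
            obtain ⟨hc, ⟨C, hC⟩, -⟩ := coef_bdd hL' k
            exact ⟨_, hD.mul_bdd hc hC⟩
          have p₁ : prim (fun s => ker x.1 s * (gen L ε s -
              ∑ k ∈ Finset.range (N + 1), coef L k s * (ε : ℂ) ^ k)) s =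
              prim (fun s => ker x.1 s * gen L ε s) s -
              ∑ k ∈ Finset.range (N + 1), prim (fun s => ker x.1 s * coef L k s) s *
                (ε : ℂ) ^ k := by
            have : ∀ r, ker x.1 r * (gen L ε r -
                ∑ k ∈ Finset.range (N + 1), coef L k r * (ε : ℂ) ^ k) =
                ker x.1 r * gen L ε r -
                ∑ k ∈ Finset.range (N + 1), ker x.1 r * coef L k r * (ε : ℂ) ^ k := by
              intro r
              rw [mul_sub, Finset.mul_sum]
              simp only [mul_assoc]
            simp only [prim, this]
            rw [integral_sub ((hD.mul_bdd e₄.1 e₄.2.1).integrableOn hs), integral_finsetSum]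
            · simp only [integral_mul_const]
            · intro k _
              obtain ⟨C, hC⟩ := hk k
              exact (hC.integrableOn hs).mul_const _
            · refine integrable_finsetSum _ fun k _ => ?_
              obtain ⟨C, hC⟩ := hk k
              exact (hC.integrableOn hs).mul_const _
          have p₂ : prim (fun s => gen (x :: L) ε s -
              ∑ k ∈ Finset.range N, coef (x :: L) k s * (ε : ℂ) ^ k) s =
              prim (gen (x :: L) ε) s -
              ∑ k ∈ Finset.range N, prim (coef (x :: L) k) s * (ε : ℂ) ^ k := by
            simp only [prim]
            rw [integral_sub (hg.integrableOn hs), integral_finsetSum]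
            · simp only [integral_mul_const]
            · intro k _
              obtain ⟨C, hC⟩ := (coef_bdd hL k).2.2 (by simp)
              exact (hC.integrableOn hs).mul_const _
            · refine integrable_finsetSum _ fun k _ => ?_
              obtain ⟨C, hC⟩ := (coef_bdd hL k).2.2 (by simp)
              exact (hC.integrableOn hs).mul_const _
          have hge : gen (x :: L) ε s = prim (fun s => ker x.1 s * gen L ε s) s +
              (total (x :: L) * ε : ℝ) * prim (gen (x :: L) ε) s :=
            gen_eq hL e₅ (C := M) ⟨hg.1, fun s hs => (hg.2 s hs).trans (by
              gcongr; exact le_max_left _ _)⟩ e₄.1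
              (fun s hs => (e₄.2.1 s hs).trans (le_max_right _ _)) hs
          rw [p₁, p₂, hge, Finset.sum_range_succ', Finset.sum_range_succ']
          simp only [coef_cons_zero, coef_cons_succ, add_mul, Finset.sum_add_distrib, pow_succ]
          rw [mul_sub, Finset.mul_sum]
          have : ∀ k, ((total (x :: L) : ℝ) : ℂ) * prim (coef (x :: L) k) s * ((ε : ℂ) ^ k * ε) =
              ((total (x :: L) * ε : ℝ) : ℂ) * (prim (coef (x :: L) k) s * (ε : ℂ) ^ k) := by
            intro k
            push_cast
            ring
          simp only [this]
          ring
        refine ⟨e₃.1.sub (hcoef _ _ hL _), fun s hs => ?_⟩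
        simp only [heq s hs]
        exact hsum.2 s hs
    obtain ⟨C, hC⟩ := key
    refine ⟨C, ?_⟩
    filter_upwards [hC] with ε hε
    exact ⟨hε.norm_le, fun _ => hε.2⟩

/-! ### Compositions -/

/-- The list of all lists of length `e` of natural numbers with sum `k`. -/
def comps : ℕ → ℕ → List (List ℕ)
  | 0, k => if k = 0 then [[]] else []
  | e + 1, k => (List.range (k + 1)).flatMap fun i => (comps e (k - i)).map fun ms => i :: ms

theorem length_of_mem_comps {e k : ℕ} {ms : List ℕ} (h : ms ∈ comps e k) :
    ms.length = e ∧ ms.sum = k := by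
  induction e generalizing k ms with
  | zero =>
    simp only [comps] at h
    split_ifs at h with hk
    · simp_all
    · simp at h
  | succ e ih =>
    simp only [comps, List.mem_flatMap, List.mem_range, List.mem_map] at h
    obtain ⟨i, hi, ns, hns, rfl⟩ := h
    obtain ⟨h1, h2⟩ := ih hns
    simp only [List.length_cons, List.sum_cons]
    omega

theorem mem_comps (ms : List ℕ) : ms ∈ comps ms.length ms.sum := by
  induction ms with
  | nil => simp [comps]
  | cons m ms ih =>
    simp only [List.length_cons, List.sum_cons, comps, List.mem_flatMap, List.mem_range,
      List.mem_map]
    exact ⟨m, by omega, ms, by simpa using ih, rfl⟩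

/-- Increment the first entry of a list. -/
def bump : List ℕ → List ℕ
  | [] => []
  | m :: ms => (m + 1) :: ms

/-- Either the first part is `0`, or it is the increment of another first part. This matches the two
terms in the recursion for `coef`. -/
theorem comps_succ_succ (e k : ℕ) : comps (e + 1) (k + 1) =
    (comps e (k + 1)).map (fun ms => 0 :: ms) ++ (comps (e + 1) k).map bump := by
  rw [comps, List.range_succ_eq_map, List.flatMap_cons, List.flatMap_map, comps, List.map_flatMap]
  simp [bump, Function.comp_def]

/-- The product of the powers `α_i ^ m_i` of the partial sums of the weights. -/
noncomputable def wt : List (ℂ × ℝ) → List ℕ → ℂ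
  | x :: L, m :: ms => (total (x :: L) : ℂ) ^ m * wt L ms
  | _, _ => 1

/-- The list of arguments and indices of a multiple polylogarithm. -/
def attach (L : List (ℂ × ℝ)) (ms : List ℕ) : List (ℂ × ℕ) :=
  List.zipWith (fun x m => (x.1, m)) L ms

theorem slit_of_mem_attach {L : List (ℂ × ℝ)} (hL : ∀ x ∈ L, -x.1 ∈ Complex.slitPlane)
    (ms : List ℕ) : ∀ x ∈ attach L ms, -x.1 ∈ Complex.slitPlane := by
  induction L generalizing ms with
  | nil => simp [attach]
  | cons y L ih =>
    cases ms with
    | nil => simp [attach]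
    | cons m ms =>
      exact List.forall_mem_cons.2 ⟨hL y List.mem_cons_self,
        ih (fun x hx => hL x (List.mem_cons_of_mem _ hx)) ms⟩

theorem prim_list_sum {α : Type*} (l : List α) (c : α → ℂ) (g : α → ℝ → ℂ)
    (h : ∀ x ∈ l, ∃ C, DecayBy C (g x)) {b : ℝ} (hb : b ≤ 0) :
    prim (fun s => (l.map fun x => c x * g x s).sum) b = (l.map fun x => c x * prim (g x) b).sum := by
  rw [prim, integral_list_sum]
  · simp only [integral_const_mul]
    rfl
  · intro x hx
    obtain ⟨C, hC⟩ := h x hx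
    exact (hC.integrableOn hb).const_mul _

/-- A further primitive in the recursion raises the first exponent by one and contributes one factor
`total (x :: L)`; unrolling it gives the sum over compositions. -/
theorem coef_eq {L : List (ℂ × ℝ)} (hL : ∀ x ∈ L, -x.1 ∈ Complex.slitPlane) (k : ℕ) {b : ℝ}
    (hb : b ≤ 0) :
    coef L k b = ((comps L.length k).map fun ms => wt L ms * Lw (attach L ms) b).sum := by
  induction L generalizing k b with
  | nil =>
    by_cases hk : k = 0
    · simp [coef, comps, hk, wt, attach, Lw]
    · simp [coef, comps, hk]
  | cons x L ih =>
    have hL' : ∀ y ∈ L, -y.1 ∈ Complex.slitPlane := fun y hy => hL y (List.mem_cons_of_mem _ hy)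
    obtain ⟨D, hD⟩ := ker_decay (hL x List.mem_cons_self)
    have hdec : ∀ ms, ∃ C, DecayBy C fun s => ker x.1 s * Lw (attach L ms) s := by
      intro ms
      obtain ⟨hc, C, hC⟩ := Lw_bdd (slit_of_mem_attach hL' ms)
      exact ⟨_, hD.mul_bdd hc hC⟩
    have hfirst : ∀ k, ∀ b ≤ 0, prim (fun s => ker x.1 s * coef L k s) b =
        (((comps L.length k).map fun ms => 0 :: ms).map fun ms =>
          wt (x :: L) ms * Lw (attach (x :: L) ms) b).sum := by
      intro k b hb
      rw [prim_congr (g' := fun s => ((comps L.length k).map fun ms =>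
        wt L ms * (ker x.1 s * Lw (attach L ms) s)).sum), prim_list_sum _ _ _ (fun ms _ => hdec ms) hb,
        List.map_map]
      · refine list_sum_map_congr (M := ℂ) fun ms _ => ?_
        simp [wt, attach, Lw]
      · intro s hs
        rw [ih hL' k (hs.trans hb), ← List.sum_map_mul_left]
        exact list_sum_map_congr (M := ℂ) fun ms _ => by ring
    induction k generalizing b with
    | zero =>
      rw [coef_cons_zero, hfirst 0 b hb]
      simp [comps]
    | succ k ihk =>
      rw [coef_cons_succ, List.length_cons, comps_succ_succ, List.map_append, List.sum_append,
        ← hfirst (k + 1) b hb]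
      refine congrArg (_ + ·) ?_
      rw [prim_congr (g := coef (x :: L) k) (g' := fun s => ((comps (L.length + 1) k).map fun ms =>
        wt (x :: L) ms * Lw (attach (x :: L) ms) s).sum) fun s hs => ihk (hs.trans hb),
        prim_list_sum _ _ _ _ hb, List.map_map, ← List.sum_map_mul_left]
      · refine list_sum_map_congr (M := ℂ) fun ms hms => ?_
        obtain ⟨m, ms, rfl⟩ : ∃ m ns, ms = m :: ns := by
          apply List.exists_cons_of_ne_nil
          rintro rfl
          simpa using (length_of_mem_comps hms).1
        simp only [Function.comp, bump, wt, attach, List.zipWith_cons_cons, Lw]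
        rw [Function.iterate_succ_apply' prim (m + 1), pow_succ]
        ring
      · intro ms hms
        obtain ⟨m, ms, rfl⟩ : ∃ m ns, ms = m :: ns := by
          apply List.exists_cons_of_ne_nil
          rintro rfl
          simpa using (length_of_mem_comps hms).1
        obtain ⟨C, hC⟩ := hdec ms
        exact ⟨C, hC.iterate_prim _⟩

/-! ### Asymptotic expansions -/

/-- `f` has the asymptotic expansion `∑ a k ε^k` as `ε → 0+`. -/
def HasAsymp (f : ℝ → ℂ) (a : ℕ → ℂ) : Prop :=
  ∀ N, (fun ε : ℝ => f ε - ∑ k ∈ Finset.range N, a k * (ε : ℂ) ^ k) =O[𝓝[>] 0] fun ε => ε ^ N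

theorem HasAsymp.congr {f g : ℝ → ℂ} {a : ℕ → ℂ} (h : HasAsymp f a) (hfg : f =ᶠ[𝓝[>] 0] g) :
    HasAsymp g a := by
  intro N
  refine (h N).congr' ?_ .rfl
  filter_upwards [hfg] with ε hε
  rw [hε]

theorem HasAsymp.congr_coef {f : ℝ → ℂ} {a b : ℕ → ℂ} (h : HasAsymp f a) (hab : ∀ k, a k = b k) :
    HasAsymp f b := funext hab ▸ h

theorem HasAsymp.add {f g : ℝ → ℂ} {a b : ℕ → ℂ} (hf : HasAsymp f a) (hg : HasAsymp g b) :
    HasAsymp (fun ε => f ε + g ε) fun k => a k + b k := by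
  intro N
  refine ((hf N).add (hg N)).congr_left fun ε => ?_
  simp only [add_mul, Finset.sum_add_distrib]
  ring

theorem HasAsymp.const_mul {f : ℝ → ℂ} {a : ℕ → ℂ} (hf : HasAsymp f a) (c : ℂ) :
    HasAsymp (fun ε => c * f ε) fun k => c * a k := by
  intro N
  refine ((hf N).const_mul_left c).congr_left fun ε => ?_
  simp only [mul_sub, Finset.mul_sum, mul_assoc]

theorem isBigO_eps : (fun ε : ℝ => (ε : ℂ)) =O[𝓝[>] 0] fun ε : ℝ => ε :=
  IsBigO.of_bound 1 (.of_forall fun ε => by simp)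

/-- Shift of a sequence by one place. -/
def shift (a : ℕ → ℂ) : ℕ → ℂ
  | 0 => 0
  | k + 1 => a k

theorem HasAsymp.eps_mul {f : ℝ → ℂ} {a : ℕ → ℂ} (hf : HasAsymp f a) :
    HasAsymp (fun ε => ε * f ε) (shift a) := by
  intro N
  cases N with
  | zero =>
    have h1 : (fun ε : ℝ => (ε : ℂ)) =O[𝓝[>] 0] fun ε : ℝ => (1 : ℝ) := by
      refine isBigO_eps.trans ?_
      have : Tendsto (fun ε : ℝ => ε) (𝓝[>] 0) (𝓝 0) := nhdsWithin_le_nhds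
      exact this.isBigO_one ℝ
    have := h1.mul (hf 0)
    simpa using this
  | succ N =>
    refine (isBigO_eps.mul (hf N)).congr (fun ε => ?_) fun ε => (pow_succ' _ _).symm
    rw [Finset.sum_range_succ', mul_sub, Finset.mul_sum]
    simp only [shift, zero_mul, add_zero, pow_succ]
    congr 1
    exact Finset.sum_congr rfl fun k _ => by ring

theorem HasAsymp.tail {f : ℝ → ℂ} {a : ℕ → ℂ} (hf : HasAsymp f a) :
    HasAsymp (fun ε => (f ε - a 0) * (ε : ℂ)⁻¹) fun k => a (k + 1) := by
  intro N
  have h1 : (fun ε : ℝ => ((ε : ℂ))⁻¹) =O[𝓝[>] 0] fun ε : ℝ => ε⁻¹ :=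
    IsBigO.of_bound 1 (.of_forall fun ε => by simp)
  refine ((hf (N + 1)).mul h1).congr' ?_ ?_
  · filter_upwards [self_mem_nhdsWithin] with ε hε
    have h0 : (ε : ℂ) ≠ 0 := by exact_mod_cast (ne_of_gt hε)
    rw [Finset.sum_range_succ', ← sub_sub, sub_right_comm, sub_mul, Finset.sum_mul]
    simp only [pow_zero, mul_one]
    congr 1
    refine Finset.sum_congr rfl fun k _ => ?_
    field_simp
    ring
  · filter_upwards [self_mem_nhdsWithin] with ε hε
    have h0 : ε ≠ 0 := ne_of_gt hε
    field_simp
    ring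

theorem HasAsymp.tendsto {f : ℝ → ℂ} {a : ℕ → ℂ} (hf : HasAsymp f a) :
    Tendsto f (𝓝[>] 0) (𝓝 (a 0)) := by
  have h := hf 1
  simp only [Finset.range_one, Finset.sum_singleton, pow_zero, mul_one, pow_one] at h
  have h2 : Tendsto (fun ε : ℝ => ε) (𝓝[>] 0) (𝓝 0) := nhdsWithin_le_nhds
  have := h.trans_tendsto h2
  simpa using this.add_const (a 0)

/-- The constant term is the limit; subtracting it and dividing by `ε` shifts the sequence. -/
theorem HasAsymp.unique {f : ℝ → ℂ} {a b : ℕ → ℂ} (ha : HasAsymp f a) (hb : HasAsymp f b) :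
    a = b := by
  ext k
  induction k generalizing f a b with
  | zero => exact tendsto_nhds_unique ha.tendsto hb.tendsto
  | succ k ih =>
    have h0 : a 0 = b 0 := tendsto_nhds_unique ha.tendsto hb.tendsto
    have h1 := ha.tail
    rw [h0] at h1
    exact ih h1 hb.tail

/-- Induction on the order of truncation, with `f g = a 0 · g + ε · f₁ g`, where `f₁` is the shifted
function of `HasAsymp.tail`. -/
theorem HasAsymp.mul {f g : ℝ → ℂ} {a b : ℕ → ℂ} (hf : HasAsymp f a) (hg : HasAsymp g b) :
    HasAsymp (fun ε => f ε * g ε) fun k => ∑ p ∈ Finset.HasAntidiagonal.antidiagonal k, a p.1 * b p.2 := by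
  intro N
  induction N generalizing f a with
  | zero => simpa using (hf 0).mul (hg 0)
  | succ N ih =>
    have h1 := isBigO_eps.mul (ih hf.tail)
    have h2 := (hg (N + 1)).const_mul_left (a 0)
    refine (h2.add (h1.congr_right fun ε => (pow_succ' _ _).symm)).congr' ?_ .rfl
    filter_upwards [self_mem_nhdsWithin] with ε hε
    have h0 : (ε : ℂ) ≠ 0 := by exact_mod_cast (ne_of_gt hε)
    have e1 : ∑ k ∈ Finset.range (N + 1),
        (∑ p ∈ Finset.HasAntidiagonal.antidiagonal k, a p.1 * b p.2) * (ε : ℂ) ^ k =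
        a 0 * ∑ k ∈ Finset.range (N + 1), b k * (ε : ℂ) ^ k +
        ε * ∑ k ∈ Finset.range N,
          (∑ p ∈ Finset.HasAntidiagonal.antidiagonal k, a (p.1 + 1) * b p.2) * (ε : ℂ) ^ k := by
      rw [Finset.sum_range_succ', Finset.sum_range_succ' (fun k => b k * (ε : ℂ) ^ k)]
      simp only [Finset.Nat.sum_antidiagonal_succ, add_mul, Finset.sum_add_distrib]
      simp only [Finset.Nat.antidiagonal_zero, Finset.sum_singleton, pow_zero, mul_one, mul_add,
        Finset.mul_sum, pow_succ]
      rw [add_right_comm]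
      congr 1
      · congr 1
        exact Finset.sum_congr rfl fun k _ => by ring
      · exact Finset.sum_congr rfl fun k _ => by ring
    rw [e1]
    field_simp
    ring

theorem HasAsymp.of_bound {f : ℝ → ℂ} {a : ℕ → ℂ}
    (h : ∀ N, ∃ C, ∀ᶠ ε in 𝓝[>] (0 : ℝ),
      ‖f ε - ∑ k ∈ Finset.range N, a k * (ε : ℂ) ^ k‖ ≤ C * ε ^ N) : HasAsymp f a := by
  intro N
  obtain ⟨C, hC⟩ := h N
  refine IsBigO.of_bound C ?_
  filter_upwards [hC, self_mem_nhdsWithin] with ε hε h0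
  have : (0 : ℝ) < ε := h0
  rwa [Real.norm_of_nonneg (by positivity)]

theorem genInt_hasAsymp {L : List (ℂ × ℝ)} (hL : ∀ x ∈ L, -x.1 ∈ Complex.slitPlane) :
    HasAsymp (fun ε => genInt L ε 0) fun k => coef L k 0 := by
  refine HasAsymp.of_bound fun N => ?_
  obtain ⟨C, hC⟩ := gen_expansion hL N
  refine ⟨C, ?_⟩
  filter_upwards [hC] with ε hε
  simpa [gen] using hε.1 0 le_rfl

theorem hasAsymp_exp (c : ℂ) :
    HasAsymp (fun ε => Complex.exp (c * ε)) fun k => c ^ k / k.factorial := by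
  refine HasAsymp.of_bound fun N => ?_
  rcases N.eq_zero_or_pos with rfl | hN
  · refine ⟨Real.exp ‖c‖, ?_⟩
    filter_upwards [self_mem_nhdsWithin, mem_nhdsWithin_of_mem_nhds (Iio_mem_nhds one_pos)]
      with ε h0 h1
    have h0' : (0 : ℝ) < ε := h0
    have h1' : ε < 1 := h1
    simp only [Finset.range_zero, Finset.sum_empty, sub_zero, pow_zero, mul_one]
    refine (Complex.norm_exp_le_exp_norm _).trans (Real.exp_le_exp.2 ?_)
    rw [norm_mul, Complex.norm_real, Real.norm_of_nonneg h0'.le]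
    exact mul_le_of_le_one_right (norm_nonneg _) h1'.le
  · refine ⟨‖c‖ ^ N * (N.succ * (N.factorial * N : ℝ)⁻¹), ?_⟩
    filter_upwards [self_mem_nhdsWithin, eventually_mul_lt ‖c‖ one_pos] with ε h0 h1
    have h0' : (0 : ℝ) < ε := h0
    have hn : ‖c * ε‖ = ‖c‖ * ε := by
      rw [norm_mul, Complex.norm_real, Real.norm_of_nonneg h0'.le]
    have := Complex.exp_bound (x := c * ε) (by rw [hn]; exact h1.le) hN
    rw [hn, mul_pow] at this
    refine (le_of_eq ?_).trans (this.trans (le_of_eq (by ring)))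
    congr 2
    exact Finset.sum_congr rfl fun k _ => by rw [mul_pow]; ring

/-- Let `P` be the truncation of the proposed quotient series at order `N`. The hypothesis on `c`
makes `f - P g` of order `ε^N`, and `1/g` is bounded. -/
theorem HasAsymp.div {f g : ℝ → ℂ} {a b c : ℕ → ℂ} (hf : HasAsymp f a) (hg : HasAsymp g b)
    (hb : b 0 ≠ 0) (hc : ∀ k, ∑ p ∈ Finset.HasAntidiagonal.antidiagonal k, c p.1 * b p.2 = a k) :
    HasAsymp (fun ε => f ε / g ε) c := by
  have hginv : (fun ε => (g ε)⁻¹) =O[𝓝[>] 0] fun _ => (1 : ℝ) :=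
    (hg.tendsto.inv₀ hb).isBigO_one ℝ
  have hne : ∀ᶠ ε in 𝓝[>] (0 : ℝ), g ε ≠ 0 := hg.tendsto.eventually_ne hb
  intro N
  have hP : HasAsymp (fun ε : ℝ => ∑ k ∈ Finset.range N, c k * (ε : ℂ) ^ k)
      fun k => if k < N then c k else 0 := by
    intro M
    refine IsBigO.of_bound (∑ k ∈ Finset.range N, ‖c k‖) ?_
    filter_upwards [self_mem_nhdsWithin, mem_nhdsWithin_of_mem_nhds (Iio_mem_nhds one_pos)]
      with ε h0 h1
    have h0' : (0 : ℝ) < ε := h0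
    have h1' : ε < 1 := h1
    have e1 : ∑ k ∈ Finset.range M, (if k < N then c k else 0) * (ε : ℂ) ^ k =
        ∑ k ∈ Finset.range N, (if k < M then c k else 0) * (ε : ℂ) ^ k := by
      simp only [ite_mul, zero_mul, ← Finset.sum_filter]
      refine Finset.sum_congr ?_ fun _ _ => rfl
      ext k
      simp [and_comm]
    rw [e1, ← Finset.sum_sub_distrib, Finset.sum_mul]
    refine norm_sum_le_of_le _ fun k _ => ?_
    rw [Real.norm_of_nonneg (by positivity)]
    split_ifs with hk
    · simp
      positivity
    · rw [zero_mul, sub_zero, norm_mul, norm_pow, Complex.norm_real, Real.norm_of_nonneg h0'.le]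
      exact mul_le_mul_of_nonneg_left (pow_le_pow_of_le_one h0'.le h1'.le (not_lt.1 hk))
        (norm_nonneg _)
  have h1 := hf N
  have h2 := HasAsymp.mul hP hg N
  have h3 := (h1.sub h2).mul hginv
  simp only [mul_one] at h3
  refine h3.congr' ?_ .rfl
  filter_upwards [hne] with ε hε
  have e2 : ∑ k ∈ Finset.range N, (∑ p ∈ Finset.HasAntidiagonal.antidiagonal k,
      (if p.1 < N then c p.1 else 0) * b p.2) * (ε : ℂ) ^ k =
      ∑ k ∈ Finset.range N, a k * (ε : ℂ) ^ k := by
    refine Finset.sum_congr rfl fun k hk => ?_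
    rw [← hc k]
    congr 1
    refine Finset.sum_congr rfl fun p hp => ?_
    have : p.1 < N := by
      have := Finset.HasAntidiagonal.mem_antidiagonal.1 hp
      have := Finset.mem_range.1 hk
      omega
    rw [if_pos this]
  rw [e2]
  field_simp
  ring

/-! ### The full integral of a kernel -/

/-- With `r = e^{Re u}` and `c = cos (Im u)`, the difference of the squares is `(1 - c)(1 - r)^2 /
2`. -/
theorem le_norm_one_add_cexp (u : ℂ) :
    (1 + Real.exp u.re) * Real.cos (u.im / 2) ≤ ‖1 + Complex.exp u‖ := by
  refine le_of_sq_le_sq ?_ (norm_nonneg _)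
  rw [← Complex.normSq_eq_norm_sq, Complex.normSq_apply]
  simp only [Complex.add_re, Complex.one_re, Complex.add_im, Complex.one_im, Complex.exp_re,
    Complex.exp_im, zero_add]
  rw [mul_pow, Real.cos_sq, mul_div_cancel₀ _ (two_ne_zero)]
  have h1 := Real.sin_sq_add_cos_sq u.im
  have h2 := Real.cos_le_one u.im
  set r := Real.exp u.re
  set c := Real.cos u.im
  set t := Real.sin u.im
  have h3 : 0 ≤ (1 - c) * (1 - r) ^ 2 := mul_nonneg (by linarith) (sq_nonneg _)
  have h4 : r ^ 2 * t ^ 2 = r ^ 2 * (1 - c ^ 2) := by rw [← h1]; ring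
  nlinarith

theorem cos_half_pos {θ : ℝ} (hθ : |θ| < Real.pi) : 0 < Real.cos (θ / 2) := by
  obtain ⟨h1, h2⟩ := abs_lt.1 hθ
  exact Real.cos_pos_of_mem_Ioo ⟨by linarith, by linarith⟩

theorem one_add_cexp_ne_zero {u : ℂ} (hu : |u.im| < Real.pi) : 1 + Complex.exp u ≠ 0 := by
  rw [← norm_pos_iff]
  refine lt_of_lt_of_le ?_ (le_norm_one_add_cexp u)
  exact mul_pos (by positivity) (cos_half_pos hu)

theorem neg_cexp_mem {w : ℂ} (hw : |w.im| < Real.pi) : - -Complex.exp w ∈ Complex.slitPlane := by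
  rw [neg_neg, Complex.mem_slitPlane_iff_arg]
  refine ⟨?_, Complex.exp_ne_zero _⟩
  obtain ⟨h1, h2⟩ := abs_lt.1 hw
  rw [Complex.arg_exp, toIocMod_eq_self _ |>.2 ⟨h1, by linarith⟩]
  exact h2.ne

theorem ker_neg_cexp (w : ℂ) (s : ℝ) :
    ker (-Complex.exp w) s = -Complex.exp (w + s) / (1 + Complex.exp (w + s)) := by
  rw [ker, Complex.exp_add]
  ring

/-- The derivative of `u ↦ -e^u / (1 + e^u)`. -/
noncomputable def kerDeriv (u : ℂ) : ℂ := -Complex.exp u / (1 + Complex.exp u) ^ 2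

theorem hasDerivAt_kernel {u : ℂ} (hu : |u.im| < Real.pi) :
    HasDerivAt (fun u => -Complex.exp u / (1 + Complex.exp u)) (kerDeriv u) u := by
  have h := one_add_cexp_ne_zero hu
  refine (((Complex.hasDerivAt_exp u).fun_neg).fun_div ((Complex.hasDerivAt_exp u).const_add 1) h).congr_deriv ?_
  rw [kerDeriv]
  congr 1
  ring

theorem norm_kerDeriv_le {u : ℂ} {c : ℝ} (hc : 0 < c)
    (hcu : c ≤ Real.cos (u.im / 2)) : ‖kerDeriv u‖ ≤ (c ^ 2)⁻¹ * min (Real.exp u.re) 1 := by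
  have h1 := le_norm_one_add_cexp u
  have h2 : (1 + Real.exp u.re) * c ≤ ‖1 + Complex.exp u‖ :=
    (mul_le_mul_of_nonneg_left hcu (by positivity)).trans h1
  rw [kerDeriv, norm_div, norm_neg, norm_pow, Complex.norm_exp]
  calc _ ≤ Real.exp u.re / ((1 + Real.exp u.re) * c) ^ 2 := by gcongr
    _ = (c ^ 2)⁻¹ * (Real.exp u.re / (1 + Real.exp u.re) ^ 2) := by field_simp
    _ ≤ _ := by
        gcongr
        have h3 := Real.exp_pos u.re
        rw [div_le_iff₀ (by positivity)]
        rcases le_total (Real.exp u.re) 1 with h | h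
        · rw [min_eq_left h]
          nlinarith [mul_pos h3 h3, mul_pos h3 (mul_pos h3 h3)]
        · rw [min_eq_right h]
          nlinarith

theorem integrable_min_exp {y : ℝ} (hy0 : 0 < y) (hy1 : y < 1) :
    Integrable fun s : ℝ => min (Real.exp s) 1 * Real.exp (-(y * s)) := by
  have hc : Continuous fun s : ℝ => min (Real.exp s) 1 * Real.exp (-(y * s)) := by fun_prop
  rw [← integrableOn_univ, ← Iic_union_Ioi (a := 0)]
  refine IntegrableOn.union ?_ ?_
  · refine (integrableOn_exp_mul_Iic (a := 1 - y) (by linarith) 0).mono'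
      hc.aestronglyMeasurable (.of_forall fun s => ?_)
    rw [Real.norm_of_nonneg (by positivity)]
    calc _ ≤ Real.exp s * Real.exp (-(y * s)) := by gcongr; exact min_le_left _ _
      _ = _ := by rw [← Real.exp_add]; ring_nf
  · refine (integrableOn_exp_mul_Ioi (a := -y) (by linarith) 0).mono'
      hc.aestronglyMeasurable (.of_forall fun s => ?_)
    rw [Real.norm_of_nonneg (by positivity)]
    calc _ ≤ 1 * Real.exp (-(y * s)) := by gcongr; exact min_le_right _ _
      _ = _ := by ring_nf

theorem min_exp_add_le {A a s : ℝ} (hA : 0 ≤ A) (h : a ≤ A) :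
    min (Real.exp (a + s)) 1 ≤ Real.exp A * min (Real.exp s) 1 := by
  have h1 : 1 ≤ Real.exp A := Real.one_le_exp hA
  rw [mul_min_of_nonneg _ _ (Real.exp_pos _).le, ← Real.exp_add, mul_one]
  exact min_le_min (Real.exp_le_exp.2 (by linarith)) h1

theorem continuous_kerDeriv {w : ℂ} (hw : |w.im| < Real.pi) :
    Continuous fun s : ℝ => kerDeriv (w + s) := by
  unfold kerDeriv
  refine Continuous.div (by fun_prop) (by fun_prop) fun s => ?_
  exact pow_ne_zero _ (one_add_cexp_ne_zero (by simpa using hw))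

theorem kerDeriv_integrable {w : ℂ} (hw : |w.im| < Real.pi) {y : ℝ} (hy0 : 0 < y) (hy1 : y < 1) :
    Integrable fun s : ℝ => kerDeriv (w + s) * Complex.exp ((-(y * s) : ℝ) : ℂ) := by
  have hc := cos_half_pos hw
  refine ((integrable_min_exp hy0 hy1).const_mul
    (((Real.cos (w.im / 2)) ^ 2)⁻¹ * Real.exp |w.re|)).mono' ?_ (.of_forall fun s => ?_)
  · exact ((continuous_kerDeriv hw).mul (by fun_prop)).aestronglyMeasurable
  · rw [norm_mul, Complex.norm_exp_ofReal]
    have h1 := norm_kerDeriv_le (u := w + s) hc (by simp)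
    calc _ ≤ (((Real.cos (w.im / 2)) ^ 2)⁻¹ * (Real.exp |w.re| * min (Real.exp s) 1)) *
          Real.exp (-(y * s)) := by
          gcongr
          refine h1.trans ?_
          gcongr
          simpa using min_exp_add_le (abs_nonneg w.re) (le_abs_self w.re)
      _ = _ := by ring

/-- The derivative of `wker` in `s` is the integrand on the left minus `y` times `wker`, and `wker`
vanishes at both ends of the line. -/
theorem integral_kerDeriv {w : ℂ} (hw : |w.im| < Real.pi) {y : ℝ} (hy0 : 0 < y) (hy1 : y < 1) :
    ∫ s : ℝ, kerDeriv (w + s) * Complex.exp ((-(y * s) : ℝ) : ℂ) =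
      y * kerInt (-Complex.exp w) y := by
  have hk := wker_integrable (x := (-Complex.exp w, y)) (neg_cexp_mem hw) hy0 hy1
  have hd := kerDeriv_integrable hw hy0 hy1
  have hder : ∀ s : ℝ, HasDerivAt (wker (-Complex.exp w, y))
      (kerDeriv (w + s) * Complex.exp ((-(y * s) : ℝ) : ℂ) - y * wker (-Complex.exp w, y) s) s := by
    intro s
    have h1 : HasDerivAt (fun s : ℝ => ker (-Complex.exp w) s) (kerDeriv (w + s)) s := by
      have h2 : HasDerivAt (fun s : ℝ => w + (s : ℂ)) 1 s := by
        simpa using (Complex.ofRealCLM.hasDerivAt (x := s)).const_add w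
      have h3 := (hasDerivAt_kernel (u := w + s) (by simpa using hw)).comp s h2
      rw [mul_one] at h3
      refine h3.congr_of_eventuallyEq (.of_forall fun r => ?_)
      simp [ker_neg_cexp]
    have h4 : HasDerivAt (fun s : ℝ => Complex.exp ((-(y * s) : ℝ) : ℂ))
        (Complex.exp ((-(y * s) : ℝ) : ℂ) * (-y : ℝ)) s := by
      have h5 : HasDerivAt (fun s : ℝ => ((-(y * s) : ℝ) : ℂ)) ((-y : ℝ) : ℂ) s := by
        simpa using ((hasDerivAt_id s).const_mul y).neg.ofReal_comp
      exact h5.cexp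
    refine (h1.mul h4).congr_deriv ?_
    simp only [wker]
    push_cast
    ring
  obtain ⟨C, hC, hb⟩ := exists_norm_ker_le (neg_cexp_mem hw)
  have hbot : Tendsto (wker (-Complex.exp w, y)) atBot (𝓝 0) := by
    refine squeeze_zero_norm (a := fun s => C * Real.exp ((1 - y) * s)) (fun s => ?_) ?_
    · rw [wker, norm_mul, Complex.norm_exp_ofReal]
      calc _ ≤ C * Real.exp s * Real.exp (-(y * s)) := by gcongr; exact (hb s).2
        _ = _ := by rw [mul_assoc, ← Real.exp_add]; ring_nf
    · simpa using (Real.tendsto_exp_atBot.comp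
        (tendsto_id.const_mul_atBot (sub_pos.2 hy1))).const_mul C
  have htop : Tendsto (wker (-Complex.exp w, y)) atTop (𝓝 0) := by
    refine squeeze_zero_norm (a := fun s => C * Real.exp (-y * s)) (fun s => ?_) ?_
    · rw [wker, norm_mul, Complex.norm_exp_ofReal]
      calc _ ≤ C * Real.exp (-(y * s)) := by gcongr; exact (hb s).1
        _ = _ := by ring_nf
    · simpa using (Real.tendsto_exp_atBot.comp
        (tendsto_id.const_mul_atTop_of_neg (neg_lt_zero.2 hy0))).const_mul C
  have := integral_of_hasDerivAt_of_tendsto hder (hd.sub (hk.const_mul _)) hbot htop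
  rw [integral_sub hd (hk.const_mul _), integral_const_mul, sub_zero] at this
  exact sub_eq_zero.1 this

/-- Translating `w` is translating `s` in the kernel, so differentiation under the integral followed
by integration by parts returns the same integral times `y`. -/
theorem hasDerivAt_kerInt {w : ℂ} (hw : |w.im| < Real.pi) {y : ℝ} (hy0 : 0 < y) (hy1 : y < 1) :
    HasDerivAt (fun w => kerInt (-Complex.exp w) y) (y * kerInt (-Complex.exp w) y) w := by
  rw [← integral_kerDeriv hw hy0 hy1]
  -- The ball of radius `r` stays in the strip `|Im v| ≤ θ`, with `θ` halfway between `|Im w|` and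
  -- `π`, where the cosine bound is uniform; `r ≤ 1` controls the real parts.
  set r := min 1 ((Real.pi - |w.im|) / 2) with hr
  have hr0 : 0 < r := lt_min one_pos (by linarith)
  set θ := (Real.pi + |w.im|) / 2 with hθ
  have hθ0 : 0 ≤ θ := by positivity
  have hθ1 : θ < Real.pi := by linarith
  set c := Real.cos (θ / 2) with hc
  have hc0 : 0 < c := cos_half_pos (by rwa [abs_of_nonneg hθ0])
  have him : ∀ v ∈ Metric.ball w r, |v.im| ≤ θ ∧ v.re ≤ |w.re| + 1 := by
    intro v hv
    rw [mem_ball_iff_norm] at hv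
    have h1 := (Complex.abs_im_le_norm (v - w)).trans hv.le
    have h2 := (Complex.abs_re_le_norm (v - w)).trans hv.le
    rw [Complex.sub_im] at h1
    rw [Complex.sub_re] at h2
    have h3 := min_le_left 1 ((Real.pi - |w.im|) / 2)
    have h4 := min_le_right 1 ((Real.pi - |w.im|) / 2)
    have h5 := abs_sub_abs_le_abs_sub v.im w.im
    have h6 := le_abs_self (v.re - w.re)
    have h7 := le_abs_self w.re
    constructor <;> linarith
  have hwb : ∀ v ∈ Metric.ball w r, |v.im| < Real.pi := fun v hv => (him v hv).1.trans_lt hθ1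
  refine (hasDerivAt_integral_of_dominated_loc_of_deriv_le (𝕜 := ℂ) (μ := volume)
    (F := fun v s => wker (-Complex.exp v, y) s)
    (F' := fun v s => kerDeriv (v + s) * Complex.exp ((-(y * s) : ℝ) : ℂ))
    (bound := fun s => ((c ^ 2)⁻¹ * Real.exp (|w.re| + 1)) *
      (min (Real.exp s) 1 * Real.exp (-(y * s))))
    (Metric.ball_mem_nhds w hr0) ?_ ?_ ?_ ?_ ?_ ?_).2
  · filter_upwards [Metric.ball_mem_nhds w hr0] with v hv
    exact (wker_continuous (x := (-Complex.exp v, y)) (neg_cexp_mem (hwb v hv))).aestronglyMeasurable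
  · exact wker_integrable (x := (-Complex.exp w, y)) (neg_cexp_mem hw) hy0 hy1
  · exact (kerDeriv_integrable hw hy0 hy1).aestronglyMeasurable
  · refine .of_forall fun s v hv => ?_
    have hcos : c ≤ Real.cos ((v + s).im / 2) := by
      rw [← Real.cos_abs ((v + s).im / 2), abs_div, abs_two, Complex.add_im, Complex.ofReal_im,
        add_zero]
      exact Real.cos_le_cos_of_nonneg_of_le_pi (by positivity) (by linarith)
        (by linarith [(him v hv).1])
    have h1 := norm_kerDeriv_le (u := v + s) hc0 hcos
    rw [norm_mul, Complex.norm_exp_ofReal]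
    calc _ ≤ ((c ^ 2)⁻¹ * (Real.exp (|w.re| + 1) * min (Real.exp s) 1)) *
          Real.exp (-(y * s)) := by
          gcongr
          refine h1.trans ?_
          gcongr
          simpa using min_exp_add_le (by positivity) (him v hv).2
      _ = _ := by ring
  · exact (integrable_min_exp hy0 hy1).const_mul _
  · refine .of_forall fun s v hv => ?_
    have h2 : HasDerivAt (fun v : ℂ => v + (s : ℂ)) 1 v := (hasDerivAt_id v).add_const _
    have h3 := (hasDerivAt_kernel (u := v + s) (by simpa using hwb v hv)).comp v h2
    rw [mul_one] at h3
    have h4 : HasDerivAt (fun v : ℂ => ker (-Complex.exp v) s) (kerDeriv (v + s)) v := by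
      refine h3.congr_of_eventuallyEq (.of_forall fun r => ?_)
      simp [ker_neg_cexp]
    exact h4.mul_const (Complex.exp ((-(y * s) : ℝ) : ℂ))

/-- On the strip `|Im w| < π` the function `e^{-yw} kerInt(-e^w, y)` has zero derivative; compare `w
= log(-t)` with `w = 0`. The hypothesis on `t` says that this logarithm lies in the open strip. -/
theorem kerInt_eq_mul {t : ℂ} (ht : -t ∈ Complex.slitPlane) {y : ℝ} (hy0 : 0 < y) (hy1 : y < 1) :
    kerInt t y = Complex.exp (y * Complex.log (-t)) * kerInt (-1) y := by
  have ht0 : t ≠ 0 := fun h => by simp [h] at ht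
  set S : Set ℂ := Complex.im ⁻¹' Ioo (-Real.pi) Real.pi with hS
  have hSo : IsOpen S := isOpen_Ioo.preimage Complex.continuous_im
  have hSc : Convex ℝ S := (convex_Ioo _ _).linear_preimage Complex.imLm
  have hmem : ∀ w ∈ S, |w.im| < Real.pi := fun w hw => abs_lt.2 hw
  have hd : ∀ w ∈ S, HasDerivAt (fun w => Complex.exp (-(y * w)) * kerInt (-Complex.exp w) y) 0 w := by
    intro w hw
    have h1 : HasDerivAt (fun w : ℂ => Complex.exp (-(y * w)))
        (Complex.exp (-(y * w)) * -(y : ℂ)) w := by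
      have : HasDerivAt (fun w : ℂ => -(y * w)) (-(y : ℂ)) w := by
        simpa using ((hasDerivAt_id w).const_mul (y : ℂ)).fun_neg
      exact this.cexp
    refine (h1.mul (hasDerivAt_kerInt (hmem w hw) hy0 hy1)).congr_deriv ?_
    ring
  have hlog : Complex.log (-t) ∈ S := by
    have h1 := Complex.neg_pi_lt_log_im (-t)
    have h2 := Complex.log_im_le_pi (-t)
    refine ⟨h1, lt_of_le_of_ne h2 ?_⟩
    rw [Complex.log_im]
    exact Complex.slitPlane_arg_ne_pi ht
  have h0 : (0 : ℂ) ∈ S := ⟨by simpa using Real.pi_pos, by simpa using Real.pi_pos⟩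
  have key := hSo.is_const_of_deriv_eq_zero hSc.isPreconnected
    (fun w hw => (hd w hw).differentiableAt.differentiableWithinAt)
    (fun w hw => (hd w hw).deriv) hlog h0
  simp only [mul_zero, neg_zero, Complex.exp_zero, one_mul,
    Complex.exp_log (neg_ne_zero.2 ht0), neg_neg] at key
  rw [← key, ← mul_assoc, ← Complex.exp_add, add_neg_cancel, Complex.exp_zero, one_mul]

/-- The substitution by the sigmoid turns the integral into `-B(1 - y, y)`, evaluated by the
reflection formula for `Γ`. -/
theorem kerInt_neg_one {y : ℝ} (hy0 : 0 < y) (hy1 : y < 1) :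
    kerInt (-1) y = -(Real.pi / Complex.sin (Real.pi * y)) := by
  have hbeta : Complex.betaIntegral (1 - y) y = Real.pi / Complex.sin (Real.pi * y) := by
    have h := Complex.Gamma_mul_Gamma_eq_betaIntegral (s := 1 - y) (t := y) (by simpa using hy1)
      (by simpa using hy0)
    rw [sub_add_cancel, Complex.Gamma_one, one_mul, mul_comm, Complex.Gamma_mul_Gamma_one_sub] at h
    exact h.symm
  rw [← hbeta, Complex.betaIntegral, intervalIntegral.integral_of_le zero_le_one,
    integral_Ioc_eq_integral_Ioo, ← Real.range_sigmoid, ← image_univ,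
    integral_image_eq_integral_abs_deriv_smul .univ
      (fun x _ => (Real.hasDerivAt_sigmoid x).hasDerivWithinAt) Real.sigmoid_injective.injOn,
    setIntegral_univ, ← integral_neg, kerInt]
  refine integral_congr_ae (.of_forall fun s => ?_)
  simp only
  have hv0 := Real.sigmoid_pos s
  have hv1 : 0 < 1 - Real.sigmoid s := sub_pos.2 (Real.sigmoid_lt_one s)
  rw [abs_of_pos (mul_pos hv0 hv1), Complex.real_smul]
  have e1 : ((Real.sigmoid s : ℝ) : ℂ) ^ ((1 - y : ℂ) - 1) =
      ((Real.sigmoid s ^ (-y) : ℝ) : ℂ) := by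
    rw [Complex.ofReal_cpow hv0.le]
    congr 1
    push_cast
    ring
  have e2 : (1 - ((Real.sigmoid s : ℝ) : ℂ)) ^ ((y : ℂ) - 1) =
      (((1 - Real.sigmoid s) ^ (y - 1) : ℝ) : ℂ) := by
    rw [Complex.ofReal_cpow hv1.le]
    push_cast
    rfl
  have e3 : wker (-1, y) s =
      ((-(Real.exp s / (1 + Real.exp s) * Real.exp (-(y * s))) : ℝ) : ℂ) := by
    simp only [wker, ker]
    push_cast
    ring
  rw [e1, e2, e3]
  norm_cast
  have hs : Real.sigmoid s = Real.exp s / (1 + Real.exp s) := by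
    rw [Real.sigmoid_def, Real.exp_neg]
    field_simp
    ring
  have hs' : 1 - Real.sigmoid s = 1 / (1 + Real.exp s) := by
    rw [hs]
    field_simp
    ring
  have hp : (0 : ℝ) < 1 + Real.exp s := by positivity
  congr 1
  rw [hs', hs, Real.div_rpow (Real.exp_pos s).le hp.le, Real.div_rpow zero_le_one hp.le,
    Real.one_rpow, ← Real.exp_mul, Real.rpow_sub hp, Real.rpow_one, Real.rpow_neg hp.le]
  have hpy : (0 : ℝ) < (1 + Real.exp s) ^ y := Real.rpow_pos_of_pos hp y
  field_simp

/-! ### Expansion of the full integral of a kernel -/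

/-- The `r k` are the coefficients of `e^{x/2} · x / (e^x - 1)`, a quotient of rational power series
with invertible denominator. The rationality of the final coefficients at `2πi` rests on this. -/
theorem exists_half_exp_div :
    ∃ r : ℕ → ℚ, ∀ k, ∑ p ∈ Finset.HasAntidiagonal.antidiagonal k,
      r p.1 * ((p.2 + 1).factorial : ℚ)⁻¹ = (1 / 2) ^ k / k.factorial := by
  set g : PowerSeries ℚ := PowerSeries.mk fun k => ((k + 1).factorial : ℚ)⁻¹ with hg
  set f : PowerSeries ℚ := PowerSeries.mk fun k => (1 / 2) ^ k / (k.factorial : ℚ) with hf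
  have hg0 : PowerSeries.constantCoeff g ≠ 0 := by
    rw [← PowerSeries.coeff_zero_eq_constantCoeff_apply, hg, PowerSeries.coeff_mk]
    simp
  refine ⟨fun k => PowerSeries.coeff k (f * g⁻¹), fun k => ?_⟩
  have h : f * g⁻¹ * g = f := by rw [mul_assoc, PowerSeries.inv_mul_cancel g hg0, mul_one]
  have h2 := congrArg (PowerSeries.coeff k) h
  rw [PowerSeries.coeff_mul] at h2
  simpa [hf, hg] using h2

theorem eps_mul_pi_div_sin {Y ε : ℝ} (hε : ε ≠ 0) :
    (ε : ℂ) * (Real.pi / Complex.sin (Real.pi * (Y * ε : ℝ))) =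
      2 * Real.pi * Complex.I * Complex.exp (2 * Real.pi * Complex.I * Y / 2 * ε) /
        ((Complex.exp (2 * Real.pi * Complex.I * Y * ε) - 1) * (ε : ℂ)⁻¹) := by
  have hε' : (ε : ℂ) ≠ 0 := by exact_mod_cast hε
  set u := Complex.exp (2 * Real.pi * Complex.I * Y / 2 * ε) with hu
  have hu0 : u ≠ 0 := Complex.exp_ne_zero _
  have h1 : Complex.exp (2 * Real.pi * Complex.I * Y * ε) = u * u := by
    rw [hu, ← Complex.exp_add]
    ring_nf
  have h2 : Complex.sin (Real.pi * (Y * ε : ℝ)) = (u⁻¹ - u) * Complex.I / 2 := by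
    rw [Complex.sin, hu, ← Complex.exp_neg]
    push_cast
    ring_nf
  rw [h1, h2]
  have h3 : (u⁻¹ - u) * Complex.I / 2 = (u * u - 1) / (2 * Complex.I * u) := by
    field_simp
    rw [Complex.I_sq]
    ring
  rw [h3]
  -- At a zero of the sine both sides are `0` by the convention for division by zero.
  by_cases h4 : u * u - 1 = 0
  · simp [h4]
  · field_simp

/-- The simple pole at `ε = 0` is removed by the factor `ε`. Every power of `ε` comes with exactly
one `2πi` or one `log(-t)`, so the coefficient of `ε^k` is homogeneous of weight `k`; the rational
`q` does not depend on `t`. -/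
theorem hasAsymp_kerInt {Y : ℚ} (hY : 0 < Y) :
    ∃ q : ℕ → ℕ → ℚ, ∀ t : ℂ, -t ∈ Complex.slitPlane →
      HasAsymp (fun ε => ε * kerInt t (Y * ε)) fun k =>
        ∑ p ∈ Finset.HasAntidiagonal.antidiagonal k,
          q p.1 p.2 * ((2 * Real.pi * Complex.I) ^ p.1 * Complex.log (-t) ^ p.2) := by
  obtain ⟨r, hr⟩ := exists_half_exp_div
  refine ⟨fun i j => -(r i * Y ^ i / Y * (Y ^ j / j.factorial)), fun t ht => ?_⟩
  have hYc : (Y : ℂ) ≠ 0 := by exact_mod_cast hY.ne'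
  set w : ℂ := 2 * Real.pi * Complex.I with hw
  have hw0 : w ≠ 0 := Complex.two_pi_I_ne_zero
  have h1 := (hasAsymp_exp (w * Y)).tail
  have h2 := (hasAsymp_exp (w * Y / 2)).const_mul w
  have h3 := h2.div h1 (c := fun k => r k * Y ^ k / Y * w ^ k) (by simpa using ⟨hw0, hY.ne'⟩)
    fun k => ?_
  · have h4 := ((hasAsymp_exp (Y * Complex.log (-t))).mul h3).const_mul (-1)
    refine (h4.congr (g := fun ε => ε * kerInt t (Y * ε)) ?_).congr_coef fun k => ?_
    · filter_upwards [self_mem_nhdsWithin, eventually_mul_lt Y one_pos] with ε h0 h1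
      have h0' : (0 : ℝ) < ε := h0
      have hY' : (0 : ℝ) < Y := by exact_mod_cast hY
      have h5 := eps_mul_pi_div_sin (Y := Y) h0'.ne'
      rw [kerInt_eq_mul ht (by positivity) h1, kerInt_neg_one (by positivity) h1]
      rw [← hw] at h5
      push_cast at h5 ⊢
      simp only [pow_zero, Nat.factorial_zero, Nat.cast_one, div_one]
      rw [← h5]
      ring_nf
    · rw [← Finset.Nat.sum_antidiagonal_swap, Finset.mul_sum]
      refine Finset.sum_congr rfl fun p _ => ?_
      simp only [Prod.fst_swap, Prod.snd_swap]
      push_cast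
      rw [mul_pow]
      ring
  · have h5 := congrArg (fun x : ℚ => (x : ℂ)) (hr k)
    push_cast at h5
    have h6 : w * ((w * Y / 2) ^ k / k.factorial) =
        (w ^ (k + 1) * Y ^ k) * ((1 / 2) ^ k / k.factorial) := by
      rw [div_pow, mul_pow, div_pow 1, one_pow]
      ring
    rw [h6, ← h5, Finset.mul_sum]
    refine Finset.sum_congr rfl fun p hp => ?_
    rw [← Finset.HasAntidiagonal.mem_antidiagonal.1 hp]
    field_simp
    ring

/-! ### Holomorphy of the iterated integrals -/

section Holo

variable {E : Type*} [NormedAddCommGroup E] [NormedSpace ℂ E]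

/-- `g` is differentiable in its first argument on `V`, with uniform exponential bounds. -/
def HoloDecay (V : Set E) (C : ℝ) (g : E → ℝ → ℂ) : Prop :=
  (∀ z ∈ V, DecayBy C (g z)) ∧ ∃ g' : E → ℝ → E →L[ℂ] ℂ, ∀ z ∈ V, DecayBy C (g' z) ∧
    ∀ s ≤ 0, HasFDerivAt (fun z => g z s) (g' z s) z

/-- `g` is differentiable in its first argument on `V`, with uniform bounds. -/
def HoloBdd (V : Set E) (C : ℝ) (g : E → ℝ → ℂ) : Prop :=
  (∀ z ∈ V, ContinuousOn (g z) (Iic 0) ∧ ∀ s ≤ 0, ‖g z s‖ ≤ C) ∧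
    ∃ g' : E → ℝ → E →L[ℂ] ℂ, ∀ z ∈ V,
      (ContinuousOn (g' z) (Iic 0) ∧ ∀ s ≤ 0, ‖g' z s‖ ≤ C) ∧
      ∀ s ≤ 0, HasFDerivAt (fun z => g z s) (g' z s) z

theorem DecayBy.bdd {F : Type*} [NormedAddCommGroup F] {C : ℝ} {f : ℝ → F} (hf : DecayBy C f) :
    ContinuousOn f (Iic 0) ∧ ∀ s ≤ 0, ‖f s‖ ≤ C :=
  ⟨hf.1, fun s hs => (hf.2 s hs).trans
    (mul_le_of_le_one_right hf.nonneg (Real.exp_le_one_iff.2 hs))⟩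

theorem HoloDecay.holoBdd {V : Set E} {C : ℝ} {g : E → ℝ → ℂ} (h : HoloDecay V C g) :
    HoloBdd V C g := by
  obtain ⟨h1, g', h2⟩ := h
  exact ⟨fun z hz => (h1 z hz).bdd, g', fun z hz => ⟨(h2 z hz).1.bdd, (h2 z hz).2⟩⟩

theorem HoloDecay.prim {V : Set E} (hV : IsOpen V) {C : ℝ} {g : E → ℝ → ℂ} (h : HoloDecay V C g) :
    HoloDecay V C fun z => prim (g z) := by
  obtain ⟨h1, g', h2⟩ := h
  refine ⟨fun z hz => (h1 z hz).prim, fun z => MPLParity.prim (g' z),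
    fun z hz => ⟨(h2 z hz).1.prim, fun b hb => ?_⟩⟩
  have hle : ∀ s ∈ Iic b, s ≤ 0 := fun s hs => le_trans hs hb
  refine hasFDerivAt_integral_of_dominated_of_fderiv_le (μ := volume.restrict (Iic b))
    (bound := fun s => C * Real.exp s) (hV.mem_nhds hz) ?_ ((h1 z hz).integrableOn hb)
    ((h2 z hz).1.integrableOn hb).aestronglyMeasurable ?_
    ((integrableOn_exp_Iic b).const_mul C) ?_
  · filter_upwards [hV.mem_nhds hz] with w hw
    exact ((h1 w hw).integrableOn hb).aestronglyMeasurable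
  · exact ae_restrict_of_forall_mem measurableSet_Iic fun s hs w hw => (h2 w hw).1.2 s (hle s hs)
  · exact ae_restrict_of_forall_mem measurableSet_Iic fun s hs w hw => (h2 w hw).2 s (hle s hs)

theorem HoloDecay.mul {V : Set E} {C C' : ℝ} {g f : E → ℝ → ℂ}
    (h : HoloDecay V C g) (h' : HoloBdd V C' f) (hC : 0 ≤ C) (hC' : 0 ≤ C') :
    HoloDecay V (2 * (C * C')) fun z s => g z s * f z s := by
  obtain ⟨h1, g', h2⟩ := h
  obtain ⟨h3, f', h4⟩ := h'
  have hCC := mul_nonneg hC hC'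
  refine ⟨fun z hz => ⟨(h1 z hz).1.mul (h3 z hz).1, fun s hs => ?_⟩,
    fun z s => g z s • f' z s + f z s • g' z s, fun z hz => ⟨⟨?_, fun s hs => ?_⟩,
    fun s hs => ((h2 z hz).2 s hs).mul ((h4 z hz).2 s hs)⟩⟩
  · rw [norm_mul]
    have hx := (Real.exp_pos s).le
    calc _ ≤ (C * Real.exp s) * C' := by gcongr; exacts [(h1 z hz).2 s hs, (h3 z hz).2 s hs]
      _ ≤ _ := by nlinarith [mul_nonneg hCC hx]
  · exact ((h1 z hz).1.smul (h4 z hz).1.1).add ((h3 z hz).1.smul (h2 z hz).1.1)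
  · refine (norm_add_le _ _).trans ?_
    rw [norm_smul, norm_smul]
    calc _ ≤ (C * Real.exp s) * C' + C' * (C * Real.exp s) := by
          gcongr
          exacts [(h1 z hz).2 s hs, (h4 z hz).1.2 s hs, (h3 z hz).2 s hs, (h2 z hz).1.2 s hs]
      _ = _ := by ring

end Holo

/-- The parameters `t` for which the kernel is regular on the negative axis. -/
def regularSet : Set ℂ := {t | ∀ u ∈ Icc (0 : ℝ) 1, 1 - t * u ≠ 0}

theorem exists_ball_le {t : ℂ} (ht : t ∈ regularSet) :
    ∃ c > 0, ∀ t' ∈ Metric.ball t c, ∀ u ∈ Icc (0 : ℝ) 1, c ≤ ‖1 - t' * u‖ := by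
  have hc : ContinuousOn (fun u : ℝ => ‖1 - t * u‖) (Icc 0 1) := by fun_prop
  obtain ⟨u₀, hu₀, hmin⟩ := isCompact_Icc.exists_isMinOn (nonempty_Icc.2 zero_le_one) hc
  have h0 : 0 < ‖1 - t * u₀‖ := norm_pos_iff.2 (ht u₀ hu₀)
  -- Half of the minimum serves as radius and as bound: moving `t` by less than `c` changes `1 - t
  -- u` by less than `c`, as `u ≤ 1`.
  refine ⟨‖1 - t * u₀‖ / 2, by positivity, fun t' ht' u hu => ?_⟩
  rw [mem_ball_iff_norm] at ht'
  have h1 : ‖1 - t * u₀‖ ≤ ‖1 - t * u‖ := hmin hu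
  have h2 : ‖1 - t * u‖ ≤ ‖1 - t' * u‖ + ‖(t' - t) * u‖ := by
    refine le_trans (le_of_eq ?_) (norm_add_le _ _)
    ring_nf
  have h3 : ‖(t' - t) * u‖ ≤ ‖t' - t‖ := by
    rw [norm_mul, Complex.norm_real, Real.norm_of_nonneg hu.1]
    exact mul_le_of_le_one_right (norm_nonneg _) hu.2
  linarith

theorem isOpen_regularSet : IsOpen regularSet := by
  rw [Metric.isOpen_iff]
  intro t ht
  obtain ⟨c, hc, h⟩ := exists_ball_le ht
  exact ⟨c, hc, fun t' ht' u hu h0 => by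
    have := h t' ht' u hu
    rw [h0, norm_zero] at this
    linarith⟩

theorem exp_mem_Icc {s : ℝ} (hs : s ≤ 0) : Real.exp s ∈ Icc (0 : ℝ) 1 :=
  ⟨(Real.exp_pos s).le, Real.exp_le_one_iff.2 hs⟩

/-- The uniform bound `C e^s` on the kernel and on its derivative in `t` is the domination needed to
differentiate under each of the iterated integrals. -/
theorem ker_holoDecay {t : ℂ} (ht : t ∈ regularSet) :
    ∃ c > 0, ∃ C, 0 ≤ C ∧ HoloDecay (Metric.ball t c) C ker := by
  obtain ⟨c, hc, h⟩ := exists_ball_le ht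
  set D := max ((‖t‖ + c) / c) (1 / c ^ 2) with hD
  have hD0 : 0 ≤ D := le_max_of_le_right (by positivity)
  have hb : ∀ t' ∈ Metric.ball t c, ∀ s ≤ (0 : ℝ), c ≤ ‖1 - t' * Complex.exp s‖ := by
    intro t' ht' s hs
    simpa using h t' ht' _ (exp_mem_Icc hs)
  have hne : ∀ t' ∈ Metric.ball t c, ∀ s ≤ (0 : ℝ), 1 - t' * Complex.exp s ≠ 0 := by
    intro t' ht' s hs
    exact norm_pos_iff.1 (hc.trans_le (hb t' ht' s hs))
  refine ⟨c, hc, D, hD0, fun t' ht' => ⟨?_, fun s hs => ?_⟩,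
    fun t' s => (1 : ℂ →L[ℂ] ℂ).smulRight (Complex.exp s / (1 - t' * Complex.exp s) ^ 2),
    fun t' ht' => ⟨⟨?_, fun s hs => ?_⟩, fun s hs => ?_⟩⟩
  · unfold ker
    exact ContinuousOn.div (by fun_prop) (by fun_prop) fun s hs => hne t' ht' s hs
  · have h1 : ‖t'‖ ≤ ‖t‖ + c := by
      rw [mem_ball_iff_norm] at ht'
      linarith [norm_le_norm_add_norm_sub t t', norm_sub_rev t t']
    rw [ker, norm_div, norm_mul, Complex.norm_exp_ofReal]
    calc _ ≤ (‖t‖ + c) * Real.exp s / c := by gcongr; exact hb t' ht' s hs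
      _ = (‖t‖ + c) / c * Real.exp s := by ring
      _ ≤ _ := by gcongr; exact le_max_left _ _
  · have h1 : ContinuousOn (fun s : ℝ => Complex.exp s / (1 - t' * Complex.exp s) ^ 2) (Iic 0) :=
      ContinuousOn.div (by fun_prop) (by fun_prop) fun s hs => pow_ne_zero _ (hne t' ht' s hs)
    exact (ContinuousLinearMap.smulRightL ℂ ℂ ℂ (1 : ℂ →L[ℂ] ℂ)).continuous.comp_continuousOn h1
  · rw [ContinuousLinearMap.norm_smulRight_apply, norm_one, one_mul, norm_div, norm_pow,
      Complex.norm_exp_ofReal]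
    calc _ ≤ Real.exp s / c ^ 2 := by gcongr; exact hb t' ht' s hs
      _ = 1 / c ^ 2 * Real.exp s := by ring
      _ ≤ _ := by gcongr; exact le_max_right _ _
  · have h1 : HasDerivAt (fun t : ℂ => t * Complex.exp s) (Complex.exp s) t' := by
      simpa using (hasDerivAt_id t').mul_const (Complex.exp s)
    have h2 := (h1.fun_div (h1.const_sub 1) (hne t' ht' s hs)).hasFDerivAt
    refine h2.congr_fderiv ?_
    ext
    simp
    ring

theorem HoloDecay.comp_proj {d : ℕ} {V : Set ℂ} {C : ℝ} {g : ℂ → ℝ → ℂ} (h : HoloDecay V C g)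
    (i : Fin d) : HoloDecay ((fun t : Fin d → ℂ => t i) ⁻¹' V) C fun t => g (t i) := by
  obtain ⟨h1, g', h2⟩ := h
  have hp : ‖(ContinuousLinearMap.proj i : (Fin d → ℂ) →L[ℂ] ℂ)‖ ≤ 1 := by
    refine ContinuousLinearMap.opNorm_le_bound _ zero_le_one fun t => ?_
    rw [one_mul]
    exact norm_le_pi_norm t i
  refine ⟨fun t ht => h1 _ ht, fun t s => (g' (t i) s).comp (ContinuousLinearMap.proj i),
    fun t ht => ⟨⟨?_, fun s hs => ?_⟩, fun s hs => ?_⟩⟩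
  · exact (h2 _ ht).1.1.clm_comp continuousOn_const
  · refine ((g' (t i) s).opNorm_comp_le _).trans ?_
    exact (mul_le_of_le_one_right (norm_nonneg _) hp).trans ((h2 _ ht).1.2 s hs)
  · exact ((h2 _ ht).2 s hs).comp (f := fun t : Fin d → ℂ => t i) t
      (ContinuousLinearMap.proj (R := ℂ) (φ := fun _ : Fin d => ℂ) i).hasFDerivAt

theorem HoloDecay.mono {E : Type*} [NormedAddCommGroup E] [NormedSpace ℂ E] {V W : Set E} {C : ℝ}
    {g : E → ℝ → ℂ} (h : HoloDecay V C g) (hW : W ⊆ V) : HoloDecay W C g := by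
  obtain ⟨h1, g', h2⟩ := h
  exact ⟨fun z hz => h1 z (hW hz), g', fun z hz => h2 z (hW hz)⟩

theorem HoloBdd.mono {E : Type*} [NormedAddCommGroup E] [NormedSpace ℂ E] {V W : Set E} {C : ℝ}
    {g : E → ℝ → ℂ} (h : HoloBdd V C g) (hW : W ⊆ V) : HoloBdd W C g := by
  obtain ⟨h1, g', h2⟩ := h
  exact ⟨fun z hz => h1 z (hW hz), g', fun z hz => h2 z (hW hz)⟩

theorem HoloDecay.iterate_prim {E : Type*} [NormedAddCommGroup E] [NormedSpace ℂ E] {V : Set E}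
    (hV : IsOpen V) {C : ℝ} {g : E → ℝ → ℂ} (h : HoloDecay V C g) (m : ℕ) :
    HoloDecay V C fun z => MPLParity.prim^[m] (g z) := by
  induction m with
  | zero => exact h
  | succ m ih =>
    simp only [Function.iterate_succ_apply']
    exact ih.prim hV

theorem Lw_holoBdd {d : ℕ} (l : List (Fin d × ℕ)) {t : Fin d → ℂ} (ht : ∀ i, t i ∈ regularSet) :
    ∃ V : Set (Fin d → ℂ), IsOpen V ∧ t ∈ V ∧ ∃ C, 0 ≤ C ∧
      HoloBdd V C fun t => Lw (l.map fun x => (t x.1, x.2)) := by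
  induction l with
  | nil =>
    refine ⟨univ, isOpen_univ, mem_univ _, 1, zero_le_one,
      fun z _ => ⟨continuousOn_const, fun s _ => by simp [Lw]⟩, fun _ _ => 0,
      fun z _ => ⟨⟨continuousOn_const, fun s _ => by simp⟩, fun s _ => ?_⟩⟩
    exact hasFDerivAt_const _ _
  | cons x l ih =>
    obtain ⟨V, hV, htV, C, hC, h⟩ := ih
    obtain ⟨c, hc, D, hD, hk⟩ := ker_holoDecay (ht x.1)
    have hW : IsOpen (V ∩ (fun t : Fin d → ℂ => t x.1) ⁻¹' Metric.ball (t x.1) c) :=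
      hV.inter (Metric.isOpen_ball.preimage (by fun_prop))
    refine ⟨_, hW, ⟨htV, Metric.mem_ball_self hc⟩, 2 * (D * C), by positivity, ?_⟩
    exact ((((hk.comp_proj x.1).mono inter_subset_right).mul (h.mono inter_subset_left) hD
      hC).iterate_prim hW (x.2 + 1)).holoBdd

theorem differentiableOn_Lw {d : ℕ} (l : List (Fin d × ℕ)) :
    DifferentiableOn ℂ (fun t : Fin d → ℂ => Lw (l.map fun x => (t x.1, x.2)) 0)
      {t | ∀ i, t i ∈ regularSet} := by
  intro t ht
  obtain ⟨V, hV, htV, C, -, -, g', h⟩ := Lw_holoBdd l ht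
  exact ((h t htV).2 0 le_rfl).differentiableAt.differentiableWithinAt

/-! ### Series expansions -/

/-- `g` is the sum of an absolutely convergent series of exponentials. -/
def ExpSum {ι : Type*} (c : ι → ℂ) (K : ι → ℕ) (g : ℝ → ℂ) : Prop :=
  (Summable fun m => ‖c m‖) ∧ ∀ b : ℝ, b ≤ 0 → HasSum (fun m => c m * Complex.exp (K m * b)) (g b)

theorem norm_cexp_nat_mul_le {K : ℕ} {s : ℝ} (hs : s ≤ 0) : ‖Complex.exp (K * s)‖ ≤ 1 := by
  rw [Complex.norm_exp]
  simpa using mul_nonpos_of_nonneg_of_nonpos (Nat.cast_nonneg K) hs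

theorem ExpSum.prim {ι : Type*} [Countable ι] {c : ι → ℂ} {K : ι → ℕ} {g : ℝ → ℂ}
    (h : ExpSum c K g) (hK : ∀ m, 0 < K m) : ExpSum (fun m => c m / K m) K (prim g) := by
  obtain ⟨h1, h2⟩ := h
  refine ⟨h1.of_nonneg_of_le (fun _ => norm_nonneg _) fun m => ?_, fun b hb => ?_⟩
  · rw [norm_div]
    refine div_le_self (norm_nonneg _) ?_
    rw [Complex.norm_natCast]
    exact_mod_cast hK m
  · have hle : ∀ s ∈ Iic b, s ≤ 0 := fun s hs => le_trans hs hb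
    have key := hasSum_integral_of_dominated_convergence (μ := volume.restrict (Iic b))
      (F := fun m (s : ℝ) => c m * Complex.exp (K m * s)) (f := g)
      (fun m s => ‖c m‖ * Real.exp s) (fun m => by
        have : Continuous fun s : ℝ => c m * Complex.exp (K m * s) := by fun_prop
        exact this.aestronglyMeasurable)
      (fun m => ae_restrict_of_forall_mem measurableSet_Iic fun s hs => ?_)
      (.of_forall fun s => h1.mul_right _) ?_
      (ae_restrict_of_forall_mem measurableSet_Iic fun s hs => h2 s (hle s hs))
    · refine key.congr_fun ?_
      intro m
      have h0 : (0 : ℝ) < ((K m : ℕ) : ℂ).re := by simpa using hK m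
      rw [integral_const_mul, integral_exp_mul_complex_Iic h0]
      ring
    · rw [norm_mul, Complex.norm_exp]
      gcongr
      have := hle s hs
      have h3 : (1 : ℝ) ≤ K m := by exact_mod_cast hK m
      simp
      nlinarith
    · simp only [tsum_mul_right]
      exact (integrableOn_exp_Iic b).const_mul _

theorem ExpSum.iterate_prim {ι : Type*} [Countable ι] {c : ι → ℂ} {K : ι → ℕ} {g : ℝ → ℂ}
    (h : ExpSum c K g) (hK : ∀ m, 0 < K m) (n : ℕ) :
    ExpSum (fun m => c m / (K m : ℂ) ^ n) K (MPLParity.prim^[n] g) := by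
  induction n with
  | zero => simpa using h
  | succ n ih =>
    rw [Function.iterate_succ_apply']
    simpa only [div_div, pow_succ] using ih.prim hK

theorem hasSum_ker {t : ℂ} (ht : ‖t‖ < 1) {s : ℝ} (hs : s ≤ 0) :
    HasSum (fun j : ℕ => t ^ (j + 1) * Complex.exp ((j + 1 : ℕ) * s)) (ker t s) := by
  have h1 : ‖t * Complex.exp s‖ < 1 := by
    rw [norm_mul, Complex.norm_exp_ofReal]
    exact (mul_le_of_le_one_right (norm_nonneg _) (Real.exp_le_one_iff.2 hs)).trans_lt ht
  refine ((hasSum_geometric_of_norm_lt_one h1).mul_left (t * Complex.exp s)).congr_fun ?_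
  intro j
  rw [Complex.exp_nat_mul, ← mul_pow, pow_succ']

theorem ExpSum.ker_mul {ι : Type*} {c : ι → ℂ} {K : ι → ℕ} {g : ℝ → ℂ} (h : ExpSum c K g)
    {t : ℂ} (ht : ‖t‖ < 1) :
    ExpSum (fun p : ℕ × ι => t ^ (p.1 + 1) * c p.2) (fun p => (p.1 + 1) + K p.2)
      fun s => ker t s * g s := by
  obtain ⟨h1, h2⟩ := h
  have hg : Summable fun j : ℕ => ‖t ^ (j + 1)‖ := by
    refine ((summable_geometric_of_lt_one (norm_nonneg _) ht).mul_right ‖t‖).congr fun j => ?_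
    rw [norm_pow, pow_succ]
  refine ⟨hg.mul_norm h1, fun b hb => ?_⟩
  have e1 : Summable fun j : ℕ => ‖t ^ (j + 1) * Complex.exp ((j + 1 : ℕ) * b)‖ := by
    refine hg.of_nonneg_of_le (fun _ => norm_nonneg _) fun j => ?_
    rw [norm_mul]
    exact mul_le_of_le_one_right (norm_nonneg _) (norm_cexp_nat_mul_le hb)
  have e2 : Summable fun m => ‖c m * Complex.exp (K m * b)‖ := by
    refine h1.of_nonneg_of_le (fun _ => norm_nonneg _) fun m => ?_
    rw [norm_mul]
    exact mul_le_of_le_one_right (norm_nonneg _) (norm_cexp_nat_mul_le hb)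
  have e3 := summable_mul_of_summable_norm e1 e2
  have key := HasSum.mul (hasSum_ker ht hb) (h2 b hb) e3
  refine key.congr_fun fun p => ?_
  push_cast
  rw [add_mul _ (K p.2 : ℂ), Complex.exp_add]
  ring

theorem ExpSum.of_equiv {ι κ : Type*} (e : κ ≃ ι) {c : ι → ℂ} {K : ι → ℕ} {g : ℝ → ℂ}
    (h : ExpSum c K g) : ExpSum (fun m => c (e m)) (fun m => K (e m)) g :=
  ⟨(e.summable_iff (f := fun m => ‖c m‖)).2 h.1, fun b hb =>
    (e.hasSum_iff (f := fun m => c m * Complex.exp (K m * b))).2 (h.2 b hb)⟩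

/-- Expanding the kernel as a geometric series adds one gap `j + 1` to the exponent, and each
primitive divides by the exponent reached so far. The partial sums of the gaps are the summation
indices of the polylogarithm. -/
theorem Lw_expSum {d : ℕ} (t : Fin d → ℂ) (m : Fin d → ℕ) (ht : ∀ p, ‖t p‖ < 1) :
    ExpSum (fun j : Fin d → ℕ => ∏ p, t p ^ (j p + 1) /
        ((∑ q ∈ Finset.Ici p, (j q + 1) : ℕ) : ℂ) ^ (m p + 1))
      (fun j => ∑ q, (j q + 1)) (Lw (List.ofFn fun p => (t p, m p))) := by
  induction d with
  | zero =>
    refine ⟨(hasSum_fintype _).summable, fun b _ => ?_⟩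
    simp [Lw]
  | succ d ih =>
    have h1 := (ih (fun p => t p.succ) (fun p => m p.succ) fun p => ht _).ker_mul (ht 0)
    have h2 := (h1.iterate_prim (fun p => by positivity) (m 0 + 1)).of_equiv
      (Fin.consEquiv fun _ => ℕ).symm
    rw [List.ofFn_succ]
    have hK : ∀ j : Fin (d + 1) → ℕ, j 0 + 1 + ∑ q : Fin d, (j q.succ + 1) = ∑ q, (j q + 1) :=
      fun j => (Fin.sum_univ_succ fun q => j q + 1).symm
    have hI : Finset.Ici (0 : Fin (d + 1)) = Finset.univ := by
      ext
      simp
    convert h2 using 2 with j j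
    · rw [Fin.prod_univ_succ]
      simp only [Fin.sum_Ici_succ, hI, ← hK]
      simp [Fin.consEquiv, Fin.tail]
      ring
    · exact (hK _).symm
    · rfl

/-- The increasing sequence with given gaps. -/
def ofGaps {d : ℕ} (g : Fin d → ℕ) :
    {k : Fin d → ℕ // StrictMono k ∧ ∀ i, 0 < k i} :=
  ⟨fun i => ∑ l ∈ Finset.Iic i, (g l + 1), fun i j hij => by
    refine Finset.sum_lt_sum_of_subset (Finset.Iic_subset_Iic.2 hij.le) (i := j) (by simp)
      (by simpa using hij) (by omega) (by simp),
    fun i => Finset.sum_pos (by simp) ⟨i, by simp⟩⟩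

theorem ofGaps_eq {d : ℕ} (g : Fin d → ℕ) (i : Fin d) :
    (ofGaps g).1 i = ∑ l ∈ Finset.Iio i, (g l + 1) + (g i + 1) := by
  simp only [ofGaps]
  rw [← Finset.Iio_insert, Finset.sum_insert (by simp), add_comm]

theorem ofGaps_bijective {d : ℕ} : Function.Bijective (ofGaps (d := d)) := by
  constructor
  · intro g g' h
    ext i
    induction i using WellFoundedLT.induction with
    | ind i ih =>
      have h1 := congrArg (fun k => k.1 i) h
      simp only [ofGaps_eq] at h1
      rw [Finset.sum_congr rfl fun l hl => by rw [ih l (Finset.mem_Iio.1 hl)]] at h1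
      omega
  · rintro ⟨k, hk, hk0⟩
    -- The supremum over an empty set is `0`, which plays the role of `k_0 = 0`; as the supremum is
    -- smaller than `k i`, the subtraction is never truncated.
    let g : Fin d → ℕ := fun i => k i - (Finset.Iio i).sup k - 1
    refine ⟨g, Subtype.ext (funext fun i => ?_)⟩
    have hlt : ∀ i : Fin d, (Finset.Iio i).sup k < k i := fun i =>
      (Finset.sup_lt_iff (by simpa using hk0 i)).2 fun j hj => hk (Finset.mem_Iio.1 hj)
    suffices h : ∀ i : Fin d, ∑ l ∈ Finset.Iio i, (g l + 1) = (Finset.Iio i).sup k by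
      rw [ofGaps_eq, h]
      have := hlt i
      simp only [g]
      omega
    intro i
    obtain ⟨i, hi⟩ := i
    induction i with
    | zero => 
      have : Finset.Iio (⟨0, hi⟩ : Fin d) = ∅ := by
        ext l
        simp [Fin.lt_def]
      simp [this]
    | succ i ih =>
      have h1 : Finset.Iio (⟨i + 1, hi⟩ : Fin d) =
          insert ⟨i, by omega⟩ (Finset.Iio ⟨i, by omega⟩) := by
        ext l
        simp only [Finset.mem_Iio, Finset.mem_insert, Fin.lt_def, Fin.ext_iff]
        omega
      have h2 := hlt ⟨i, by omega⟩
      rw [h1, Finset.sum_insert (by simp), ih, Finset.sup_insert, sup_of_le_left h2.le]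
      simp only [g]
      omega

theorem prod_tailProd_pow {d : ℕ} (z : Fin d → ℂ) (g : Fin d → ℕ) :
    ∏ i, tailProd z i ^ (g i + 1) = ∏ i, z i ^ (ofGaps g).1 i := by
  simp only [tailProd, ofGaps, ← Finset.prod_pow, ← Finset.prod_pow_eq_pow_sum]
  refine Finset.prod_comm' fun i j => ?_
  simp

/-- The arguments and indices of `Li_n(z)`, in the form used by `Lw`. -/
def mplList {d : ℕ} (n : Fin d → ℕ) (z : Fin d → ℂ) : List (ℂ × ℕ) :=
  List.ofFn fun p : Fin d => (tailProd z p.rev, n p.rev - 1)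

/-- Passing from indices to gaps replaces `∏ z_i^{k_i}` by powers of the tail products. The reversal
in `e` is needed because `mplList` starts with the last variable. -/
theorem mplSeries_eq {d : ℕ} {n : Fin d → ℕ} (hn : ∀ i, 1 ≤ n i) {z : Fin d → ℂ}
    (hz : ∀ i, ‖tailProd z i‖ < 1) : mplSeries n z = Lw (mplList n z) 0 := by
  have h1 := (Lw_expSum (fun p : Fin d => tailProd z p.rev) (fun p => n p.rev - 1)
    fun p => hz _).2 0 le_rfl
  let e : (Fin d → ℕ) ≃ {k : Fin d → ℕ // StrictMono k ∧ ∀ i, 0 < k i} :=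
    (Equiv.arrowCongr Fin.revPerm (Equiv.refl ℕ)).trans (Equiv.ofBijective _ ofGaps_bijective)
  refine HasSum.tsum_eq (e.hasSum_iff.1 (h1.congr_fun fun j => ?_))
  simp only [Complex.ofReal_zero, mul_zero, Complex.exp_zero, mul_one, Function.comp,
    Finset.prod_div_distrib]
  have he : e j = ofGaps fun i => j i.rev := by
    simp [e, Equiv.arrowCongr, Function.comp_def]
  rw [he, ← prod_tailProd_pow]
  congr 1
  · rw [← Equiv.prod_comp Fin.revPerm]
    simp
  · rw [← Equiv.prod_comp Fin.revPerm]
    refine Finset.prod_congr rfl fun i _ => ?_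
    simp only [Fin.revPerm_apply, ofGaps]
    rw [Nat.sub_add_cancel (hn i.rev), ← Fin.map_revPerm_Ici, Finset.sum_map]
    simp

/-! ### Continuation along segments, and `mpl` as an iterated integral -/

theorem mul_mem_regularSet {t : ℂ} (ht : -t ∈ Complex.slitPlane) {r : ℝ} (h0 : 0 ≤ r) :
    (r : ℂ) * t ∈ regularSet := by
  intro u hu h
  rw [Complex.mem_slitPlane_iff] at ht
  have h1 : (r * u : ℝ) * t = 1 := by
    push_cast
    linear_combination -h
  have hre := congrArg Complex.re h1
  have him := congrArg Complex.im h1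
  rw [Complex.re_ofReal_mul, Complex.one_re] at hre
  rw [Complex.im_ofReal_mul, Complex.one_im] at him
  have h2 : 0 ≤ r * u := mul_nonneg h0 hu.1
  rcases ht with ht | ht
  · rw [Complex.neg_re] at ht
    nlinarith
  · rw [Complex.neg_im] at ht
    rcases mul_eq_zero.1 him with h3 | h3
    · rw [h3, zero_mul] at hre
      exact zero_ne_one hre
    · exact ht (by rw [h3, neg_zero])

theorem neg_mem_slitPlane_iff {t : ℂ} :
    -t ∈ Complex.slitPlane ↔ ∀ r : ℝ, 0 ≤ r → t ≠ r := by
  rw [Complex.mem_slitPlane_iff, Complex.neg_re, Complex.neg_im]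
  constructor
  · rintro h r hr rfl
    simp at h
    linarith
  · intro h
    by_contra! h0
    refine h t.re (by linarith) (Complex.ext (by simp) ?_)
    simpa using h0.2

theorem tailProd_eq_consecProd {d : ℕ} (z : Fin d → ℂ) (i : Fin d) :
    ∃ j, i ≤ j ∧ (j : ℕ) + 1 = d ∧ tailProd z i = consecProd z i j := by
  obtain _ | d := d
  · exact i.elim0
  · refine ⟨Fin.last d, Fin.le_last i, rfl, ?_⟩
    rw [tailProd, consecProd]
    congr 1

/-- Along the segment each tail product is multiplied by a nonnegative real number; a nonnegative
multiple of a point off `[0, ∞)` is never in `[1, ∞)`, the only place where the kernel is singular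
on `s ≤ 0`. -/
theorem isMPLContinuation_Lw {d : ℕ} {n : Fin d → ℕ} (hn : ∀ i, 1 ≤ n i)
    {z : Fin d → ℂ} (hz : ∀ i, -tailProd z i ∈ Complex.slitPlane) :
    IsMPLContinuation n z fun z => Lw (mplList n z) 0 := by
  have hT : ∀ i, Differentiable ℂ fun z : Fin d → ℂ => tailProd z i := fun i => by
    unfold tailProd
    fun_prop
  have hc : ∀ i, Continuous fun z : Fin d → ℂ => tailProd z i := fun i => (hT i).continuous
  refine ⟨⋂ i, (fun z => tailProd z i) ⁻¹' regularSet,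
    isOpen_iInter_of_finite fun i => isOpen_regularSet.preimage (hc i), ?_, ?_, ?_⟩
  · rintro _ ⟨a, b, ha, hb, -, rfl⟩
    refine mem_iInter.2 fun i => ?_
    have h1 : tailProd (a • 0 + b • z) i = (b ^ (Finset.Ici i).card : ℝ) * tailProd z i := by
      simp [tailProd, Finset.prod_mul_distrib]
    rw [mem_preimage, h1]
    exact mul_mem_regularSet (hz i) (by positivity)
  · have h1 := differentiableOn_Lw (List.ofFn fun p : Fin d => (p, n p.rev - 1))
    have h2 : DifferentiableOn ℂ (fun (z : Fin d → ℂ) (p : Fin d) => tailProd z p.rev)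
        (⋂ i, (fun z => tailProd z i) ⁻¹' regularSet) :=
      (differentiable_pi.2 fun p : Fin d => hT p.rev).differentiableOn
    refine (h1.comp h2 fun w hw i => mem_iInter.1 hw i.rev).congr fun w _ => ?_
    simp [mplList, List.map_ofFn, Function.comp_def]
  · have h1 : ∀ᶠ z in 𝓝 (0 : Fin d → ℂ), ∀ i, ‖tailProd z i‖ < 1 := by
      refine eventually_all.2 fun i => ?_
      have h2 := ((hc i).norm.tendsto 0)
      have h3 : tailProd (0 : Fin d → ℂ) i = 0 :=
        Finset.prod_eq_zero (Finset.mem_Ici.2 le_rfl) rfl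
      rw [h3, norm_zero] at h2
      exact h2.eventually_lt_const one_pos
    filter_upwards [h1] with w hw
    exact (mplSeries_eq hn hw).symm

theorem mpl_eq_Lw {d : ℕ} {n : Fin d → ℕ} (hn : ∀ i, 1 ≤ n i)
    {z : Fin d → ℂ} (hz : ∀ i, -tailProd z i ∈ Complex.slitPlane) :
    mpl n z = Lw (mplList n z) 0 := (isMPLContinuation_Lw hn hz).mpl_eq

theorem consecProd_slit {d : ℕ} {z : Fin d → ℂ} (hz : z ∈ mplDomain d) {i j : Fin d} (h : i ≤ j) :
    -consecProd z i j ∈ Complex.slitPlane := neg_mem_slitPlane_iff.2 (hz i j h)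

theorem tailProd_slit {d : ℕ} {z : Fin d → ℂ} (hz : z ∈ mplDomain d) (i : Fin d) :
    -tailProd z i ∈ Complex.slitPlane := by
  obtain ⟨j, hj, -, h⟩ := tailProd_eq_consecProd z i
  exact h ▸ consecProd_slit hz hj

/-! ### The filtered graded algebra spanned by products of polylogarithms -/

/-- A single polylogarithm with arguments that are consecutive products. -/
structure Block (d : ℕ) where
  dep : ℕ
  dep_pos : 0 < dep
  idx : Fin dep → ℕ
  idx_pos : ∀ j, 0 < idx j
  lo : Fin dep → Fin d
  hi : Fin dep → Fin d
  lo_le_hi : ∀ j, lo j ≤ hi j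

namespace Block

variable {d : ℕ}

/-- The arguments of the polylogarithm. -/
def args (B : Block d) (z : Fin d → ℂ) : Fin B.dep → ℂ := fun j => consecProd z (B.lo j) (B.hi j)

/-- The weight of the polylogarithm. -/
def weight (B : Block d) : ℕ := ∑ j, B.idx j

/-- The value of the polylogarithm. -/
noncomputable def eval (B : Block d) (z : Fin d → ℂ) : ℂ := mpl B.idx (B.args z)

/-- The arguments lie in the domain. -/
def WellDefined (B : Block d) : Prop := ∀ z ∈ mplDomain d, B.args z ∈ mplDomain B.dep

end Block

/-- The products of depth at most `δ` and weight `w`. -/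
def gens (d δ : ℕ) (w : ℤ) : Set (mplDomain d → ℂ) :=
  {f | ∃ (k₀ : ℕ) (k : Fin d → ℕ) (Bs : List (Block d)), (Bs.map Block.dep).sum ≤ δ ∧
    ((k₀ + ∑ i, k i + (Bs.map Block.weight).sum : ℕ) : ℤ) = w ∧ (∀ B ∈ Bs, B.WellDefined) ∧
    f = fun z => (2 * Real.pi * Complex.I) ^ k₀ * (∏ i, Complex.log (-tailProd z.1 i) ^ k i) *
      (Bs.map fun B => B.eval z.1).prod}

/-- The span of the products of depth at most `δ` and weight `w`. -/
noncomputable def polySpan (d δ : ℕ) (w : ℤ) : Submodule ℚ (mplDomain d → ℂ) :=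
  Submodule.span ℚ (gens d δ w)

theorem polySpan_mono {d δ δ' : ℕ} (h : δ ≤ δ') (w : ℤ) : polySpan d δ w ≤ polySpan d δ' w := by
  refine Submodule.span_mono ?_
  rintro f ⟨k₀, k, Bs, h1, h2⟩
  exact ⟨k₀, k, Bs, h1.trans h, h2⟩

theorem one_mem_polySpan (d δ : ℕ) : (fun _ => 1) ∈ polySpan d δ 0 :=
  Submodule.subset_span ⟨0, 0, [], by simp, by simp, by simp, by simp⟩

theorem mul_mem_polySpan {d δ δ' : ℕ} {w w' : ℤ} {f g : mplDomain d → ℂ}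
    (hf : f ∈ polySpan d δ w) (hg : g ∈ polySpan d δ' w') :
    (fun z => f z * g z) ∈ polySpan d (δ + δ') (w + w') := by
  have h1 : f * g ∈ polySpan d δ w * polySpan d δ' w' := Submodule.mul_mem_mul hf hg
  rw [polySpan, polySpan, Submodule.span_mul_span] at h1
  refine Submodule.span_mono ?_ h1
  rintro _ ⟨f, ⟨k₀, k, Bs, h1, h2, h3, rfl⟩, g, ⟨k₀', k', Bs', h1', h2', h3', rfl⟩, rfl⟩
  refine ⟨k₀ + k₀', k + k', Bs ++ Bs', ?_, ?_, ?_, ?_⟩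
  · simpa using add_le_add h1 h1'
  · rw [← h2, ← h2']
    simp only [Pi.add_apply, Finset.sum_add_distrib, List.map_append, List.sum_append]
    push_cast
    ring
  · intro B hB
    rcases List.mem_append.1 hB with h | h
    exacts [h3 B h, h3' B h]
  · ext z
    simp only [Pi.mul_apply, Pi.add_apply, pow_add, Finset.prod_mul_distrib, List.map_append,
      List.prod_append]
    ring

theorem two_pi_I_mem (d δ : ℕ) : (fun _ => 2 * Real.pi * Complex.I) ∈ polySpan d δ 1 :=
  Submodule.subset_span ⟨1, 0, [], by simp, by simp, by simp, by simp⟩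

theorem log_mem {d : ℕ} (δ : ℕ) (i : Fin d) :
    (fun z : mplDomain d => Complex.log (-tailProd z.1 i)) ∈ polySpan d δ 1 := by
  refine Submodule.subset_span ⟨0, Pi.single i 1, [], by simp, by simp, by simp, ?_⟩
  ext z
  rw [Finset.prod_eq_single i (fun j _ hj => by simp [hj]) (by simp)]
  simp

theorem pow_mem_polySpan {d : ℕ} {w : ℤ} {f : mplDomain d → ℂ}
    (hf : f ∈ polySpan d 0 w) (k : ℕ) : (fun z => f z ^ k) ∈ polySpan d 0 (k * w) := by
  induction k with
  | zero => simpa using one_mem_polySpan d 0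
  | succ k ih =>
    have hw : ((k + 1 : ℕ) : ℤ) * w = k * w + w := by
      push_cast
      ring
    have h := mul_mem_polySpan ih hf
    rw [Nat.add_zero, ← hw] at h
    simpa only [pow_succ] using h

theorem prod_mem_polySpan {d : ℕ} {ι : Type*} (s : Finset ι) (w : ι → ℤ)
    (f : ι → mplDomain d → ℂ) (hf : ∀ i ∈ s, f i ∈ polySpan d 0 (w i)) :
    (fun z => ∏ i ∈ s, f i z) ∈ polySpan d 0 (∑ i ∈ s, w i) := by
  classical
  induction s using Finset.induction_on with
  | empty => simpa using one_mem_polySpan d 0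
  | insert i s hi ih =>
    simp only [Finset.prod_insert hi, Finset.sum_insert hi]
    have h := mul_mem_polySpan (hf i (Finset.mem_insert_self _ _))
      (ih fun j hj => hf j (Finset.mem_insert_of_mem hj))
    rwa [Nat.add_zero] at h

/-- Every coordinate of `φ` is a consecutive product. -/
def IsBlockMap {d e : ℕ} (φ : (Fin d → ℂ) → Fin e → ℂ) : Prop :=
  ∀ j, ∃ a b, a ≤ b ∧ ∀ z ∈ mplDomain d, φ z j = consecProd z a b

theorem mpl_mem_polySpan {d e : ℕ} (he : 0 < e) {φ : (Fin d → ℂ) → Fin e → ℂ} (hφ : IsBlockMap φ)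
    (hm : MapsTo φ (mplDomain d) (mplDomain e)) {n : Fin e → ℕ} (hn : ∀ i, 0 < n i) :
    (fun z : mplDomain d => mpl n (φ z.1)) ∈ polySpan d e (∑ i, n i : ℕ) := by
  choose lo hi hle h using hφ
  have h' : ∀ z ∈ mplDomain d, φ z = fun j => consecProd z (lo j) (hi j) :=
    fun z hz => funext fun j => h j z hz
  refine Submodule.subset_span ⟨0, 0, [⟨e, he, n, hn, lo, hi, hle⟩], by simp, by simp [Block.weight],
    ?_, ?_⟩
  · simp only [List.mem_singleton, forall_eq]
    intro z hz
    have := hm hz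
    rw [h' z hz] at this
    exact this
  · ext z
    simp only [Block.eval, h' z.1 z.2]
    simp
    rfl

theorem list_prod_mem_polySpan {d : ℕ} {α : Type*} (l : List α) (δ : α → ℕ) (w : α → ℤ)
    (f : α → mplDomain d → ℂ) (hf : ∀ i ∈ l, f i ∈ polySpan d (δ i) (w i)) :
    (fun z => (l.map fun i => f i z).prod) ∈ polySpan d (l.map δ).sum (l.map w).sum := by
  induction l with
  | nil => simpa using one_mem_polySpan d 0
  | cons i l ih =>
    simp only [List.map_cons, List.prod_cons, List.sum_cons]
    exact mul_mem_polySpan (hf i List.mem_cons_self)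
      (ih fun j hj => hf j (List.mem_cons_of_mem _ hj))

/-- Products go to products: `hφ` takes care of the arguments of the polylogarithms, and `ht`
ensures that the logarithms remain logarithms of tail products. -/
theorem comp_mem_polySpan {d e δ : ℕ} {w : ℤ} {φ : (Fin d → ℂ) → Fin e → ℂ}
    (hφ : ∀ i j, i ≤ j → ∃ a b, a ≤ b ∧ ∀ z ∈ mplDomain d, consecProd (φ z) i j = consecProd z a b)
    (ht : ∀ j, ∃ i, ∀ z ∈ mplDomain d, tailProd (φ z) j = tailProd z i)
    (hm : MapsTo φ (mplDomain d) (mplDomain e)) {f : mplDomain e → ℂ} (hf : f ∈ polySpan e δ w) :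
    (fun z : mplDomain d => f ⟨φ z.1, hm z.2⟩) ∈ polySpan d δ w := by
  let Φ : (mplDomain e → ℂ) →ₗ[ℚ] (mplDomain d → ℂ) :=
    LinearMap.funLeft ℚ ℂ fun z => ⟨φ z.1, hm z.2⟩
  suffices h : polySpan e δ w ≤ (polySpan d δ w).comap Φ from h hf
  refine Submodule.span_le.2 ?_
  rintro f ⟨k₀, k, Bs, h1, h2, h3, rfl⟩
  choose i hi using ht
  have e1 := pow_mem_polySpan (two_pi_I_mem d 0) k₀
  have e2 := prod_mem_polySpan (d := d) Finset.univ (fun j => (k j : ℤ) * 1)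
    (fun j z => Complex.log (-tailProd z.1 (i j)) ^ k j) fun j _ =>
      pow_mem_polySpan (log_mem 0 (i j)) (k j)
  have e3 := list_prod_mem_polySpan (d := d) Bs Block.dep (fun B => (B.weight : ℤ))
    (fun B z => B.eval (φ z.1)) fun B hB =>
      mpl_mem_polySpan B.dep_pos (φ := fun z => B.args (φ z)) (fun j => hφ _ _ (B.lo_le_hi j))
        (fun z hz => h3 B hB _ (hm hz)) B.idx_pos
  have e4 := polySpan_mono (by simpa using h1) _ (mul_mem_polySpan (mul_mem_polySpan e1 e2) e3)
  rw [SetLike.mem_coe, Submodule.mem_comap]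
  convert e4 using 1
  · rw [← h2]
    congr 1
    push_cast
    simp [Function.comp_def]
  · ext z
    simp only [Φ, LinearMap.funLeft_apply]
    congr 2
    exact Finset.prod_congr rfl fun j _ => by rw [hi j _ z.2]

theorem gens_subset {d : ℕ} {w : ℕ} {δ : ℕ} (hδ : δ < d) :
    gens d δ w ⊆ {f : mplDomain d → ℂ | ∃ T : MPLProduct d,
        T.depth < d ∧ T.weight = w ∧ T.WellDefined ∧ f = fun z => T.eval z.1} := by
  rintro f ⟨k₀, k, Bs, h1, h2, h3, rfl⟩
  refine ⟨⟨k₀, k, Bs.length, fun i => Bs[i].dep, fun i => Bs[i].dep_pos, fun i => Bs[i].idx,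
    fun i => Bs[i].idx_pos, fun i => Bs[i].lo, fun i => Bs[i].hi, fun i => Bs[i].lo_le_hi⟩,
    ?_, ?_, ?_, ?_⟩
  · refine lt_of_le_of_lt (le_of_eq ?_) (h1.trans_lt hδ)
    exact Fin.sum_univ_fun_getElem Bs Block.dep
  · have h4 := Fin.sum_univ_fun_getElem Bs Block.weight
    rw [← h4] at h2
    exact_mod_cast h2
  · exact fun z hz i => h3 _ (List.getElem_mem _) z hz
  · ext z
    have h4 := Fin.prod_univ_fun_getElem Bs fun B => B.eval z.1
    rw [← h4]
    rfl

/-! ### Laurent expansions with coefficients of bounded depth -/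

/-- `F z ε` has a Laurent expansion in `ε` whose coefficient of `ε ^ k` has depth at most `δ` and
weight `k + c`. -/
def PolyAsymp {d : ℕ} (δ : ℕ) (c : ℤ) (F : mplDomain d → ℝ → ℂ) : Prop :=
  ∃ (N : ℕ) (a : ℕ → mplDomain d → ℂ), (∀ k : ℕ, a k ∈ polySpan d δ (k - N + c)) ∧
    ∀ z, HasAsymp (fun ε => (ε : ℂ) ^ N * F z ε) fun k => a k z

theorem shift_mem {d δ : ℕ} {c : ℤ} {a : ℕ → mplDomain d → ℂ}
    (h : ∀ k : ℕ, a k ∈ polySpan d δ (k + c)) (k : ℕ) :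
    (fun z => shift (fun k => a k z) k) ∈ polySpan d δ (k - 1 + c) := by
  cases k with
  | zero => exact Submodule.zero_mem _
  | succ k => simpa [shift] using h k

theorem HasAsymp.shift_iterate {f : ℝ → ℂ} {a : ℕ → ℂ} (h : HasAsymp f a) (N : ℕ) :
    HasAsymp (fun ε => (ε : ℂ) ^ N * f ε) (shift^[N] a) := by
  induction N with
  | zero => simpa using h
  | succ N ih =>
    rw [Function.iterate_succ_apply']
    simpa only [pow_succ', mul_assoc] using ih.eps_mul

theorem shift_iterate_apply (a : ℕ → ℂ) (N k : ℕ) : shift^[N] a (k + N) = a k := by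
  induction N with
  | zero => rfl
  | succ N ih => rw [Function.iterate_succ_apply']; exact ih

namespace PolyAsymp

variable {d δ δ' : ℕ} {c c' : ℤ} {F G : mplDomain d → ℝ → ℂ}

theorem congr (h : PolyAsymp δ c F) (hFG : ∀ z, F z =ᶠ[𝓝[>] 0] G z) : PolyAsymp δ c G := by
  obtain ⟨N, a, h1, h2⟩ := h
  refine ⟨N, a, h1, fun z => (h2 z).congr ?_⟩
  filter_upwards [hFG z] with ε hε
  rw [hε]

theorem mono (h : PolyAsymp δ c F) (hδ : δ ≤ δ') : PolyAsymp δ' c F := by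
  obtain ⟨N, a, h1, h2⟩ := h
  exact ⟨N, a, fun k => polySpan_mono hδ _ (h1 k), h2⟩

/-- The order of the pole may be overestimated at will, which brings two expansions to a common one.
-/
theorem exists_of_le (h : PolyAsymp δ c F) : ∃ N₀ : ℕ, ∀ N : ℕ, N₀ ≤ N → ∃ a : ℕ → mplDomain d → ℂ,
    (∀ k : ℕ, a k ∈ polySpan d δ (k - N + c)) ∧
    ∀ z, HasAsymp (fun ε => (ε : ℂ) ^ N * F z ε) fun k => a k z := by
  obtain ⟨N, a, h1, h2⟩ := h
  refine ⟨N, fun M hM => ?_⟩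
  induction M, hM using Nat.le_induction with
  | base => exact ⟨a, h1, h2⟩
  | succ M _ ih =>
    obtain ⟨b, h3, h4⟩ := ih
    refine ⟨fun k z => shift (fun k => b k z) k, fun k => ?_, fun z => ?_⟩
    · have := shift_mem (δ := δ) (c := c - M) (a := b) (fun k => by convert h3 k using 2; ring_nf) k
      convert this using 2
      push_cast
      ring
    · simpa only [pow_succ', mul_assoc] using (h4 z).eps_mul

theorem add (hF : PolyAsymp δ c F) (hG : PolyAsymp δ c G) :
    PolyAsymp δ c fun z ε => F z ε + G z ε := by
  obtain ⟨N, h1⟩ := hF.exists_of_le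
  obtain ⟨M, h2⟩ := hG.exists_of_le
  obtain ⟨a, ha, ha'⟩ := h1 _ (le_max_left N M)
  obtain ⟨b, hb, hb'⟩ := h2 _ (le_max_right N M)
  refine ⟨max N M, fun k => a k + b k, fun k => add_mem (ha k) (hb k), fun z => ?_⟩
  simpa only [mul_add, Pi.add_apply] using (ha' z).add (hb' z)

theorem mul (hF : PolyAsymp δ c F) (hG : PolyAsymp δ' c' G) :
    PolyAsymp (δ + δ') (c + c') fun z ε => F z ε * G z ε := by
  obtain ⟨N, a, ha, ha'⟩ := hF
  obtain ⟨M, b, hb, hb'⟩ := hG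
  refine ⟨N + M, fun k z => ∑ p ∈ Finset.HasAntidiagonal.antidiagonal k, a p.1 z * b p.2 z,
    fun k => ?_, fun z => ?_⟩
  · have : (fun z => ∑ p ∈ Finset.HasAntidiagonal.antidiagonal k, a p.1 z * b p.2 z) =
        ∑ p ∈ Finset.HasAntidiagonal.antidiagonal k, fun z => a p.1 z * b p.2 z := by
      ext z
      simp
    beta_reduce
    rw [this]
    refine Submodule.sum_mem _ fun p hp => ?_
    have hw : (k : ℤ) - (N + M : ℕ) + (c + c') = (p.1 - N + c) + (p.2 - M + c') := by
      rw [← Finset.HasAntidiagonal.mem_antidiagonal.1 hp]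
      push_cast
      ring
    rw [hw]
    exact mul_mem_polySpan (ha p.1) (hb p.2)
  · refine ((ha' z).mul (hb' z)).congr (.of_forall fun ε => ?_)
    simp only [pow_add]
    ring

theorem rat_mul (hF : PolyAsymp δ c F) (q : ℚ) : PolyAsymp δ c fun z ε => (q : ℂ) * F z ε := by
  obtain ⟨N, a, ha, ha'⟩ := hF
  refine ⟨N, fun k => q • a k, fun k => Submodule.smul_mem _ _ (ha k), fun z => ?_⟩
  refine (((ha' z).const_mul q).congr (.of_forall fun ε => ?_)).congr_coef fun k => ?_
  · ring
  · simp [Rat.smul_def]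

theorem inv_pow_mul (hF : PolyAsymp δ c F) (m : ℕ) :
    PolyAsymp δ (c + m) fun z ε => ((ε : ℂ) ^ m)⁻¹ * F z ε := by
  obtain ⟨N, a, ha, ha'⟩ := hF
  refine ⟨N + m, a, fun k => ?_, fun z => (ha' z).congr ?_⟩
  · convert ha k using 2
    push_cast
    ring
  · filter_upwards [self_mem_nhdsWithin] with ε hε
    have h0 : (ε : ℂ) ≠ 0 := by exact_mod_cast (ne_of_gt hε)
    rw [pow_add]
    field_simp

theorem zero (δ : ℕ) (c : ℤ) : PolyAsymp (d := d) δ c fun _ _ => 0 := by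
  refine ⟨0, fun _ => 0, fun _ => Submodule.zero_mem _, fun z N => ?_⟩
  simpa using isBigO_zero _ _

theorem list_sum {α : Type*} (l : List α) (F : α → mplDomain d → ℝ → ℂ)
    (hF : ∀ x ∈ l, PolyAsymp δ c (F x)) :
    PolyAsymp δ c fun z ε => (l.map fun x => F x z ε).sum := by
  induction l with
  | nil => simpa using zero δ c
  | cons x l ih =>
    simpa using (hF x List.mem_cons_self).add (ih fun y hy => hF y (List.mem_cons_of_mem _ hy))

theorem finset_sum {α : Type*} (s : Finset α) (F : α → mplDomain d → ℝ → ℂ)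
    (hF : ∀ x ∈ s, PolyAsymp δ c (F x)) : PolyAsymp δ c fun z ε => ∑ x ∈ s, F x z ε := by
  classical
  induction s using Finset.induction_on with
  | empty => simpa using zero δ c
  | insert x s hx ih =>
    simpa only [Finset.sum_insert hx] using (hF x (Finset.mem_insert_self _ _)).add
      (ih fun y hy => hF y (Finset.mem_insert_of_mem hy))

/-- Poles may occur in intermediate expressions. If the function also has a Taylor expansion,
uniqueness of the expansion of `ε^N F` identifies the coefficients. -/
theorem coef_mem (hF : PolyAsymp δ c F) {b : ℕ → mplDomain d → ℂ}
    (hb : ∀ z, HasAsymp (F z) fun k => b k z) (k : ℕ) : b k ∈ polySpan d δ (k + c) := by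
  obtain ⟨N, a, ha, ha'⟩ := hF
  have : b k = a (k + N) := by
    ext z
    have h := ((hb z).shift_iterate N).unique (ha' z)
    have h2 := congrFun h (k + N)
    rwa [shift_iterate_apply] at h2
  rw [this]
  convert ha (k + N) using 1
  push_cast
  ring_nf

end PolyAsymp

theorem kerInt_polyAsymp {d : ℕ} (i : Fin d) {Y : ℚ} (hY : 0 < Y) :
    PolyAsymp 0 1 fun (z : mplDomain d) ε => kerInt (tailProd z.1 i) (Y * ε) := by
  obtain ⟨q, hq⟩ := hasAsymp_kerInt hY
  refine ⟨1, fun k z => ∑ p ∈ Finset.HasAntidiagonal.antidiagonal k,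
    q p.1 p.2 * ((2 * Real.pi * Complex.I) ^ p.1 * Complex.log (-tailProd z.1 i) ^ p.2),
    fun k => ?_, fun z => ?_⟩
  · have : (fun z : mplDomain d => ∑ p ∈ Finset.HasAntidiagonal.antidiagonal k,
        (q p.1 p.2 : ℂ) * ((2 * Real.pi * Complex.I) ^ p.1 * Complex.log (-tailProd z.1 i) ^ p.2)) =
        ∑ p ∈ Finset.HasAntidiagonal.antidiagonal k, q p.1 p.2 • fun z : mplDomain d =>
          (2 * Real.pi * Complex.I) ^ p.1 * Complex.log (-tailProd z.1 i) ^ p.2 := by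
      ext z
      simp [Rat.smul_def]
    beta_reduce
    rw [this]
    refine Submodule.sum_mem _ fun p hp => Submodule.smul_mem _ _ ?_
    have h := mul_mem_polySpan (pow_mem_polySpan (two_pi_I_mem d 0) p.1)
      (pow_mem_polySpan (log_mem 0 i) p.2)
    rw [Nat.add_zero] at h
    convert h using 2
    rw [← Finset.HasAntidiagonal.mem_antidiagonal.1 hp]
    push_cast
    ring
  · simpa using hq _ (tailProd_slit z.2 i)

/-! ### Generating integrals with admissible arguments -/

/-- The product of the powers of the partial sums of a list of rational weights. -/
def ratWt : List ℚ → List ℕ → ℚ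
  | y :: ys, m :: ms => (y :: ys).sum ^ m * ratWt ys ms
  | _, _ => 1

theorem total_map {α : Type*} (L : List (α × ℚ)) (τ : α → ℂ) :
    total (L.map fun x => (τ x.1, (x.2 : ℝ))) = ((L.map Prod.snd).sum : ℚ) := by
  induction L with
  | nil => simp [total]
  | cons x L ih =>
    simp only [total, List.map_cons, List.sum_cons] at ih ⊢
    rw [ih]
    push_cast
    rfl

theorem wt_map {α : Type*} (L : List (α × ℚ)) (τ : α → ℂ) (ms : List ℕ) :
    wt (L.map fun x => (τ x.1, (x.2 : ℝ))) ms = (ratWt (L.map Prod.snd) ms : ℂ) := by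
  induction L generalizing ms with
  | nil => simp [wt, ratWt]
  | cons x L ih =>
    cases ms with
    | nil => simp [wt, ratWt]
    | cons m ms =>
      have := total_map (x :: L) τ
      simp only [List.map_cons] at this
      simp only [List.map_cons, wt, ratWt, ih, this]
      rw [Rat.cast_mul, Rat.cast_pow, Complex.ofReal_ratCast]

/-- The iterated integrals with arguments `τ c z`, for `c` in `cs`, have depth at most the length
of `cs`. -/
def Representable {d : ℕ} (τ : ℕ → (Fin d → ℂ) → ℂ) (cs : List ℕ) : Prop :=
  ∀ ms : List ℕ, ms.length = cs.length →
    (fun z : mplDomain d => Lw (List.zipWith (fun c m => (τ c z.1, m)) cs ms) 0) ∈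
      polySpan d cs.length (ms.sum + cs.length)

theorem attach_map {α : Type*} (L : List (α × ℚ)) (τ : α → ℂ) (ms : List ℕ) :
    attach (L.map fun x => (τ x.1, (x.2 : ℝ))) ms =
      List.zipWith (fun c m => (τ c, m)) (L.map Prod.fst) ms := by
  simp [attach, List.zipWith_map_left]

theorem genInt_hasAsymp_zipWith {α : Type*} (L : List (α × ℚ)) (τ : α → ℂ)
    (hs : ∀ x ∈ L, -τ x.1 ∈ Complex.slitPlane) :
    HasAsymp (fun ε => genInt (L.map fun x => (τ x.1, (x.2 : ℝ))) ε 0) fun k =>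
      ((comps L.length k).map fun ms => (ratWt (L.map Prod.snd) ms : ℂ) *
        Lw (List.zipWith (fun c m => (τ c, m)) (L.map Prod.fst) ms) 0).sum := by
  have hs' : ∀ x ∈ L.map fun x => (τ x.1, (x.2 : ℝ)), -x.1 ∈ Complex.slitPlane := by
    intro x hx
    obtain ⟨y, hy, rfl⟩ := List.mem_map.1 hx
    exact hs y hy
  refine (genInt_hasAsymp hs').congr_coef fun k => ?_
  rw [coef_eq hs' k le_rfl, List.length_map]
  simp only [wt_map, attach_map]

theorem genInt_polyAsymp {d : ℕ} {τ : ℕ → (Fin d → ℂ) → ℂ} {L : List (ℕ × ℚ)}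
    (hs : ∀ x ∈ L, ∀ z ∈ mplDomain d, -τ x.1 z ∈ Complex.slitPlane)
    (hR : Representable τ (L.map Prod.fst)) :
    PolyAsymp L.length L.length fun (z : mplDomain d) ε =>
      genInt (L.map fun x => (τ x.1 z.1, (x.2 : ℝ))) ε 0 := by
  refine ⟨0, fun k z => ((comps L.length k).map fun ms => (ratWt (L.map Prod.snd) ms : ℂ) *
        Lw (List.zipWith (fun c m => (τ c z.1, m)) (L.map Prod.fst) ms) 0).sum, fun k => ?_,
        fun z => ?_⟩
  · have : (fun z : mplDomain d => ((comps L.length k).map fun ms =>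
        (ratWt (L.map Prod.snd) ms : ℂ) *
          Lw (List.zipWith (fun c m => (τ c z.1, m)) (L.map Prod.fst) ms) 0).sum) =
        ((comps L.length k).map fun ms => ratWt (L.map Prod.snd) ms • fun z : mplDomain d =>
          Lw (List.zipWith (fun c m => (τ c z.1, m)) (L.map Prod.fst) ms) 0).sum := by
      ext z
      rw [Pi.list_sum_apply, List.map_map]
      simp [Rat.smul_def, Function.comp_def]
    beta_reduce
    rw [this]
    refine list_sum_mem fun f hf => ?_
    obtain ⟨ms, hms, rfl⟩ := List.mem_map.1 hf
    obtain ⟨h1, h2⟩ := length_of_mem_comps hms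
    refine Submodule.smul_mem _ _ ?_
    have := hR ms (by simpa using h1)
    rw [h2, List.length_map] at this
    simpa using this
  · simpa using genInt_hasAsymp_zipWith L (fun c => τ c z.1) fun x hx => hs x hx _ z.2

theorem pairs_eq (τ : ℕ → ℂ) (L : List (ℕ × ℚ)) (ε b : ℝ) :
    low ((pairs τ ε L).map wker) b =
      genInt ((L.map fun x => (x.1, -x.2)).map fun x => (τ x.1, (x.2 : ℝ))) ε b := by
  rw [genInt, pairs, List.map_map, List.map_map]
  simp [Function.comp_def]

theorem pairs_polyAsymp {d : ℕ} {τ : ℕ → (Fin d → ℂ) → ℂ} {L : List (ℕ × ℚ)}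
    (hs : ∀ x ∈ L, ∀ z ∈ mplDomain d, -τ x.1 z ∈ Complex.slitPlane)
    (hR : Representable τ (L.map Prod.fst)) :
    PolyAsymp L.length L.length fun (z : mplDomain d) ε =>
      low ((pairs (fun c => τ c z.1) ε L).map wker) 0 := by
  simp only [pairs_eq]
  have := genInt_polyAsymp (τ := τ) (L := L.map fun x => (x.1, -x.2)) (fun x hx => by
    obtain ⟨y, hy, rfl⟩ := List.mem_map.1 hx
    exact hs y hy) (by simpa [Function.comp_def] using hR)
  simpa using this

/-- The difference removes the leading term of `low_mker_expansion`. In the others each lost unit of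
depth comes with a factor `ε⁻¹`, so the weight offset remains `L.length` while the depth drops. -/
theorem mker_sub_polyAsymp {d : ℕ} {τ : ℕ → (Fin d → ℂ) → ℂ} {L : List (ℕ × ℚ)}
    (hL : ∀ x ∈ L, 0 < x.2) (hs : ∀ x ∈ L, ∀ z ∈ mplDomain d, -τ x.1 z ∈ Complex.slitPlane)
    (hR : ∀ cs : List ℕ, cs.Sublist (L.map Prod.fst) → cs.length < L.length → Representable τ cs) :
    PolyAsymp (L.length - 1) L.length fun (z : mplDomain d) ε =>
      low ((L.map fun x => (τ x.1 z.1, (x.2 * ε : ℝ))).map mker) 0 -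
        low ((pairs (fun c => τ c z.1) ε L).map wker) 0 := by
  obtain ⟨R, hR1, hR2⟩ := low_mker_expansion L hL
  have key : PolyAsymp (d := d) (L.length - 1) L.length fun z ε =>
      (R.map fun ρ => mterm L.length (fun c => τ c z.1) ε 0 ρ).sum := by
    refine PolyAsymp.list_sum R (fun ρ z ε => mterm L.length (fun c => τ c z.1) ε 0 ρ)
      fun ρ hρ => ?_
    obtain ⟨-, -, h3, h4⟩ := hR1 ρ hρ
    have h5 := (((pairs_polyAsymp (τ := τ) (L := ρ.2.2) (fun x hx z hz => ?_)
      (hR _ h4 (by simpa using h3))).inv_pow_mul (L.length - ρ.2.2.length)).rat_mul ρ.1).mono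
      (show ρ.2.2.length ≤ L.length - 1 by omega)
    · have h6 : (ρ.2.2.length : ℤ) + (L.length - ρ.2.2.length : ℕ) = L.length := by omega
      rw [h6] at h5
      refine h5.congr fun z => .of_forall fun ε => ?_
      simp [mterm, mul_assoc]
    · obtain ⟨y, hy, hyx⟩ := List.mem_map.1 (h4.subset (List.mem_map_of_mem hx))
      rw [← hyx]
      exact hs y hy z hz
  refine key.congr fun z => ?_
  filter_upwards [self_mem_nhdsWithin] with ε hε
  rw [hR2 (fun c => τ c z.1) (fun x hx => hs x hx _ z.2) ε hε 0, add_sub_cancel_left]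

theorem mker_polyAsymp {d : ℕ} {τ : ℕ → (Fin d → ℂ) → ℂ} {L : List (ℕ × ℚ)}
    (hL : ∀ x ∈ L, 0 < x.2) (hs : ∀ x ∈ L, ∀ z ∈ mplDomain d, -τ x.1 z ∈ Complex.slitPlane)
    (hR : ∀ cs : List ℕ, cs.Sublist (L.map Prod.fst) → Representable τ cs) :
    PolyAsymp L.length L.length fun (z : mplDomain d) ε =>
      low ((L.map fun x => (τ x.1 z.1, (x.2 * ε : ℝ))).map mker) 0 := by
  have h1 := (mker_sub_polyAsymp hL hs fun cs h _ => hR cs h).mono (Nat.sub_le L.length 1)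
  simpa using h1.add (pairs_polyAsymp hs (hR _ (List.Sublist.refl _)))

/-! ### Admissible lists of arguments -/

/-- The product of all variables from position `c` on. -/
noncomputable def tl {d : ℕ} (c : ℕ) (z : Fin d → ℂ) : ℂ := ∏ l : Fin d with c ≤ l.1, z l

theorem apply_ne_zero {d : ℕ} {z : Fin d → ℂ} (hz : z ∈ mplDomain d) (i : Fin d) : z i ≠ 0 := by
  have := hz i i le_rfl 0 le_rfl
  simpa [consecProd] using this

theorem tl_ne_zero {d : ℕ} {z : Fin d → ℂ} (hz : z ∈ mplDomain d) (c : ℕ) : tl c z ≠ 0 :=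
  Finset.prod_ne_zero_iff.2 fun i _ => apply_ne_zero hz i

theorem tl_eq_tailProd {d : ℕ} (z : Fin d → ℂ) (i : Fin d) : tl i z = tailProd z i := by
  refine Finset.prod_congr ?_ fun _ _ => rfl
  ext l
  simp only [Finset.mem_filter, Finset.mem_univ, true_and, Finset.mem_Ici, Fin.le_def]

theorem tl_self {d : ℕ} (z : Fin d → ℂ) : tl d z = 1 := by
  rw [tl, Finset.filter_false_of_mem fun l _ => by simp, Finset.prod_empty]

theorem tl_div {d a b : ℕ} (hab : a < b) (hb : b ≤ d) {z : Fin d → ℂ} (hz : z ∈ mplDomain d) :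
    tl a z / tl b z = consecProd z ⟨a, by omega⟩ ⟨b - 1, by omega⟩ := by
  rw [div_eq_iff (tl_ne_zero hz b), tl, tl, consecProd, ← Finset.prod_union]
  · congr 1
    ext l
    simp only [Finset.mem_filter, Finset.mem_univ, true_and, Finset.mem_union, Finset.mem_Icc,
      Fin.le_def]
    omega
  · rw [Finset.disjoint_left]
    intro l
    simp only [Finset.mem_filter, Finset.mem_univ, true_and, Finset.mem_Icc, Fin.le_def]
    omega

theorem consecProd_telescope {e : ℕ} {u : ℕ → ℂ} (hu : ∀ l, u l ≠ 0) (i j : Fin e) (hij : i ≤ j) :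
    consecProd (fun l : Fin e => u l / u (l + 1)) i j = u i / u (j + 1) := by
  have h := Finset.prod_map (Finset.Icc i j) Fin.valEmbedding fun l => u l / u (l + 1)
  simp only [Fin.valEmbedding_apply, Fin.map_valEmbedding_Icc] at h
  rw [consecProd, ← h]
  clear h
  have hij' : (i : ℕ) ≤ j := hij
  generalize (j : ℕ) = m at hij'
  induction m, hij' using Nat.le_induction with
  | base => simp
  | succ m hm ih =>
    rw [Finset.prod_Icc_succ_top (by omega), ih, div_mul_div_cancel₀ (hu _)]

theorem exists_blockMap {d : ℕ} {v : ℕ → (Fin d → ℂ) → ℂ} {i : ℕ} {cs : List ℕ}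
    (h0 : ∀ c, ∀ z ∈ mplDomain d, v c z ≠ 0)
    (h : (i :: cs).Pairwise fun x y => ∃ a b, a ≤ b ∧
      ∀ z ∈ mplDomain d, v y z / v x z = consecProd z a b) :
    ∃ φ : (Fin d → ℂ) → Fin cs.length → ℂ,
      (∀ i j, i ≤ j → ∃ a b, a ≤ b ∧
        ∀ z ∈ mplDomain d, consecProd (φ z) i j = consecProd z a b) ∧
      MapsTo φ (mplDomain d) (mplDomain cs.length) ∧
      ∀ z ∈ mplDomain d, ∀ p : Fin cs.length, tailProd (φ z) p.rev = v cs[p] z / v i z := by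
  set e := cs.length with he
  -- The list is read backwards, with `x e = i` at the end, so that products of successive quotients
  -- telescope to a value of `v` over `v i`. The default `0` is never reached, since `e - l ≤ e`.
  let x : ℕ → ℕ := fun l => (i :: cs).getD (e - l) 0
  let φ : (Fin d → ℂ) → Fin e → ℂ := fun z l => v (x l) z / v (x (l + 1)) z
  have hcons : ∀ z ∈ mplDomain d, ∀ a b : Fin e, a ≤ b →
      consecProd (φ z) a b = v (x a) z / v (x (b + 1)) z := fun z hz a b hab =>
    consecProd_telescope (u := fun l => v (x l) z) (fun l => h0 _ z hz) a b hab
  have H : ∀ i j, i ≤ j → ∃ a b, a ≤ b ∧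
      ∀ z ∈ mplDomain d, consecProd (φ z) i j = consecProd z a b := by
    intro a b hab
    have hab' : (a : ℕ) ≤ b := hab
    obtain ⟨l, r, hlr, hR⟩ := List.pairwise_iff_getElem.1 h (e - (b + 1)) (e - a)
      (by simp; omega) (by simp; omega) (by omega)
    refine ⟨l, r, hlr, fun z hz => ?_⟩
    rw [hcons z hz a b hab, ← hR z hz]
    simp only [x]
    rw [List.getD_eq_getElem _ _ (by simp; omega), List.getD_eq_getElem _ _ (by simp; omega)]
  refine ⟨φ, H, fun z hz a b hab r hr => ?_, fun z hz p => ?_⟩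
  · obtain ⟨l, r', hlr, hR⟩ := H a b hab
    rw [hR z hz]
    exact hz l r' hlr r hr
  · obtain ⟨j, hj, hj', hT⟩ := tailProd_eq_consecProd (φ z) p.rev
    rw [hT, hcons z hz _ _ hj, hj']
    have h1 : x p.rev = cs[p] := by
      have : e - (p.rev : ℕ) = p + 1 := by
        rw [Fin.val_rev]
        omega
      simp only [x, this]
      simp
    have h2 : x e = i := by simp [x]
    rw [h1, h2]

theorem sum_getD {e : ℕ} {ms : List ℕ} (h : ms.length = e) :
    ∑ p : Fin e, ms.getD p.rev 0 = ms.sum := by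
  subst h
  rw [← Equiv.sum_comp Fin.revPerm]
  simp

theorem mplList_eq_zipWith {cs ms : List ℕ} (h : ms.length = cs.length) (τ : ℕ → ℂ)
    {y : Fin cs.length → ℂ} (hy : ∀ p : Fin cs.length, tailProd y p.rev = τ cs[p]) :
    mplList (fun p => ms.getD p.rev 0 + 1) y = List.zipWith (fun c m => (τ c, m)) cs ms := by
  refine List.ext_getElem (by simp [mplList, h]) fun p h1 h2 => ?_
  simp [mplList, hy, h]

/-- Successive quotients form an argument vector all of whose consecutive products are consecutive
products of `z`. It therefore lies in the domain, and the iterated integral is a genuine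
polylogarithm there. -/
theorem representable_div {d : ℕ} {v : ℕ → (Fin d → ℂ) → ℂ} {i : ℕ} {cs : List ℕ}
    (h0 : ∀ c, ∀ z ∈ mplDomain d, v c z ≠ 0)
    (h : (i :: cs).Pairwise fun x y => ∃ a b, a ≤ b ∧
      ∀ z ∈ mplDomain d, v y z / v x z = consecProd z a b) :
    Representable (fun c z => v c z / v i z) cs := by
  intro ms hms
  rcases List.eq_nil_or_concat' cs with rfl | ⟨_, _, hcs⟩
  · obtain rfl := List.length_eq_zero_iff.1 hms
    simpa [Lw] using one_mem_polySpan d 0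
  have hpos : 0 < cs.length := by simp [hcs]
  clear hcs
  obtain ⟨φ, h1, h2, h3⟩ := exists_blockMap h0 h
  have h4 := mpl_mem_polySpan hpos (φ := φ) (fun j => by simpa [consecProd] using h1 j j le_rfl) h2
    (n := fun p => ms.getD p.rev 0 + 1) (fun p => Nat.succ_pos _)
  rw [Finset.sum_add_distrib, sum_getD hms] at h4
  convert h4 using 2
  · simp
  · rename_i z
    rw [mpl_eq_Lw (fun p => Nat.le_add_left _ _) (tailProd_slit (h2 z.2)),
      mplList_eq_zipWith hms (fun c => v c z.1 / v i z.1) (h3 z.1 z.2)]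

theorem representable_tl_div {d i : ℕ} (hi : i ≤ d) {cs : List ℕ} (h : (i :: cs).Pairwise (· > ·)) :
    Representable (d := d) (fun c z => tl c z / tl i z) cs := by
  refine representable_div (fun c z hz => tl_ne_zero hz c) (h.imp_of_mem ?_)
  intro x y hx _ hxy
  have hx' : x ≤ d := by
    rcases List.mem_cons.1 hx with rfl | hx
    · exact hi
    · exact ((List.pairwise_cons.1 h).1 x hx).le.trans hi
  exact ⟨⟨y, by omega⟩, ⟨x - 1, by omega⟩, Fin.mk_le_mk.2 (by omega), fun z hz => tl_div hxy hx' hz⟩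

/-- With `v = 1 / tl` the inverted quotients fall under `representable_div`, for positions in
increasing order. -/
theorem representable_div_tl {d i : ℕ} {cs : List ℕ} (hcs : ∀ c ∈ cs, c ≤ d)
    (h : (i :: cs).Pairwise (· < ·)) :
    Representable (d := d) (fun c z => tl i z / tl c z) cs := by
  have key : Representable (d := d) (fun c z => (tl c z)⁻¹ / (tl i z)⁻¹) cs := by
    refine representable_div (fun c z hz => inv_ne_zero (tl_ne_zero hz c)) (h.imp_of_mem ?_)
    intro x y hx hy hxy
    have hy' : y ≤ d := by
      rcases List.mem_cons.1 hy with rfl | hy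
      · rcases List.mem_cons.1 hx with rfl | hx
        · omega
        · exact absurd ((List.pairwise_cons.1 h).1 x hx) (by omega)
      · exact hcs y hy
    refine ⟨⟨x, by omega⟩, ⟨y - 1, by omega⟩, Fin.mk_le_mk.2 (by omega), fun z hz => ?_⟩
    rw [inv_div_inv]
    exact tl_div hxy hy' hz
  simpa only [inv_div_inv] using key

theorem mpl_inv_eq {d : ℕ} (n : Fin d → ℕ) (z : Fin d → ℂ) :
    mpl n (fun i => (z i)⁻¹) = (-1) ^ ((∑ i, n i) - d) * (mpl n z - pli n z) := by
  rw [pli, sub_sub_cancel, ← mul_assoc, ← mul_pow]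
  simp

theorem tailProd_inv {d : ℕ} (z : Fin d → ℂ) (i : Fin d) :
    tailProd (fun i => (z i)⁻¹) i = (tailProd z i)⁻¹ := by
  simp [tailProd]

/-- Inverse tail products are not consecutive products. The integral is `Li` at the inverse of an
admissible vector `φ z`, hence `±(Li - PLi)` at `φ z`, and `ih` bounds `PLi`. The tail products of
`φ z` are tail products of `z`, so its logarithms are admissible. -/
theorem representable_inv_tl {d : ℕ} {cs : List ℕ} (h : (d :: cs).Pairwise (· > ·))
    (ih : 0 < cs.length → ∀ n : Fin cs.length → ℕ, (∀ i, 1 ≤ n i) →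
      (fun z : mplDomain cs.length => pli n z.1) ∈
        polySpan cs.length (cs.length - 1) (∑ i, n i : ℕ)) :
    Representable (d := d) (fun c z => (tl c z)⁻¹) cs := by
  intro ms hms
  rcases List.eq_nil_or_concat' cs with rfl | ⟨_, _, hcs⟩
  · obtain rfl := List.length_eq_zero_iff.1 hms
    simpa [Lw] using one_mem_polySpan d 0
  have hpos : 0 < cs.length := by simp [hcs]
  clear hcs
  obtain ⟨φ, h1, h2, h3⟩ := exists_blockMap (d := d) (v := tl) (i := d) (cs := cs)
    (fun c z hz => tl_ne_zero hz c) (h.imp_of_mem fun {x y} hx _ hxy => by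
      have hx' : x ≤ d := by
        rcases List.mem_cons.1 hx with rfl | hx
        · exact le_rfl
        · exact ((List.pairwise_cons.1 h).1 x hx).le
      exact ⟨⟨y, by omega⟩, ⟨x - 1, by omega⟩, Fin.mk_le_mk.2 (by omega),
        fun z hz => tl_div hxy hx' hz⟩)
  simp only [tl_self, div_one] at h3
  set n : Fin cs.length → ℕ := fun p => ms.getD p.rev 0 + 1 with hn
  have hn1 : ∀ p, 1 ≤ n p := fun p => Nat.le_add_left _ _
  have h4 := mpl_mem_polySpan hpos (φ := φ) (fun j => by simpa [consecProd] using h1 j j le_rfl) h2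
    (n := n) hn1
  have h5 := polySpan_mono (Nat.sub_le _ 1) _ (comp_mem_polySpan h1 (fun j => by
    have hlt : cs[j.rev] < d := (List.pairwise_cons.1 h).1 _ (List.getElem_mem _)
    refine ⟨⟨cs[j.rev], hlt⟩, fun z hz => ?_⟩
    have := h3 z hz j.rev
    rw [Fin.rev_rev] at this
    rw [this, ← tl_eq_tailProd]) h2 (ih hpos n hn1))
  have h6 := Submodule.smul_mem _ ((-1 : ℚ) ^ ((∑ i, n i) - cs.length)) (sub_mem h4 h5)
  have h7 : ∑ i, n i = ms.sum + cs.length := by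
    rw [hn, Finset.sum_add_distrib, sum_getD hms]
    simp
  rw [h7] at h6
  convert h6 using 2
  · simp
  rename_i z
  have h8 := mpl_inv_eq n (φ z.1)
  rw [mpl_eq_Lw hn1 fun p => by
      rw [tailProd_inv]
      exact inv_neg_mem_slitPlane (tailProd_slit (h2 z.2) p),
    mplList_eq_zipWith hms (fun c => (tl c z.1)⁻¹) fun p => by
      rw [tailProd_inv, h3 z.1 z.2], h7] at h8
  rw [h8]
  simp [Rat.smul_def]

/-! ### Extraction of coefficients -/

/-- Each linear functional on `W ⧸ V` turns the sum into a rational polynomial in `α` with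
infinitely many roots; over a field the functionals separate points. -/
theorem coeff_mem_of_infinite {W : Type*} [AddCommGroup W] [Module ℚ W] (V : Submodule ℚ W)
    {S : Set ℚ} (hS : S.Infinite) {n : ℕ} {Q : ℕ → W}
    (h : ∀ α ∈ S, ∑ i ∈ Finset.range n, α ^ i • Q i ∈ V) : ∀ i < n, Q i ∈ V := by
  intro i hi
  rw [← Submodule.Quotient.mk_eq_zero, ← Module.forall_dual_apply_eq_zero_iff ℚ]
  intro φ
  let p : Polynomial ℚ := ∑ i ∈ Finset.range n, Polynomial.monomial i (φ (V.mkQ (Q i)))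
  have hp : p = 0 := by
    refine Polynomial.eq_zero_of_infinite_isRoot p (hS.mono fun α hα => ?_)
    have h1 := congrArg φ ((Submodule.Quotient.mk_eq_zero V).2 (h α hα))
    rw [← Submodule.mkQ_apply, map_sum, map_sum, map_zero] at h1
    rw [mem_ofPred_eq, Polynomial.IsRoot, Polynomial.eval_finsetSum, ← h1]
    refine Finset.sum_congr rfl fun i _ => ?_
    rw [Polynomial.eval_monomial, map_smul, map_smul, smul_eq_mul, mul_comm]
  have h2 := congrArg (fun p => Polynomial.coeff p i) hp
  simpa [p, Polynomial.finsetSum_coeff, Polynomial.coeff_monomial, hi] using h2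

theorem list_sum_range {M : Type*} [AddCommMonoid M] (n : ℕ) (f : ℕ → M) :
    ((List.range n).map f).sum = ∑ i ∈ Finset.range n, f i := by
  induction n with
  | zero => simp
  | succ n ih => simp [List.range_succ, Finset.sum_range_succ, ih]

theorem mem_of_forall_ratWt {W : Type*} [AddCommGroup W] [Module ℚ W] (V : Submodule ℚ W) (e k : ℕ)
    (P : List ℕ → W) (h : ∀ βs : List ℚ, βs.length = e → (∀ β ∈ βs, 0 < β) →
      ((comps e k).map fun ms => ratWt βs ms • P ms).sum ∈ V) : ∀ ms ∈ comps e k, P ms ∈ V := by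
  induction e generalizing k P with
  | zero =>
    intro ms hms
    obtain ⟨h1, h2⟩ := length_of_mem_comps hms
    obtain rfl := List.length_eq_zero_iff.1 h1
    obtain rfl : k = 0 := by simpa using h2.symm
    simpa [comps, ratWt] using h [] rfl (by simp)
  | succ e ih =>
    have key : ∀ i < k + 1, ∀ ms ∈ comps e (k - i), P (i :: ms) ∈ V := by
      intro i hi
      refine ih (k - i) (fun ms => P (i :: ms)) fun βs hβ hpos => ?_
      -- The first weight enters only through the first partial sum `α`. Taking this weight to be `α
      -- - βs.sum`, positive on `S`, makes the sum polynomial in `α`, with the sums for the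
      -- remaining weights as coefficients.
      refine coeff_mem_of_infinite V (S := Ioi βs.sum) (Set.Ioi_infinite _) (n := k + 1)
        (Q := fun i => ((comps e (k - i)).map fun ms => ratWt βs ms • P (i :: ms)).sum)
        (fun α hα => ?_) i hi
      have h1 := h ((α - βs.sum) :: βs) (by simp [hβ]) (by
        simp only [List.mem_cons, forall_eq_or_imp]
        exact ⟨sub_pos.2 hα, hpos⟩)
      rw [comps, List.flatMap_def, List.map_flatten, List.sum_flatten, List.map_map, List.map_map,
        list_sum_range] at h1
      convert h1 using 2 with i hi
      rw [Function.comp, Function.comp, List.smul_sum, List.map_map, List.map_map]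
      refine list_sum_map_congr fun ms _ => ?_
      simp [ratWt, mul_smul]
    intro ms hms
    simp only [comps, List.mem_flatMap, List.mem_range, List.mem_map] at hms
    obtain ⟨i, hi, ns, hns, rfl⟩ := hms
    exact key i hi ns hns

theorem ratWt_neg (βs : List ℚ) (ms : List ℕ) (h : ms.length = βs.length) :
    ratWt (βs.map fun β => -β) ms = (-1) ^ ms.sum * ratWt βs ms := by
  induction βs generalizing ms with
  | nil =>
    obtain rfl := List.length_eq_zero_iff.1 h
    simp [ratWt]
  | cons β βs ih =>
    obtain ⟨m, ms, rfl⟩ : ∃ m ns, ms = m :: ns := by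
      apply List.exists_cons_of_ne_nil
      rintro rfl
      simp at h
    have h1 : ((β :: βs).map fun β => -β).sum = -(β :: βs).sum := (List.sum_neg _).symm
    have h2 : (m :: ms).sum = m + ms.sum := List.sum_cons
    rw [List.map_cons] at h1
    rw [List.map_cons, ratWt, ratWt, ih ms (by simpa using h), h1, neg_pow, h2, pow_add]
    ring

/-! ### The depth reduction of the antipode relation -/

/-- A list of strictly decreasing positions below `d`, with positive weights. -/
def Decreasing (d : ℕ) (L : List (ℕ × ℚ)) : Prop :=
  (d :: L.map Prod.fst).Pairwise (· > ·) ∧ ∀ x ∈ L, 0 < x.2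

theorem Decreasing.sublist {d : ℕ} {L L' : List (ℕ × ℚ)} (h : Decreasing d L)
    (hL : L'.Sublist L) : Decreasing d L' :=
  ⟨h.1.sublist ((hL.map Prod.fst).cons_cons d), fun x hx => h.2 x (hL.subset hx)⟩

theorem Decreasing.lt {d : ℕ} {L : List (ℕ × ℚ)} (h : Decreasing d L) {x : ℕ × ℚ} (hx : x ∈ L) :
    x.1 < d := (List.pairwise_cons.1 h.1).1 _ (List.mem_map_of_mem hx)

theorem tl_div_slit {d a b : ℕ} (hab : a < b) (hb : b ≤ d) {z : Fin d → ℂ} (hz : z ∈ mplDomain d) :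
    -(tl a z / tl b z) ∈ Complex.slitPlane := by
  rw [tl_div hab hb hz]
  exact consecProd_slit hz (Fin.mk_le_mk.2 (by omega))

theorem tl_div_slit' {d a b : ℕ} (hab : a < b) (hb : b ≤ d) {z : Fin d → ℂ} (hz : z ∈ mplDomain d) :
    -(tl b z / tl a z) ∈ Complex.slitPlane := by
  rw [← inv_div]
  exact inv_neg_mem_slitPlane (tl_div_slit hab hb hz)

theorem tl_slit {d a : ℕ} (ha : a < d) {z : Fin d → ℂ} (hz : z ∈ mplDomain d) :
    -tl a z ∈ Complex.slitPlane := by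
  simpa [tl_self] using tl_div_slit ha le_rfl hz

/-- The list of arguments `τ c`, with weights multiplied by `ε`. -/
noncomputable def weighted (τ : ℕ → ℂ) (ε : ℝ) (L : List (ℕ × ℚ)) : List (ℂ × ℝ) :=
  L.map fun x => (τ x.1, (x.2 * ε : ℝ))

theorem total_weighted (τ : ℕ → ℂ) (ε : ℝ) (L : List (ℕ × ℚ)) :
    total (weighted τ ε L) = ((L.map Prod.snd).sum : ℚ) * ε := by
  induction L with
  | nil => simp [total, weighted]
  | cons x L ih =>
    simp only [total, weighted, List.map_cons, List.sum_cons] at ih ⊢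
    rw [ih]
    push_cast
    ring

theorem Decreasing.eventually_good {d : ℕ} {L : List (ℕ × ℚ)} (h : Decreasing d L) {z : Fin d → ℂ}
    (hz : z ∈ mplDomain d) :
    ∀ᶠ ε in 𝓝[>] (0 : ℝ), Good (weighted (fun c => tl c z) ε L) := by
  filter_upwards [self_mem_nhdsWithin,
    eventually_mul_lt (((L.map Prod.snd).sum : ℚ) : ℝ) one_pos] with ε h0 h1
  have h0' : (0 : ℝ) < ε := h0
  refine ⟨fun x hx => ?_, fun x hx => ?_, by rwa [total_weighted], ?_⟩
  · obtain ⟨y, hy, rfl⟩ := List.mem_map.1 hx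
    exact tl_slit (h.lt hy) hz
  · obtain ⟨y, hy, rfl⟩ := List.mem_map.1 hx
    have : (0 : ℝ) < y.2 := by exact_mod_cast h.2 y hy
    exact mul_pos this h0'
  · rw [weighted, List.pairwise_map]
    refine (List.pairwise_map.1 (List.pairwise_cons.1 h.1).2).imp_of_mem fun {x y} hx _ hxy => ?_
    exact ⟨tl_div_slit' hxy (h.lt hx).le hz, tl_div_slit hxy (h.lt hx).le hz⟩

theorem upp_polyAsymp {d : ℕ} {τ : ℕ → (Fin d → ℂ) → ℂ} {L : List (ℕ × ℚ)}
    (hL : ∀ x ∈ L, 0 < x.2) (hs : ∀ x ∈ L, ∀ z ∈ mplDomain d, -τ x.1 z ∈ Complex.slitPlane)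
    (hR : ∀ cs : List ℕ, cs.Sublist (L.map Prod.fst) →
      Representable (fun c z => (τ c z)⁻¹) cs) :
    PolyAsymp L.length L.length fun (z : mplDomain d) ε =>
      upp ((weighted (fun c => τ c z.1) ε L).map wker) 0 := by
  have h := (mker_polyAsymp (τ := fun c z => (τ c z)⁻¹) hL
    (fun x hx z hz => inv_neg_mem_slitPlane (hs x hx z hz)) hR).rat_mul ((-1) ^ L.length)
  refine h.congr fun z => .of_forall fun ε => ?_
  dsimp only
  rw [upp_wker]
  · simp [weighted, Function.comp_def]
  · intro x hx
    obtain ⟨y, hy, rfl⟩ := List.mem_map.1 hx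
    exact hs y hy _ z.2

/-- The pivot of a split contributes depth `0` and weight `1`, hence the drop in depth. Positions
below the pivot give consecutive products `tl c / tl i`; for those above it, the reflection inside
`upp` inverts the quotient into one. No induction hypothesis is needed. -/
theorem Decreasing.full_polyAsymp {d : ℕ} {L : List (ℕ × ℚ)} (h : Decreasing d L) :
    PolyAsymp (L.length - 1) L.length fun (z : mplDomain d) ε =>
      full ((weighted (fun c => tl c z.1) ε L).map wker) := by
  have key : PolyAsymp (d := d) (L.length - 1) L.length fun z ε =>
      ((splits L).map fun σ => kerInt (tl σ.2.1.1 z.1) (((L.map Prod.snd).sum : ℚ) * ε) *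
        genInt (σ.2.2.map fun x => (tl x.1 z.1 / tl σ.2.1.1 z.1, (x.2 : ℝ))) ε 0 *
        upp ((weighted (fun c => tl c z.1 / tl σ.2.1.1 z.1) ε σ.1.reverse).map wker) 0).sum := by
    refine PolyAsymp.list_sum (splits L) (fun σ z ε =>
      kerInt (tl σ.2.1.1 z.1) (((L.map Prod.snd).sum : ℚ) * ε) *
        genInt (σ.2.2.map fun x => (tl x.1 z.1 / tl σ.2.1.1 z.1, (x.2 : ℝ))) ε 0 *
        upp ((weighted (fun c => tl c z.1 / tl σ.2.1.1 z.1) ε σ.1.reverse).map wker) 0)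
      fun σ hσ => ?_
    have hL := eq_of_mem_splits hσ
    obtain ⟨p, ⟨i, β⟩, q⟩ := σ
    dsimp only at hL ⊢
    have hi : i < d := h.lt (x := (i, β)) (by simp [hL])
    have hY : 0 < (L.map Prod.snd).sum := by
      refine List.sum_pos _ (fun y hy => ?_) (by simp [hL])
      obtain ⟨x, hx, rfl⟩ := List.mem_map.1 hy
      exact h.2 x hx
    have hpw := (List.pairwise_cons.1 h.1).2
    rw [hL, List.map_append, List.pairwise_append, List.map_cons] at hpw
    have hq : ∀ x ∈ q, x.1 < i := fun x hx =>
      (List.pairwise_cons.1 hpw.2.1).1 _ (List.mem_map_of_mem hx)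
    have hp : ∀ x ∈ p, i < x.1 := fun x hx =>
      hpw.2.2 _ (List.mem_map_of_mem hx) _ List.mem_cons_self
    have hpd : ∀ x ∈ p, x.1 < d := fun x hx => h.lt (by simp [hL, hx])
    have h1 := kerInt_polyAsymp (⟨i, hi⟩ : Fin d) hY
    have h2 := genInt_polyAsymp (d := d) (τ := fun c z => tl c z / tl i z) (L := q)
      (fun x hx z hz => tl_div_slit (hq x hx) hi.le hz) (representable_tl_div hi.le hpw.2.1)
    have h3 := upp_polyAsymp (d := d) (τ := fun c z => tl c z / tl i z) (L := p.reverse)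
      (fun x hx => h.2 x (by rw [hL]; exact List.mem_append_left _ (List.mem_reverse.1 hx)))
      (fun x hx z hz => tl_div_slit' (hp x (List.mem_reverse.1 hx))
        (hpd x (List.mem_reverse.1 hx)).le hz) fun cs hcs => by
          simp only [inv_div]
          have hmem : ∀ c ∈ cs, ∃ x ∈ p, x.1 = c := fun c hc => by
            obtain ⟨x, hx, hxc⟩ := List.mem_map.1 (hcs.subset hc)
            exact ⟨x, List.mem_reverse.1 hx, hxc⟩
          refine representable_div_tl (fun c hc => ?_) (List.pairwise_cons.2 ⟨fun c hc => ?_, ?_⟩)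
          · obtain ⟨x, hx, rfl⟩ := hmem c hc
            exact (hpd x hx).le
          · obtain ⟨x, hx, rfl⟩ := hmem c hc
            exact hp x hx
          · rw [List.map_reverse] at hcs
            exact (List.pairwise_reverse.2 hpw.1).sublist hcs
    have h4 := (h1.mul h2).mul h3
    have e1 : 0 + q.length + p.reverse.length = L.length - 1 := by
      rw [hL]
      simp
      omega
    have e2 : (1 : ℤ) + q.length + p.reverse.length = L.length := by
      rw [hL]
      simp
      ring
    rw [e1, e2] at h4
    refine h4.congr fun z => .of_forall fun ε => ?_
    dsimp only
    rw [← tl_eq_tailProd]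
  refine key.congr fun z => ?_
  filter_upwards [h.eventually_good z.2] with ε hε
  rw [full_wker_eq_splits hε, total_weighted, weighted, splits_map, List.map_map]
  refine list_sum_map_congr fun σ _ => ?_
  simp only [Function.comp, genInt, weighted, List.map_map, List.map_reverse, scale, Function.comp_def]

/-- In `low_antipode` the term `(-1)^N upp` reflects to the subtracted integral plus terms of
smaller depth. The product with index `i` has depth at most `i + (N - i - 1)`. Inverse tail products
are needed only for fewer than `N` positions, where `ih` applies. -/
theorem Decreasing.low_sub_polyAsymp {d : ℕ} {L : List (ℕ × ℚ)} (h : Decreasing d L)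
    (ih : ∀ e, 0 < e → e < L.length → ∀ n : Fin e → ℕ, (∀ i, 1 ≤ n i) →
      (fun z : mplDomain e => pli n z.1) ∈ polySpan e (e - 1) (∑ i, n i : ℕ)) :
    PolyAsymp (L.length - 1) L.length fun (z : mplDomain d) ε =>
      low ((weighted (fun c => tl c z.1) ε L).map wker) 0 -
        low ((pairs (fun c => (tl c z.1)⁻¹) ε L).map wker) 0 := by
  have hrep : ∀ cs : List ℕ, cs.Sublist (L.map Prod.fst) → cs.length < L.length →
      Representable (d := d) (fun c z => (tl c z)⁻¹) cs := fun cs hcs hlen =>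
    representable_inv_tl (h.1.sublist (hcs.cons_cons d)) fun h0 => ih _ h0 hlen
  have h1 := mker_sub_polyAsymp (d := d) (τ := fun c z => (tl c z)⁻¹) h.2
    (fun x hx z hz => inv_neg_mem_slitPlane (tl_slit (h.lt hx) hz)) hrep
  have h2 : PolyAsymp (d := d) (L.length - 1) L.length fun z ε => ∑ i ∈ Finset.range L.length,
      ((-1) ^ i : ℚ) * (upp ((weighted (fun c => tl c z.1) ε (L.take i)).map wker) 0 *
        full ((weighted (fun c => tl c z.1) ε (L.drop i)).map wker)) := by
    refine PolyAsymp.finset_sum _ (fun i z ε =>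
      (((-1) ^ i : ℚ) : ℂ) * (upp ((weighted (fun c => tl c z.1) ε (L.take i)).map wker) 0 *
        full ((weighted (fun c => tl c z.1) ε (L.drop i)).map wker))) fun i hi => ?_
    have hi' := Finset.mem_range.1 hi
    have hlen : (L.take i).length = i := by simp; omega
    have h3 := upp_polyAsymp (d := d) (τ := tl) (L := L.take i)
      (h.sublist (List.take_sublist i L)).2
      (fun x hx z hz => tl_slit (h.lt ((List.take_sublist i L).subset hx)) hz)
      fun cs hcs => hrep cs (hcs.trans ((List.take_sublist i L).map _))
        (hcs.length_le.trans_lt (by rw [List.length_map, hlen]; exact hi'))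
    have h4 := (h3.mul (h.sublist (List.drop_sublist i L)).full_polyAsymp).rat_mul ((-1) ^ i)
    rw [hlen, List.length_drop] at h4
    have e1 : i + (L.length - i - 1) = L.length - 1 := by omega
    have e2 : (i : ℤ) + (L.length - i : ℕ) = L.length := by omega
    rwa [e1, e2] at h4
  refine (h1.add h2).congr fun z => ?_
  filter_upwards [h.eventually_good z.2, self_mem_nhdsWithin] with ε hε h0
  rw [low_antipode hε.integrable 0, upp_wker _ hε.slit]
  simp only [List.length_map, ← List.map_take, ← List.map_drop]
  have e3 : ∀ x : ℂ, (-1 : ℂ) ^ L.length * ((-1) ^ L.length * x) = x := fun x => by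
    rw [← mul_assoc, ← mul_pow]
    simp
  simp only [weighted, List.length_map, List.map_map, List.map_take, List.map_drop, Function.comp_def,
    e3]
  push_cast
  ring

theorem pli_mem_polySpan (d : ℕ) (hd : 0 < d) (n : Fin d → ℕ) (hn : ∀ i, 1 ≤ n i) :
    (fun z : mplDomain d => pli n z.1) ∈ polySpan d (d - 1) (∑ i, n i : ℕ) := by
  induction d using Nat.strong_induction_on with
  | _ d ih =>
    set cs := (List.range d).reverse with hcs
    have hcl : cs.length = d := by simp [hcs]
    have hcp : (d :: cs).Pairwise (· > ·) := by
      refine List.pairwise_cons.2 ⟨fun c hc => ?_, ?_⟩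
      · simpa [hcs] using hc
      · rw [hcs, List.pairwise_reverse]
        exact List.pairwise_lt_range
    have key : ∀ k, ∀ ms ∈ comps d k, (fun z : mplDomain d =>
        Lw (List.zipWith (fun c m => (tl c z.1, m)) cs ms) 0 -
          (-1) ^ ms.sum * Lw (List.zipWith (fun c m => ((tl c z.1)⁻¹, m)) cs ms) 0) ∈
        polySpan d (d - 1) (k + d) := by
      intro k
      refine mem_of_forall_ratWt _ d k (fun ms (z : mplDomain d) =>
        Lw (List.zipWith (fun c m => (tl c z.1, m)) cs ms) 0 -
          (-1) ^ ms.sum * Lw (List.zipWith (fun c m => ((tl c z.1)⁻¹, m)) cs ms) 0)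
        -- The arguments stay fixed while the weights run over all positive rationals; the
        -- coefficient of `ε^k` is then the sum over compositions from which single indices are
        -- extracted.
        fun βs hβ hpos => ?_
      set L := cs.zip βs with hL
      have hLf : L.map Prod.fst = cs := List.map_fst_zip (by omega)
      have hLs : L.map Prod.snd = βs := List.map_snd_zip (by omega)
      have hLl : L.length = d := by simp [hL, hcl, hβ]
      have hdec : Decreasing d L := by
        refine ⟨by rwa [hLf], fun x hx => hpos _ ?_⟩
        rw [← hLs]
        exact List.mem_map_of_mem hx
      have h1 := hdec.low_sub_polyAsymp fun e he0 he n hn => ih e (hLl ▸ he) he0 n hn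
      rw [hLl] at h1
      have h2 := h1.coef_mem (b := fun k z => ((comps d k).map fun ms => ratWt βs ms •
        (Lw (List.zipWith (fun c m => (tl c z.1, m)) cs ms) 0 -
          (-1) ^ ms.sum * Lw (List.zipWith (fun c m => ((tl c z.1)⁻¹, m)) cs ms) 0)).sum)
        (fun z => ?_) k
      · convert h2 using 1
        ext z
        rw [Pi.list_sum_apply, List.map_map]
        rfl
      · have h3 := genInt_hasAsymp_zipWith L (fun c => tl c z.1)
          fun x hx => tl_slit (hdec.lt hx) z.2
        have h4 := genInt_hasAsymp_zipWith (L.map fun x => (x.1, -x.2)) (fun c => (tl c z.1)⁻¹)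
          fun x hx => by
            obtain ⟨y, hy, rfl⟩ := List.mem_map.1 hx
            exact inv_neg_mem_slitPlane (tl_slit (hdec.lt hy) z.2)
        refine ((h3.add (h4.const_mul (-1))).congr (.of_forall fun ε => ?_)).congr_coef fun k => ?_
        · simp only [pairs_eq, weighted, genInt, List.map_map, Function.comp_def]
          ring
        · have e1 : (L.map fun x => (x.1, -x.2)).map Prod.snd = βs.map fun β => -β := by
            rw [← hLs]
            simp
          have e2 : (L.map fun x => (x.1, -x.2)).map Prod.fst = cs := by
            rw [← hLf]
            simp
          rw [e1, e2, hLf, hLs, List.length_map, hLl, ← List.sum_map_mul_left, ← List.sum_map_add]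
          refine list_sum_map_congr fun ms hms => ?_
          -- Negating the weights multiplies a monomial of degree `ms.sum` by `(-1)^ms.sum`: the
          -- parity sign.
          rw [ratWt_neg βs ms (by rw [(length_of_mem_comps hms).1, hβ]), Rat.smul_def]
          push_cast
          ring
    -- An index `n_i` corresponds to the exponent `n_i - 1`, so `ms.sum = |n| - d`; the order is
    -- reversed because the lists start with the last variable.
    set ms : List ℕ := List.ofFn fun p : Fin d => n p.rev - 1 with hms
    have hml : ms.length = d := by simp [hms]
    have hsum : ms.sum + d = ∑ i, n i := by
      rw [hms, List.sum_ofFn, ← Equiv.sum_comp Fin.revPerm]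
      simp only [Fin.revPerm_apply, Fin.rev_rev]
      have : ∑ i : Fin d, n i = ∑ i : Fin d, ((n i - 1) + 1) :=
        Finset.sum_congr rfl fun i _ => (Nat.sub_add_cancel (hn i)).symm
      rw [this, Finset.sum_add_distrib]
      simp
    have hlist : ∀ (τ : ℕ → ℂ) (y : Fin d → ℂ), (∀ i : Fin d, tailProd y i = τ i) →
        mplList n y = List.zipWith (fun c m => (τ c, m)) cs ms := by
      intro τ y hy
      refine List.ext_getElem (by simp [mplList, hcl, hml]) fun p h1 h2 => ?_
      have hp : p < d := by simpa [mplList] using h1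
      simp only [mplList, List.getElem_ofFn, List.getElem_zipWith, hy, hms, hcs,
        List.getElem_reverse, List.getElem_range, List.length_range, Fin.val_rev]
      congr 2
      omega
    have h5 := key ms.sum ms (by simpa [hml] using mem_comps ms)
    have e1 : (ms.sum : ℤ) + d = (∑ i, n i : ℕ) := by exact_mod_cast hsum
    rw [e1] at h5
    convert h5 using 1
    ext z
    have e2 : (∑ i, n i) - d = ms.sum := by omega
    rw [pli, e2, mpl_eq_Lw hn (tailProd_slit z.2), mpl_eq_Lw hn fun i => by
      rw [tailProd_inv]
      exact inv_neg_mem_slitPlane (tailProd_slit z.2 i),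
      hlist (fun c => tl c z.1) z.1 fun i => (tl_eq_tailProd _ i).symm,
      hlist (fun c => (tl c z.1)⁻¹) _ fun i => by rw [tailProd_inv, tl_eq_tailProd]]

end MPLParity

theorem mainTheorem2 (d : ℕ) (hd : 1 ≤ d) (n : Fin d → ℕ) (hn : ∀ i, 1 ≤ n i) :
    (∀ z ∈ mplDomain d, ∃ F, IsMPLContinuation n z F) ∧
    (fun z : mplDomain d => pli n z.1) ∈
      Submodule.span ℚ {f : mplDomain d → ℂ | ∃ T : MPLProduct d,
        T.depth < d ∧ T.weight = ∑ i, n i ∧ T.WellDefined ∧ f = fun z => T.eval z.1} :=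
  ⟨fun _ hz => ⟨_, MPLParity.isMPLContinuation_Lw hn (MPLParity.tailProd_slit hz)⟩,
    Submodule.span_mono (MPLParity.gens_subset (by omega)) (MPLParity.pli_mem_polySpan d hd n hn)⟩
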